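/- Let $K$ be a field and let $(A,\Delta)$ be a regular multiplier Hopf algebra over $K$ (in the sense of Van Daele; $A$ is an associative $K$-algebra with non-degenerate product, not necessarily unital), with counit $\varepsilon$ and antipode $S$. Write $M(\cdot)$ for the multiplier algebra and $\iota$ for the identity map. Homomorphisms such as $\Delta\otimes\iota$, $\iota\otimes\Delta$, $\varepsilon\otimes\iota$, $\iota\otimes\varepsilon$ on $A\otimes A$, and the anti-homomorphism $S$ on $A$, are also extended to the multiplier algebras. Let $J\in M(A\otimes A)$ be an invertible multiplier such that 1. $(\Delta\otimes\iota)(J)\,(J\otimes 1)=(\iota\otimes\Delta)(J)\,(1\otimes J)$ in $M(A\otimes A\otimes A)$ ($J$ is a twist); 2. $(\varepsilon\otimes\iota)(J)=1=(\iota\otimes\varepsilon)(J)$ ($J$ is normalized); 3. for all $a\in A$, $J(1\otimes a)$ and $(1\otimes a)J$ belong to $M(A)\otimes A$, and $J(a\otimes 1)$ and $(a\otimes 1)J$ belong to $A\otimes M(A)$ ($J$ is general). Then there is a unique multiplier $Q_J=S(J^{(1)})J^{(2)}\in M(A)$ with $$Q_J\,a=m(S\otimes\iota)\big(J(1\otimes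 a)\big),\qquad a\,Q_J=m(S\otimes\iota)\big(J(S^{-1}(a)\otimes 1)\big)\qquad(a\in A),$$ where $m$ is the multiplication. It is invertible in $M(A)$, and the algebra $A$ with the comultiplication $$\Delta^J(a)=J^{-1}\Delta(a)J\qquad(a\in A)$$ is again a regular multiplier Hopf algebra $A^J$, whose counit is $\varepsilon$ and whose antipode is $$S^J(a)=Q_J^{-1}\,S(a)\,Q_J\qquad(a\in A).$$ -/

import Mathlib

open scoped TensorProduct

noncomputable section

namespace MulHopf

universe u v w

section Multipliers

variable (K : Type u) [Field K] (A : Type v) [NonUnitalRing A] [Module K A]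
  [IsScalarTower K A A] [SMulCommClass K A A]

/-- The product of `A` is non-degenerate. -/
structure Nondegenerate (A : Type v) [NonUnitalRing A] : Prop where
  left : ∀ a : A, (∀ b : A, a * b = 0) → a = 0
  right : ∀ b : A, (∀ a : A, a * b = 0) → b = 0

/-- The multiplier algebra `M(A)`, realised by pairs `(L, R)` of linear maps, `L b = m b` and
`R a = a m`, that satisfy `L (ab) = (L a) b`, `R (ab) = a (R b)` and `(R a) b = a (L b)`.
The second component lives in the opposite algebra, since `a (m n) = (a m) n`. -/
def multiplierAlgebra : Subalgebra K (Module.End K A × (Module.End K A)ᵐᵒᵖ) where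
  carrier := {x | (∀ a b : A, x.1 (a * b) = x.1 a * b) ∧
    (∀ a b : A, x.2.unop (a * b) = a * x.2.unop b) ∧
    ∀ a b : A, x.2.unop a * b = a * x.1 b}
  mul_mem' := by
    rintro x y ⟨hx1, hx2, hx3⟩ ⟨hy1, hy2, hy3⟩
    refine ⟨fun a b => ?_, fun a b => ?_, fun a b => ?_⟩
    · simp [hx1, hy1]
    · simp [hx2, hy2]
    · simp [hx3, hy3]
  add_mem' := by
    rintro x y ⟨hx1, hx2, hx3⟩ ⟨hy1, hy2, hy3⟩
    refine ⟨fun a b => ?_, fun a b => ?_, fun a b => ?_⟩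
    · simp [hx1, hy1, add_mul]
    · simp [hx2, hy2, mul_add]
    · simp [hx3, hy3, mul_add, add_mul]
  algebraMap_mem' := by
    intro r
    refine ⟨fun a b => ?_, fun a b => ?_, fun a b => ?_⟩ <;>
      simp [Prod.algebraMap_apply, MulOpposite.algebraMap_apply, Module.algebraMap_end_apply,
        smul_mul_assoc, mul_smul_comm]

/-- The type of multipliers of `A`, a unital `K`-algebra. -/
def Mult : Type v := multiplierAlgebra K A

instance : Ring (Mult K A) := inferInstanceAs (Ring (multiplierAlgebra K A))

instance : Algebra K (Mult K A) := inferInstanceAs (Algebra K (multiplierAlgebra K A))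

variable {K A}

/-- The element `m a` of `A`, for a multiplier `m` and `a` in `A`. -/
def lact (m : Mult K A) : A →ₗ[K] A := m.1.1

/-- The element `a m` of `A`, for a multiplier `m` and `a` in `A`. -/
def ract (m : Mult K A) : A →ₗ[K] A := m.1.2.unop

theorem Mult.ext' {m n : Mult K A} (hL : ∀ a, lact m a = lact n a)
    (hR : ∀ a, ract m a = ract n a) : m = n :=
  Subtype.ext (Prod.ext (LinearMap.ext hL) (MulOpposite.unop_injective (LinearMap.ext hR)))

theorem lact_mul_right (m : Mult K A) (a b : A) : lact m (a * b) = lact m a * b := m.2.1 a b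

theorem ract_mul_left (m : Mult K A) (a b : A) : ract m (a * b) = a * ract m b := m.2.2.1 a b

theorem ract_mul (m : Mult K A) (a b : A) : ract m a * b = a * lact m b := m.2.2.2 a b

@[simp] theorem lact_one : lact (1 : Mult K A) = LinearMap.id := rfl
@[simp] theorem ract_one : ract (1 : Mult K A) = LinearMap.id := rfl
@[simp] theorem lact_mul (m n : Mult K A) : lact (m * n) = lact m ∘ₗ lact n := rfl
@[simp] theorem ract_mul' (m n : Mult K A) : ract (m * n) = ract n ∘ₗ ract m := rfl
@[simp] theorem lact_zero : lact (0 : Mult K A) = 0 := rfl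
@[simp] theorem ract_zero : ract (0 : Mult K A) = 0 := rfl
@[simp] theorem lact_add (m n : Mult K A) : lact (m + n) = lact m + lact n := rfl
@[simp] theorem ract_add (m n : Mult K A) : ract (m + n) = ract m + ract n := rfl
@[simp] theorem lact_smul (r : K) (m : Mult K A) : lact (r • m) = r • lact m := rfl
@[simp] theorem ract_smul (r : K) (m : Mult K A) : ract (r • m) = r • ract m := rfl

/-- A multiplier from its left and right actions. -/
def Mult.mk' (L R : A →ₗ[K] A) (hL : ∀ a b, L (a * b) = L a * b)
    (hR : ∀ a b, R (a * b) = a * R b) (hLR : ∀ a b, R a * b = a * L b) : Mult K A :=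
  ⟨(L, MulOpposite.op R), hL, hR, hLR⟩

@[simp] theorem lact_mk' (L R : A →ₗ[K] A) (hL hR hLR) :
    lact (Mult.mk' L R hL hR hLR) = L := rfl
@[simp] theorem ract_mk' (L R : A →ₗ[K] A) (hL hR hLR) :
    ract (Mult.mk' L R hL hR hLR) = R := rfl

variable (K A)

/-- The canonical homomorphism `A → M(A)` (injective when the product is non-degenerate). -/
def emb : A →ₙₐ[K] Mult K A where
  toFun a := Mult.mk' (LinearMap.mulLeft K a) (LinearMap.mulRight K a)
    (fun b c => by simp [mul_assoc]) (fun b c => by simp [mul_assoc])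
    (fun b c => by simp [mul_assoc])
  map_smul' r a := Mult.ext' (fun b => smul_mul_assoc r a b) (fun b => mul_smul_comm r b a)
  map_zero' := Mult.ext' (fun b => zero_mul b) (fun b => mul_zero b)
  map_add' a a' := Mult.ext' (fun b => add_mul a a' b) (fun b => mul_add b a a')
  map_mul' a a' := Mult.ext' (fun b => mul_assoc a a' b) (fun b => (mul_assoc b a a').symm)

@[simp] theorem lact_emb (a b : A) : lact (emb K A a) b = a * b := rfl
@[simp] theorem ract_emb (a b : A) : ract (emb K A a) b = b * a := rfl

variable {K A}

end Multipliers

section Functoriality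

variable {K : Type u} [Field K]
  {A : Type v} [NonUnitalRing A] [Module K A] [IsScalarTower K A A] [SMulCommClass K A A]
  {B : Type w} [NonUnitalRing B] [Module K B] [IsScalarTower K B B] [SMulCommClass K B B]

/-- Transport of multipliers along a multiplicative linear equivalence `e : A ≃ B`. -/
def Mult.transport (e : A ≃ₗ[K] B) (he : ∀ x y, e (x * y) = e x * e y) :
    Mult K A →ₐ[K] Mult K B where
  toFun m := Mult.mk' (e.toLinearMap ∘ₗ lact m ∘ₗ e.symm.toLinearMap)
    (e.toLinearMap ∘ₗ ract m ∘ₗ e.symm.toLinearMap)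
    (fun a b => by
      obtain ⟨a, rfl⟩ := e.surjective a
      obtain ⟨b, rfl⟩ := e.surjective b
      simp [← he, lact_mul_right])
    (fun a b => by
      obtain ⟨a, rfl⟩ := e.surjective a
      obtain ⟨b, rfl⟩ := e.surjective b
      simp [← he, ract_mul_left])
    (fun a b => by
      obtain ⟨a, rfl⟩ := e.surjective a
      obtain ⟨b, rfl⟩ := e.surjective b
      simp [← he, ract_mul])
  map_one' := by
    apply Mult.ext' <;> intro a <;> simp
  map_mul' m n := by
    apply Mult.ext' <;> intro a <;> simp
  map_zero' := by
    apply Mult.ext' <;> intro a <;> simp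
  map_add' m n := by
    apply Mult.ext' <;> intro a <;> simp
  commutes' r := by
    rw [Algebra.algebraMap_eq_smul_one, Algebra.algebraMap_eq_smul_one]
    apply Mult.ext' <;> intro a <;> simp

/-- The canonical linear map `M(A) ⊗ M(B) → M(A ⊗ B)`, with
`(m ⊗ n)(a ⊗ b) = m a ⊗ n b` and `(a ⊗ b)(m ⊗ n) = a m ⊗ b n`. -/
def mtprod : Mult K A ⊗[K] Mult K B →ₗ[K] Mult K (A ⊗[K] B) :=
  TensorProduct.lift <| LinearMap.mk₂ K
    (fun m n => Mult.mk' (TensorProduct.map (lact m) (lact n)) (TensorProduct.map (ract m) (ract n))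
      (fun x y => by
        induction x with
        | zero => simp
        | add x x' hx hx' => simp [add_mul, hx, hx']
        | tmul a b =>
          induction y with
          | zero => simp
          | add y y' hy hy' => simp only [mul_add, map_add, hy, hy']
          | tmul a' b' => simp [lact_mul_right])
      (fun x y => by
        induction x with
        | zero => simp
        | add x x' hx hx' => simp [add_mul, hx, hx']
        | tmul a b =>
          induction y with
          | zero => simp
          | add y y' hy hy' => simp only [mul_add, map_add, hy, hy']
          | tmul a' b' => simp [ract_mul_left])
      (fun x y => by
        induction x with
        | zero => simp
        | add x x' hx hx' => simp [add_mul, hx, hx']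
        | tmul a b =>
          induction y with
          | zero => simp
          | add y y' hy hy' => simp only [mul_add, map_add, hy, hy']
          | tmul a' b' => simp [ract_mul]))
    (fun m m' n => by
      apply Mult.ext' <;> intro x
      · exact congrArg (fun f => f x) (TensorProduct.map_add_left (lact m) (lact m') (lact n))
      · exact congrArg (fun f => f x) (TensorProduct.map_add_left (ract m) (ract m') (ract n)))
    (fun r m n => by
      apply Mult.ext' <;> intro x
      · exact congrArg (fun f => f x) (TensorProduct.map_smul_left r (lact m) (lact n))
      · exact congrArg (fun f => f x) (TensorProduct.map_smul_left r (ract m) (ract n)))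
    (fun m n n' => by
      apply Mult.ext' <;> intro x
      · exact congrArg (fun f => f x) (TensorProduct.map_add_right (lact m) (lact n) (lact n'))
      · exact congrArg (fun f => f x) (TensorProduct.map_add_right (ract m) (ract n) (ract n')))
    (fun r m n => by
      apply Mult.ext' <;> intro x
      · exact congrArg (fun f => f x) (TensorProduct.map_smul_right r (lact m) (lact n))
      · exact congrArg (fun f => f x) (TensorProduct.map_smul_right r (ract m) (ract n)))

theorem comm_mul (x y : A ⊗[K] B) :
    TensorProduct.comm K A B (x * y) = TensorProduct.comm K A B x * TensorProduct.comm K A B y := by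
  induction x with
  | zero => simp
  | add x x' hx hx' => simp [add_mul, hx, hx']
  | tmul a b =>
    induction y with
    | zero => simp
    | add y y' hy hy' => simp only [mul_add, map_add, hy, hy']
    | tmul a' b' => simp

theorem assoc_symm_mul (x y : A ⊗[K] (A ⊗[K] A)) :
    (TensorProduct.assoc K A A A).symm (x * y) =
      (TensorProduct.assoc K A A A).symm x * (TensorProduct.assoc K A A A).symm y := by
  induction x with
  | zero => simp
  | add x x' hx hx' => simp [add_mul, hx, hx']
  | tmul a z =>
    induction y with
    | zero => simp
    | add y y' hy hy' => simp only [mul_add, map_add, hy, hy']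
    | tmul a' z' =>
      induction z with
      | zero => simp
      | add z t hz ht => simp only [TensorProduct.tmul_add, add_mul, map_add, hz, ht]
      | tmul b c =>
        induction z' with
        | zero => simp
        | add z t hz ht => simp only [TensorProduct.tmul_add, mul_add, map_add, hz, ht]
        | tmul b' c' => simp

/-- The flip `τ`, extended to `M(A ⊗ A)`. -/
def flipMult : Mult K (A ⊗[K] A) →ₐ[K] Mult K (A ⊗[K] A) :=
  Mult.transport (TensorProduct.comm K A A) comm_mul

/-- The identification of `M(A ⊗ (A ⊗ A))` with `M((A ⊗ A) ⊗ A)`. -/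
def assocMult : Mult K (A ⊗[K] (A ⊗[K] A)) →ₐ[K] Mult K ((A ⊗[K] A) ⊗[K] A) :=
  Mult.transport (TensorProduct.assoc K A A A).symm assoc_symm_mul

end Functoriality

section Extension

variable {K : Type u} [Field K]
  {B : Type v} [NonUnitalRing B] [Module K B] [IsScalarTower K B B] [SMulCommClass K B B]

/-- `n` is a value at the multiplier `m` of an extension to `M(B)` of the homomorphism `F`:
`n F(b) = F(m b)` and `F(b) n = F(b m)` for all `b` in `B`. -/
def IsExtension {R : Type w} [Semiring R] [Module K R] (F : B →ₗ[K] R) (m : Mult K B) (n : R) : Prop :=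
  ∀ b : B, n * F b = F (lact m b) ∧ F b * n = F (ract m b)

open Classical in
/-- The extension to `M(B)` of a non-degenerate homomorphism `F` from `B` into the algebra `R`
(where `R` is a multiplier algebra or its opposite). -/
def extend {R : Type w} [Semiring R] [Module K R] (F : B →ₗ[K] R) (m : Mult K B) : R :=
  if h : ∃ n, IsExtension F m n then h.choose else 0

variable {C : Type w} [NonUnitalRing C] [Module K C] [IsScalarTower K C C] [SMulCommClass K C C]

/-- A linear map `F : B → M(C)` is non-degenerate if `F(B) C` and `C F(B)` span `C`. -/
structure NondegenerateMap (F : B →ₗ[K] Mult K C) : Prop where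
  left : Submodule.span K {c | ∃ b d, c = lact (F b) d} = ⊤
  right : Submodule.span K {c | ∃ b d, c = ract (F b) d} = ⊤

/-- A non-degenerate homomorphism `B → M(C)` has exactly one extension to `M(B)`. -/
theorem existsUnique_extension (hC : Nondegenerate C) (F : B →ₙₐ[K] Mult K C)
    (hF : NondegenerateMap (F : B →ₗ[K] Mult K C)) (m : Mult K B) :
    ∃! n : Mult K C, IsExtension (F : B →ₗ[K] Mult K C) m n := by
  have hl := hF.left
  have hr := hF.right
  -- the left and the right action on elements of the spanning sets
  let lmap : Mult K C →ₗ[K] C →ₗ[K] C :=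
    { toFun := lact, map_add' := fun _ _ => rfl, map_smul' := fun _ _ => rfl }
  let rmap : Mult K C →ₗ[K] C →ₗ[K] C :=
    { toFun := ract, map_add' := fun _ _ => rfl, map_smul' := fun _ _ => rfl }
  let Fl : B →ₗ[K] Mult K C := (F : B →ₗ[K] Mult K C)
  let g : B ⊗[K] C →ₗ[K] C := TensorProduct.lift (lmap ∘ₗ Fl)
  let h : B ⊗[K] C →ₗ[K] C := TensorProduct.lift (lmap ∘ₗ Fl ∘ₗ lact m)
  let g' : B ⊗[K] C →ₗ[K] C := TensorProduct.lift (rmap ∘ₗ Fl)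
  let h' : B ⊗[K] C →ₗ[K] C := TensorProduct.lift (rmap ∘ₗ Fl ∘ₗ ract m)
  have hg : ∀ b c, g (b ⊗ₜ c) = lact (F b) c := fun b c => rfl
  have hh : ∀ b c, h (b ⊗ₜ c) = lact (F (lact m b)) c := fun b c => rfl
  have hg' : ∀ b c, g' (b ⊗ₜ c) = ract (F b) c := fun b c => rfl
  have hh' : ∀ b c, h' (b ⊗ₜ c) = ract (F (ract m b)) c := fun b c => rfl
  have gs : Function.Surjective g := by
    rw [← LinearMap.range_eq_top, eq_top_iff, ← hl, Submodule.span_le]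
    rintro _ ⟨b, d, rfl⟩
    exact ⟨b ⊗ₜ d, hg b d⟩
  have gs' : Function.Surjective g' := by
    rw [← LinearMap.range_eq_top, eq_top_iff, ← hr, Submodule.span_le]
    rintro _ ⟨b, d, rfl⟩
    exact ⟨b ⊗ₜ d, hg' b d⟩
  have zl : ∀ w : C, (∀ b, lact (F b) w = 0) → w = 0 := by
    intro w hw
    refine hC.right w fun c => ?_
    obtain ⟨z, rfl⟩ := gs' c
    induction z with
    | zero => simp
    | add x y hx hy => rw [map_add, add_mul, hx, hy, add_zero]
    | tmul b d => rw [hg', ract_mul, hw, mul_zero]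
  have zr : ∀ w : C, (∀ b, ract (F b) w = 0) → w = 0 := by
    intro w hw
    refine hC.left w fun c => ?_
    obtain ⟨z, rfl⟩ := gs c
    induction z with
    | zero => simp
    | add x y hx hy => rw [map_add, mul_add, hx, hy, add_zero]
    | tmul b d => rw [hg, ← ract_mul, hw, zero_mul]
  have kl : ∀ z, ∀ b', lact (F b') (h z) = lact (F (ract m b')) (g z) := by
    intro z b'
    induction z with
    | zero => simp
    | add x y hx hy => simp only [map_add, hx, hy]
    | tmul b d =>
      rw [hg, hh, ← LinearMap.comp_apply, ← LinearMap.comp_apply, ← lact_mul, ← lact_mul,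
        ← map_mul, ← map_mul, ract_mul]
  have kr : ∀ z, ∀ b', ract (F b') (h' z) = ract (F (lact m b')) (g' z) := by
    intro z b'
    induction z with
    | zero => simp
    | add x y hx hy => simp only [map_add, hx, hy]
    | tmul b d =>
      rw [hg', hh', ← LinearMap.comp_apply, ← LinearMap.comp_apply, ← ract_mul', ← ract_mul',
        ← map_mul, ← map_mul, ract_mul]
  obtain ⟨s, hs⟩ := g.exists_rightInverse_of_surjective (LinearMap.range_eq_top.2 gs)
  obtain ⟨s', hs'⟩ := g'.exists_rightInverse_of_surjective (LinearMap.range_eq_top.2 gs')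
  have hL : ∀ z, h (s (g z)) = h z := by
    intro z
    rw [← sub_eq_zero, ← map_sub]
    refine zl _ fun b => ?_
    rw [kl, map_sub, show g (s (g z)) = g z from LinearMap.congr_fun hs (g z), sub_self, map_zero]
  have hR : ∀ z, h' (s' (g' z)) = h' z := by
    intro z
    rw [← sub_eq_zero, ← map_sub]
    refine zr _ fun b => ?_
    rw [kr, map_sub, show g' (s' (g' z)) = g' z from LinearMap.congr_fun hs' (g' z), sub_self,
      map_zero]
  let L : C →ₗ[K] C := h ∘ₗ s
  let R : C →ₗ[K] C := h' ∘ₗ s'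
  have L1 : ∀ b c, L (lact (F b) c) = lact (F (lact m b)) c := fun b c => by
    rw [← hg, ← hh]; exact hL _
  have R1 : ∀ b c, R (ract (F b) c) = ract (F (ract m b)) c := fun b c => by
    rw [← hg', ← hh']; exact hR _
  refine ⟨Mult.mk' L R ?_ ?_ ?_, ?_, ?_⟩
  · intro a c
    obtain ⟨z, rfl⟩ := gs a
    induction z with
    | zero => simp
    | add x y hx hy => simp only [map_add, add_mul, hx, hy]
    | tmul b d => rw [hg, L1, ← lact_mul_right, L1, lact_mul_right]
  · intro a c
    obtain ⟨z, rfl⟩ := gs' c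
    induction z with
    | zero => simp
    | add x y hx hy => simp only [map_add, mul_add, hx, hy]
    | tmul b d => rw [hg', R1, ← ract_mul_left, R1, ract_mul_left]
  · intro a c
    obtain ⟨z, rfl⟩ := gs' a
    induction z with
    | zero => simp
    | add x y hx hy => simp only [map_add, add_mul, hx, hy]
    | tmul b d =>
      obtain ⟨t, rfl⟩ := gs c
      induction t with
      | zero => simp
      | add x y hx hy => simp only [map_add, mul_add, hx, hy]
      | tmul b' d' =>
        rw [hg, hg', L1, R1, ract_mul, ract_mul, ← LinearMap.comp_apply, ← LinearMap.comp_apply,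
          ← lact_mul, ← lact_mul, ← map_mul, ← map_mul, ract_mul]
  · intro b
    have e1 : ∀ c, lact (F b) (L c) = lact (F (ract m b)) c := fun c => by
      obtain ⟨z, rfl⟩ := gs c
      rw [show L (g z) = h z from hL z, kl]
    have e2 : ∀ c, ract (F b) (R c) = ract (F (lact m b)) c := fun c => by
      obtain ⟨z, rfl⟩ := gs' c
      rw [show R (g' z) = h' z from hR z, kr]
    exact ⟨Mult.ext' (fun c => L1 b c) (fun c => e2 c), Mult.ext' (fun c => e1 c) (fun c => R1 b c)⟩
  · intro n hn
    refine Mult.ext' (fun c => ?_) (fun c => ?_)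
    · obtain ⟨z, rfl⟩ := gs c
      induction z with
      | zero => simp
      | add x y hx hy => simp only [map_add, hx, hy]
      | tmul b d =>
        rw [hg]
        exact (congrArg (fun x => lact x d) (hn b).1).trans (L1 b d).symm
    · obtain ⟨z, rfl⟩ := gs' c
      induction z with
      | zero => simp
      | add x y hx hy => simp only [map_add, hx, hy]
      | tmul b d =>
        rw [hg']
        exact (congrArg (fun x => ract x d) (hn b).2).trans (R1 b d).symm

/-- The extension is what it should be: `extend F m` is the only value that it can have. -/
theorem extend_eq_iff (hC : Nondegenerate C) (F : B →ₙₐ[K] Mult K C)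
    (hF : NondegenerateMap (F : B →ₗ[K] Mult K C)) (m : Mult K B) (n : Mult K C) :
    extend (F : B →ₗ[K] Mult K C) m = n ↔ IsExtension (F : B →ₗ[K] Mult K C) m n := by
  have hu := existsUnique_extension hC F hF m
  have hs : IsExtension (F : B →ₗ[K] Mult K C) m (extend (F : B →ₗ[K] Mult K C) m) := by
    unfold extend
    rw [dif_pos hu.exists]
    exact hu.exists.choose_spec
  exact ⟨fun h => h ▸ hs, fun h => hu.unique hs h⟩

end Extension

section HopfStructure

variable {K : Type u} [Field K]
  {A : Type v} [NonUnitalRing A] [Module K A] [IsScalarTower K A A] [SMulCommClass K A A]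

/-- The map `T₁ : a ⊗ b ↦ Δ(a)(1 ⊗ b)`, with values in `M(A ⊗ A)`. -/
def T₁ (Δ : A →ₙₐ[K] Mult K (A ⊗[K] A)) : A ⊗[K] A →ₗ[K] Mult K (A ⊗[K] A) :=
  TensorProduct.lift <| (LinearMap.mul K (Mult K (A ⊗[K] A))).compl₁₂ (Δ : A →ₗ[K] _)
    (mtprod ∘ₗ TensorProduct.mk K (Mult K A) (Mult K A) 1 ∘ₗ (emb K A : A →ₗ[K] Mult K A))

/-- The map `T₂ : a ⊗ b ↦ (a ⊗ 1)Δ(b)`, with values in `M(A ⊗ A)`. -/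
def T₂ (Δ : A →ₙₐ[K] Mult K (A ⊗[K] A)) : A ⊗[K] A →ₗ[K] Mult K (A ⊗[K] A) :=
  TensorProduct.lift <| (LinearMap.mul K (Mult K (A ⊗[K] A))).compl₁₂
    (mtprod ∘ₗ (TensorProduct.mk K (Mult K A) (Mult K A)).flip 1 ∘ₗ (emb K A : A →ₗ[K] Mult K A))
    (Δ : A →ₗ[K] _)

/-- The homomorphism `Δ ⊗ ι : A ⊗ A → M(A ⊗ A ⊗ A)`. -/
def comulLeft (Δ : A →ₙₐ[K] Mult K (A ⊗[K] A)) :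
    A ⊗[K] A →ₗ[K] Mult K ((A ⊗[K] A) ⊗[K] A) :=
  mtprod ∘ₗ TensorProduct.map (Δ : A →ₗ[K] _) (emb K A : A →ₗ[K] Mult K A)

/-- The homomorphism `ι ⊗ Δ : A ⊗ A → M(A ⊗ A ⊗ A)`. -/
def comulRight (Δ : A →ₙₐ[K] Mult K (A ⊗[K] A)) :
    A ⊗[K] A →ₗ[K] Mult K ((A ⊗[K] A) ⊗[K] A) :=
  assocMult.toLinearMap ∘ₗ mtprod ∘ₗ
    TensorProduct.map (emb K A : A →ₗ[K] Mult K A) (Δ : A →ₗ[K] _)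

/-- `(A, Δ)` is a multiplier Hopf algebra. The elements `Δ(a)(1 ⊗ b)` and `(a ⊗ 1)Δ(b)` belong to
`A ⊗ A`, and `T₁`, `T₂` are bijections of `A ⊗ A` onto (the image in `M(A ⊗ A)` of) `A ⊗ A`. -/
structure IsMultiplierHopf (Δ : A →ₙₐ[K] Mult K (A ⊗[K] A)) : Prop where
  nondegenerate : Nondegenerate A
  mem₁ : ∀ a b : A, ∃ z, emb K (A ⊗[K] A) z = Δ a * mtprod (1 ⊗ₜ emb K A b)
  mem₂ : ∀ a b : A, ∃ z, emb K (A ⊗[K] A) z = mtprod (emb K A a ⊗ₜ 1) * Δ b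
  /-- `(a ⊗ 1 ⊗ 1)(Δ ⊗ ι)(Δ(b)(1 ⊗ c)) = (ι ⊗ Δ)((a ⊗ 1)Δ(b))(1 ⊗ 1 ⊗ c)` -/
  coassoc : ∀ (a b c : A) (z w : A ⊗[K] A),
    emb K (A ⊗[K] A) z = Δ b * mtprod (1 ⊗ₜ emb K A c) →
    emb K (A ⊗[K] A) w = mtprod (emb K A a ⊗ₜ 1) * Δ b →
    mtprod (mtprod (emb K A a ⊗ₜ 1) ⊗ₜ 1) * comulLeft Δ z =
      comulRight Δ w * mtprod (1 ⊗ₜ emb K A c)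
  injective₁ : Function.Injective (T₁ Δ)
  range₁ : LinearMap.range (T₁ Δ) =
    LinearMap.range (emb K (A ⊗[K] A) : A ⊗[K] A →ₗ[K] Mult K (A ⊗[K] A))
  injective₂ : Function.Injective (T₂ Δ)
  range₂ : LinearMap.range (T₂ Δ) =
    LinearMap.range (emb K (A ⊗[K] A) : A ⊗[K] A →ₗ[K] Mult K (A ⊗[K] A))

/-- The co-opposite comultiplication `τ ∘ Δ`. -/
def coop (Δ : A →ₙₐ[K] Mult K (A ⊗[K] A)) : A →ₙₐ[K] Mult K (A ⊗[K] A) :=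
  ((flipMult : Mult K (A ⊗[K] A) →ₐ[K] Mult K (A ⊗[K] A)) :
    Mult K (A ⊗[K] A) →ₙₐ[K] Mult K (A ⊗[K] A)).comp Δ

/-- `(A, Δ)` is a regular multiplier Hopf algebra. -/
structure IsRegularMultiplierHopf (Δ : A →ₙₐ[K] Mult K (A ⊗[K] A)) : Prop where
  isMultiplierHopf : IsMultiplierHopf Δ
  coop_isMultiplierHopf : IsMultiplierHopf (coop Δ)

/-- The map `ε ⊗ ι : A ⊗ A → A`. -/
def counitLeft (ε : A →ₙₐ[K] K) : A ⊗[K] A →ₗ[K] A :=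
  (TensorProduct.lid K A).toLinearMap ∘ₗ TensorProduct.map (ε : A →ₗ[K] K) LinearMap.id

/-- The map `ι ⊗ ε : A ⊗ A → A`. -/
def counitRight (ε : A →ₙₐ[K] K) : A ⊗[K] A →ₗ[K] A :=
  (TensorProduct.rid K A).toLinearMap ∘ₗ TensorProduct.map LinearMap.id (ε : A →ₗ[K] K)

/-- The homomorphism `ε : A → K` is the counit of `(A, Δ)`:
`(ε ⊗ ι)(Δ(a)(1 ⊗ b)) = ab` and `(ι ⊗ ε)((a ⊗ 1)Δ(b)) = ab`. -/
structure IsCounit (Δ : A →ₙₐ[K] Mult K (A ⊗[K] A)) (ε : A →ₙₐ[K] K) : Prop where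
  left : ∀ (a b : A) (z : A ⊗[K] A),
    emb K (A ⊗[K] A) z = Δ a * mtprod (1 ⊗ₜ emb K A b) → counitLeft ε z = a * b
  right : ∀ (a b : A) (z : A ⊗[K] A),
    emb K (A ⊗[K] A) z = mtprod (emb K A a ⊗ₜ 1) * Δ b → counitRight ε z = a * b

/-- The anti-homomorphism `S : A → M(A)` is the antipode of `(A, Δ)` with counit `ε`:
`m(S ⊗ ι)(Δ(a)(1 ⊗ b)) = ε(a)b` and `m(ι ⊗ S)((a ⊗ 1)Δ(b)) = ε(b)a`. -/
structure IsAntipode (Δ : A →ₙₐ[K] Mult K (A ⊗[K] A)) (ε : A →ₙₐ[K] K) (S : A →ₗ[K] Mult K A) :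
    Prop where
  map_mul : ∀ a b : A, S (a * b) = S b * S a
  left : ∀ (a b : A) (z : A ⊗[K] A),
    emb K (A ⊗[K] A) z = Δ a * mtprod (1 ⊗ₜ emb K A b) →
    LinearMap.mul' K (Mult K A) (TensorProduct.map S (emb K A : A →ₗ[K] Mult K A) z) =
      emb K A (ε a • b)
  right : ∀ (a b : A) (z : A ⊗[K] A),
    emb K (A ⊗[K] A) z = mtprod (emb K A a ⊗ₜ 1) * Δ b →
    LinearMap.mul' K (Mult K A) (TensorProduct.map (emb K A : A →ₗ[K] Mult K A) S z) =
      emb K A (ε b • a)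

/-- The extension to `M(A)` of an anti-homomorphism `S : A → M(A)`, characterised by
`S(a) S(m) = S(m a)` and `S(m) S(a) = S(a m)`. -/
def extendAnti (S : A →ₗ[K] Mult K A) (m : Mult K A) : Mult K A :=
  (extend ((MulOpposite.opLinearEquiv K).toLinearMap ∘ₗ S) m).unop

/-- The subspace `M(A) ⊗ A` of `M(A ⊗ A)`. -/
def multTensor (K : Type u) [Field K] (A : Type v) [NonUnitalRing A] [Module K A]
    [IsScalarTower K A A] [SMulCommClass K A A] : Submodule K (Mult K (A ⊗[K] A)) :=
  LinearMap.range (mtprod ∘ₗ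
    TensorProduct.map (LinearMap.id : Mult K A →ₗ[K] Mult K A) (emb K A : A →ₗ[K] Mult K A))

/-- The subspace `A ⊗ M(A)` of `M(A ⊗ A)`. -/
def tensorMult (K : Type u) [Field K] (A : Type v) [NonUnitalRing A] [Module K A]
    [IsScalarTower K A A] [SMulCommClass K A A] : Submodule K (Mult K (A ⊗[K] A)) :=
  LinearMap.range (mtprod ∘ₗ
    TensorProduct.map (emb K A : A →ₗ[K] Mult K A) (LinearMap.id : Mult K A →ₗ[K] Mult K A))

/-- The invertible multiplier `J` of `A ⊗ A` is a normalized general twist for `(A, Δ)`. -/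
structure IsGeneralTwist (Δ : A →ₙₐ[K] Mult K (A ⊗[K] A)) (ε : A →ₙₐ[K] K)
    (J : (Mult K (A ⊗[K] A))ˣ) : Prop where
  /-- `(Δ ⊗ ι)(J)(J ⊗ 1) = (ι ⊗ Δ)(J)(1 ⊗ J)` in `M(A ⊗ A ⊗ A)` -/
  twist : extend (comulLeft Δ) (J : Mult K (A ⊗[K] A)) * mtprod ((J : Mult K (A ⊗[K] A)) ⊗ₜ 1) =
    extend (comulRight Δ) (J : Mult K (A ⊗[K] A)) *
      assocMult (mtprod (1 ⊗ₜ (J : Mult K (A ⊗[K] A))))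
  /-- `(ε ⊗ ι)(J) = 1` -/
  normalized_left : extend ((emb K A : A →ₗ[K] Mult K A) ∘ₗ counitLeft ε)
    (J : Mult K (A ⊗[K] A)) = 1
  /-- `(ι ⊗ ε)(J) = 1` -/
  normalized_right : extend ((emb K A : A →ₗ[K] Mult K A) ∘ₗ counitRight ε)
    (J : Mult K (A ⊗[K] A)) = 1
  mul_right_mem : ∀ a : A, (J : Mult K (A ⊗[K] A)) * mtprod (1 ⊗ₜ emb K A a) ∈ multTensor K A
  right_mul_mem : ∀ a : A, mtprod (1 ⊗ₜ emb K A a) * (J : Mult K (A ⊗[K] A)) ∈ multTensor K A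
  mul_left_mem : ∀ a : A, (J : Mult K (A ⊗[K] A)) * mtprod (emb K A a ⊗ₜ 1) ∈ tensorMult K A
  left_mul_mem : ∀ a : A, mtprod (emb K A a ⊗ₜ 1) * (J : Mult K (A ⊗[K] A)) ∈ tensorMult K A

/-- The twisted comultiplication `Δ^J(a) = J⁻¹ Δ(a) J`. -/
def twistComul (Δ : A →ₙₐ[K] Mult K (A ⊗[K] A)) (J : (Mult K (A ⊗[K] A))ˣ) :
    A →ₙₐ[K] Mult K (A ⊗[K] A) where
  toFun a := ↑J⁻¹ * Δ a * ↑J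
  map_smul' r a := by simp
  map_zero' := by simp
  map_add' a b := by simp [mul_add, add_mul]
  map_mul' a b := by simp [mul_assoc]

/-- The multiplier `Q` is `Q_J = S(J⁽¹⁾)J⁽²⁾`, that is, `Q a = m(S ⊗ ι)(J(1 ⊗ a))` and
`a Q = m(S ⊗ ι)(J(S⁻¹(a) ⊗ 1))` for all `a` in `A`. In the first formula `J(1 ⊗ a)` is an element
`∑ mᵢ ⊗ bᵢ` of `M(A) ⊗ A`, and `S` is extended to `M(A)`; in the second one `J(S⁻¹(a) ⊗ 1)` is an
element `∑ bᵢ ⊗ mᵢ` of `A ⊗ M(A)`. -/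
structure IsTwistMultiplier (S : A →ₗ[K] Mult K A) (J : Mult K (A ⊗[K] A)) (Q : Mult K A) :
    Prop where
  left : ∀ (a : A) (n : ℕ) (m : Fin n → Mult K A) (b : Fin n → A),
    J * mtprod (1 ⊗ₜ emb K A a) = ∑ i, mtprod (m i ⊗ₜ emb K A (b i)) →
    lact Q a = ∑ i, lact (extendAnti S (m i)) (b i)
  right : ∀ (a c : A) (n : ℕ) (b : Fin n → A) (m : Fin n → Mult K A),
    S c = emb K A a →
    J * mtprod (emb K A c ⊗ₜ 1) = ∑ i, mtprod (emb K A (b i) ⊗ₜ m i) →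
    emb K A (ract Q a) = ∑ i, S (b i) * m i

/-- The map `a ↦ Q⁻¹ S(a) Q`. -/
def twistAntipode (S : A →ₗ[K] Mult K A) (Q : (Mult K A)ˣ) : A →ₗ[K] Mult K A where
  toFun a := ↑Q⁻¹ * S a * ↑Q
  map_add' a b := by simp [mul_add, add_mul]
  map_smul' r a := by simp

end HopfStructure

end MulHopf

end

/-!
Write `C(x ⊗ y) = S(x)y`. In the regular case `S` is a bijection `σ` of `A`
(`IsAntipode.exists_linearEquiv`): the antipode `S'` of the co-opposite comultiplication satisfies
`S(S'(x)y) = S(y)x`, so that `S(A) ⊆ A`, and `S'` is the inverse of `S`. The generality of `J`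
provides a multiplier `Q` with `S(c)Qa = C(J(c ⊗ a))` (`exists_isContraction`), and this relation
describes `Q` without reference to decompositions of `J`.

Since `C(Δ(a)z) = ε(a)C(z)`, contracting the first two, respectively the last two, legs of the twist
equation turns `(Δ ⊗ ι)(J)`, respectively `(ι ⊗ Δ)(J)`, into `1` by normalization. What is left are
the two formulas that carry the proof, `IsGeneralTwist.emb_canon₂` and
`IsGeneralTwist.ract_canon₁_symm`:
`(S(J⁽¹⁾c) ⊗ 1)Δ(J⁽²⁾d) = (S(c)Q ⊗ 1)J⁻¹Δ(d)` and
`(ι ⊗ S⁻¹)(T₁⁻¹(Δ(a)J(1 ⊗ b)))J = a ⊗ S⁻¹(Qb)`, where `T₁(p ⊗ q) = Δ(p)(1 ⊗ q)`.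

Once `Q` is known to be invertible, these formulas factor the canonical maps of `Δ^J` into
bijections of `A ⊗ A`: the canonical maps of `Δ`, the map `S` on one leg, and the actions of `J` and
`Q` (`IsGeneralTwist.isMultiplierHopf`). Coassociativity is a computation with the twist equation in
the unital algebra `M(A ⊗ A ⊗ A)`, and the counit is checked by extending `ε ⊗ ι` and `ι ⊗ ε` to
multipliers. The antipode is determined by `m(S ⊗ ι)(Δ(a)(1 ⊗ b)) = ε(a)b` alone
(`eq_antipodeMap`), and `Q⁻¹S(·)Q` has this property for `Δ^J`. Regularity is the same statement for
the co-opposite comultiplication and the flipped twist (`coop_twistComul`, `IsGeneralTwist.coop`).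

The invertibility of `Q` is the delicate point. The conditions of generality concern `J` and not
`J⁻¹`, so the formula `J⁻⁽¹⁾S(J⁻⁽²⁾)` for the inverse is not available. Instead, `QA = A` is shown
by duality (`IsGeneralTwist.surjective_lact`). Let the functional `f` vanish on `QA`, and let
`J(1 ⊗ d) = ∑ mᵢ ⊗ dᵢ`. By the first formula above, the element
`∑ (S(mᵢ) ⊗ x ⊗ 1)(ι ⊗ Δ)(Δ(dᵢ))(1 ⊗ 1 ⊗ c)` of `A ⊗ A ⊗ A` has a left factor `Q ⊗ 1 ⊗ 1`, so its
slices by `f(· e)` in the first leg vanish for all `e` in `A`. Contracting its first two legs by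
`m(ι ⊗ S)` and applying `f` therefore gives `0`, that is, `(f ∘ S ⊗ ι)((x ⊗ 1)J(1 ⊗ d)) = 0` for all
`x` and `d`, and `f = 0` since `J` is invertible. The
multiplier of the flipped twist is `S⁻¹(Q)` (`IsContraction.ract_eq`), which gives `AQ = A`.
-/

set_option linter.unusedSectionVars false

noncomputable section

namespace MulHopf

universe u v w

/-! ### Tensor products of vector spaces -/

section TensorKernel

variable {K : Type*} [Field K] {M M' N : Type*} [AddCommGroup M] [Module K M]
  [AddCommGroup M'] [Module K M'] [AddCommGroup N] [Module K N]

/-- Over a field, an element of `M ⊗ N` killed by all `g i ⊗ ι` lies in `(⋂ i, ker (g i)) ⊗ N`. -/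
theorem mem_span_of_forall_map_left_eq_zero {ι : Type*} (g : ι → M →ₗ[K] M') (y : M ⊗[K] N)
    (hy : ∀ i, TensorProduct.map (g i) (LinearMap.id : N →ₗ[K] N) y = 0) :
    y ∈ Submodule.span K {t : M ⊗[K] N | ∃ a u, (∀ i, g i a = 0) ∧ t = a ⊗ₜ u} := by
  classical
  let 𝓑 := Module.Basis.ofVectorSpace K N
  obtain ⟨b, rfl⟩ := TensorProduct.eq_repr_basis_right 𝓑 y
  have h0 : ∀ i k, g i (b k) = 0 := by
    intro i k
    have h := hy i
    rw [map_finsuppSum] at h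
    have h1 : ((b.mapRange (g i) (map_zero _)).sum fun k m => m ⊗ₜ[K] 𝓑 k) = 0 := by
      rw [Finsupp.sum_mapRange_index (by simp)]
      simpa using h
    have h2 := TensorProduct.sum_tmul_basis_right_eq_zero 𝓑 _ h1
    simpa using DFunLike.congr_fun h2 k
  exact Submodule.sum_mem _ fun k _ => Submodule.subset_span ⟨b k, 𝓑 k, fun i => h0 i k, rfl⟩

theorem eq_zero_of_forall_map_left_eq_zero {ι : Type*} (g : ι → M →ₗ[K] M')
    (hg : ∀ a, (∀ i, g i a = 0) → a = 0) (y : M ⊗[K] N)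
    (hy : ∀ i, TensorProduct.map (g i) (LinearMap.id : N →ₗ[K] N) y = 0) : y = 0 := by
  have h := mem_span_of_forall_map_left_eq_zero g y hy
  have h' : {t : M ⊗[K] N | ∃ a u, (∀ i, g i a = 0) ∧ t = a ⊗ₜ u} ⊆
      (⊥ : Submodule K (M ⊗[K] N)) := by
    rintro _ ⟨a, u, ha, rfl⟩
    simp [hg a ha]
  simpa using Submodule.span_le.2 h' h

theorem eq_zero_of_forall_map_right_eq_zero {ι : Type*} (g : ι → M →ₗ[K] M')
    (hg : ∀ a, (∀ i, g i a = 0) → a = 0) (y : N ⊗[K] M)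
    (hy : ∀ i, TensorProduct.map (LinearMap.id : N →ₗ[K] N) (g i) y = 0) : y = 0 := by
  have h : TensorProduct.comm K N M y = 0 := by
    refine eq_zero_of_forall_map_left_eq_zero g hg _ fun i => ?_
    rw [TensorProduct.map_comm, hy i, map_zero]
  simpa using h

end TensorKernel

/-! ### Multipliers of an algebra and of a tensor product -/

section Basics

variable {K : Type u} [Field K]
  {A : Type v} [NonUnitalRing A] [Module K A] [IsScalarTower K A A] [SMulCommClass K A A]
  {B : Type w} [NonUnitalRing B] [Module K B] [IsScalarTower K B B] [SMulCommClass K B B]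

theorem mul_emb (m : Mult K A) (a : A) : m * emb K A a = emb K A (lact m a) :=
  Mult.ext' (fun b => by simp [lact_mul_right]) (fun b => by simp [ract_mul])

theorem emb_mul (m : Mult K A) (a : A) : emb K A a * m = emb K A (ract m a) :=
  Mult.ext' (fun b => by simp [ract_mul]) (fun b => by simp [ract_mul_left])

theorem emb_injective (hA : Nondegenerate A) : Function.Injective (emb K A) := by
  intro a b h
  rw [← sub_eq_zero]
  refine hA.left _ fun c => ?_
  rw [sub_mul, sub_eq_zero]
  exact LinearMap.congr_fun (congrArg lact h) c

theorem Mult.ext_lact (hA : Nondegenerate A) {m n : Mult K A} (h : ∀ a, lact m a = lact n a) :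
    m = n := by
  refine Mult.ext' h fun a => ?_
  rw [← sub_eq_zero]
  refine hA.left _ fun c => ?_
  rw [sub_mul, sub_eq_zero, ract_mul, ract_mul, h]

theorem Mult.ext_mul_emb (hA : Nondegenerate A) {m n : Mult K A}
    (h : ∀ a, m * emb K A a = n * emb K A a) : m = n :=
  Mult.ext_lact hA fun a => emb_injective hA (by rw [← mul_emb, ← mul_emb, h])

theorem Mult.ext_emb_mul (hA : Nondegenerate A) {m n : Mult K A}
    (h : ∀ a, emb K A a * m = emb K A a * n) : m = n := by
  refine Mult.ext_lact hA fun a => ?_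
  rw [← sub_eq_zero]
  refine hA.right _ fun c => ?_
  rw [mul_sub, sub_eq_zero, ← ract_mul, ← ract_mul]
  exact congrArg (· * a) (emb_injective hA (by rw [← emb_mul, ← emb_mul, h]))

theorem lact_lact (m n : Mult K A) (a : A) : lact m (lact n a) = lact (m * n) a := rfl

theorem ract_ract (m n : Mult K A) (a : A) : ract m (ract n a) = ract (n * m) a := rfl

theorem mtprod_mul (m m' : Mult K A) (n n' : Mult K B) :
    mtprod (m ⊗ₜ n) * mtprod (m' ⊗ₜ n') = mtprod ((m * m') ⊗ₜ[K] (n * n')) := by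
  apply Mult.ext' <;> intro x
  · exact (LinearMap.congr_fun
      (TensorProduct.map_comp (lact m) (lact n) (lact m') (lact n')) x).symm
  · exact (LinearMap.congr_fun
      (TensorProduct.map_comp (ract m') (ract n') (ract m) (ract n)) x).symm

theorem mtprod_one : mtprod ((1 : Mult K A) ⊗ₜ[K] (1 : Mult K B)) = 1 := by
  apply Mult.ext' <;> intro x
  · exact LinearMap.congr_fun TensorProduct.map_id x
  · exact LinearMap.congr_fun TensorProduct.map_id x

theorem lact_mtprod (m : Mult K A) (n : Mult K B) :
    lact (mtprod (m ⊗ₜ[K] n)) = TensorProduct.map (lact m) (lact n) := rfl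

@[simp] theorem lact_mtprod_tmul (m : Mult K A) (n : Mult K B) (a : A) (b : B) :
    lact (mtprod (m ⊗ₜ[K] n)) (a ⊗ₜ b) = lact m a ⊗ₜ lact n b := rfl

@[simp] theorem ract_mtprod_tmul (m : Mult K A) (n : Mult K B) (a : A) (b : B) :
    ract (mtprod (m ⊗ₜ[K] n)) (a ⊗ₜ b) = ract m a ⊗ₜ ract n b := rfl

theorem mtprod_emb (a : A) (b : B) :
    mtprod (emb K A a ⊗ₜ[K] emb K B b) = emb K (A ⊗[K] B) (a ⊗ₜ b) := by
  apply Mult.ext' <;> intro x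
  · induction x with
    | zero => simp
    | add x y hx hy => rw [map_add, map_add, hx, hy]
    | tmul c d => simp
  · induction x with
    | zero => simp
    | add x y hx hy => rw [map_add, map_add, hx, hy]
    | tmul c d => simp

/-- The homomorphism `m ↦ m ⊗ 1` of multiplier algebras. -/
def leftLeg (K : Type u) [Field K]
    (A : Type v) [NonUnitalRing A] [Module K A] [IsScalarTower K A A] [SMulCommClass K A A]
    (B : Type w) [NonUnitalRing B] [Module K B] [IsScalarTower K B B] [SMulCommClass K B B] :
    Mult K A →ₐ[K] Mult K (A ⊗[K] B) :=
  AlgHom.ofLinearMap (mtprod ∘ₗ (TensorProduct.mk K (Mult K A) (Mult K B)).flip 1) mtprod_one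
    (fun m n => by
      change mtprod ((m * n) ⊗ₜ 1) = mtprod (m ⊗ₜ 1) * mtprod (n ⊗ₜ 1)
      rw [mtprod_mul, mul_one])

/-- The homomorphism `m ↦ 1 ⊗ m` of multiplier algebras. -/
def rightLeg (K : Type u) [Field K]
    (A : Type v) [NonUnitalRing A] [Module K A] [IsScalarTower K A A] [SMulCommClass K A A]
    (B : Type w) [NonUnitalRing B] [Module K B] [IsScalarTower K B B] [SMulCommClass K B B] :
    Mult K B →ₐ[K] Mult K (A ⊗[K] B) :=
  AlgHom.ofLinearMap (mtprod ∘ₗ TensorProduct.mk K (Mult K A) (Mult K B) 1) mtprod_one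
    (fun m n => by
      change mtprod (1 ⊗ₜ (m * n)) = mtprod (1 ⊗ₜ m) * mtprod (1 ⊗ₜ n)
      rw [mtprod_mul, mul_one])

theorem leftLeg_apply (m : Mult K A) : leftLeg K A B m = mtprod (m ⊗ₜ 1) := rfl

theorem rightLeg_apply (m : Mult K B) : rightLeg K A B m = mtprod (1 ⊗ₜ m) := rfl

theorem leftLeg_mul_rightLeg (m : Mult K A) (n : Mult K B) :
    leftLeg K A B m * rightLeg K A B n = mtprod (m ⊗ₜ n) := by
  rw [leftLeg_apply, rightLeg_apply, mtprod_mul, mul_one, one_mul]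

theorem rightLeg_mul_leftLeg (m : Mult K A) (n : Mult K B) :
    rightLeg K A B n * leftLeg K A B m = mtprod (m ⊗ₜ n) := by
  rw [leftLeg_apply, rightLeg_apply, mtprod_mul, mul_one, one_mul]

@[simp] theorem lact_leftLeg_tmul (m : Mult K A) (a : A) (b : B) :
    lact (leftLeg K A B m) (a ⊗ₜ b) = lact m a ⊗ₜ b := rfl

@[simp] theorem lact_rightLeg_tmul (m : Mult K B) (a : A) (b : B) :
    lact (rightLeg K A B m) (a ⊗ₜ b) = a ⊗ₜ lact m b := rfl

@[simp] theorem ract_leftLeg_tmul (m : Mult K A) (a : A) (b : B) :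
    ract (leftLeg K A B m) (a ⊗ₜ b) = ract m a ⊗ₜ b := rfl

@[simp] theorem ract_rightLeg_tmul (m : Mult K B) (a : A) (b : B) :
    ract (rightLeg K A B m) (a ⊗ₜ b) = a ⊗ₜ ract m b := rfl

theorem eq_zero_of_lact_leftLeg (hA : Nondegenerate A) (z : A ⊗[K] B)
    (h : ∀ a, lact (leftLeg K A B (emb K A a)) z = 0) : z = 0 :=
  eq_zero_of_forall_map_left_eq_zero (fun a => lact (emb K A a)) (fun b hb => hA.right b hb) z h

theorem eq_zero_of_ract_leftLeg (hA : Nondegenerate A) (z : A ⊗[K] B)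
    (h : ∀ a, ract (leftLeg K A B (emb K A a)) z = 0) : z = 0 :=
  eq_zero_of_forall_map_left_eq_zero (fun a => ract (emb K A a)) (fun b hb => hA.left b hb) z h

theorem eq_zero_of_lact_rightLeg (hB : Nondegenerate B) (z : A ⊗[K] B)
    (h : ∀ b, lact (rightLeg K A B (emb K B b)) z = 0) : z = 0 :=
  eq_zero_of_forall_map_right_eq_zero (fun a => lact (emb K B a)) (fun b hb => hB.right b hb) z h

theorem eq_zero_of_ract_rightLeg (hB : Nondegenerate B) (z : A ⊗[K] B)
    (h : ∀ b, ract (rightLeg K A B (emb K B b)) z = 0) : z = 0 :=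
  eq_zero_of_forall_map_right_eq_zero (fun a => ract (emb K B a)) (fun b hb => hB.left b hb) z h

theorem lact_leftLeg_cancel (hA : Nondegenerate A) {z t : A ⊗[K] B}
    (h : ∀ a, lact (leftLeg K A B (emb K A a)) z = lact (leftLeg K A B (emb K A a)) t) : z = t :=
  sub_eq_zero.1 (eq_zero_of_lact_leftLeg hA _ fun a => by rw [map_sub, h, sub_self])

theorem ract_rightLeg_cancel (hB : Nondegenerate B) {z t : A ⊗[K] B}
    (h : ∀ b, ract (rightLeg K A B (emb K B b)) z = ract (rightLeg K A B (emb K B b)) t) : z = t :=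
  sub_eq_zero.1 (eq_zero_of_ract_rightLeg hB _ fun a => by rw [map_sub, h, sub_self])

theorem Nondegenerate.tensor (hA : Nondegenerate A) (hB : Nondegenerate B) :
    Nondegenerate (A ⊗[K] B) where
  left z hz := by
    refine eq_zero_of_ract_leftLeg hA z fun a => eq_zero_of_ract_rightLeg hB _ fun b => ?_
    rw [ract_ract, leftLeg_mul_rightLeg, mtprod_emb]
    exact hz (a ⊗ₜ b)
  right z hz := by
    refine eq_zero_of_lact_leftLeg hA z fun a => eq_zero_of_lact_rightLeg hB _ fun b => ?_
    rw [lact_lact, rightLeg_mul_leftLeg, mtprod_emb]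
    exact hz (a ⊗ₜ b)

/-- If `A` is spanned by products, every element of `A ⊗ B` is a sum of `(1 ⊗ b) z`. -/
theorem span_lact_rightLeg (hsp : Submodule.span K {c : B | ∃ a b, c = a * b} = ⊤) :
    Submodule.span K {t : A ⊗[K] B | ∃ b z, t = lact (rightLeg K A B (emb K B b)) z} = ⊤ := by
  rw [eq_top_iff, ← TensorProduct.span_tmul_eq_top, Submodule.span_le]
  rintro _ ⟨x, y, rfl⟩
  have hy : y ∈ Submodule.span K {c : B | ∃ a b, c = a * b} := hsp ▸ Submodule.mem_top
  induction hy using Submodule.span_induction with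
  | mem y hy =>
    obtain ⟨a, b, rfl⟩ := hy
    exact Submodule.subset_span ⟨a, x ⊗ₜ b, rfl⟩
  | zero => simp
  | add y y' _ _ h h' => rw [TensorProduct.tmul_add]; exact Submodule.add_mem _ h h'
  | smul r y _ h => rw [TensorProduct.tmul_smul]; exact Submodule.smul_mem _ r h

end Basics

/-! ### Extension of non-degenerate homomorphisms -/

section ExtendHom

variable {K : Type u} [Field K]
  {B : Type v} [NonUnitalRing B] [Module K B] [IsScalarTower K B B] [SMulCommClass K B B]
  {C : Type w} [NonUnitalRing C] [Module K C] [IsScalarTower K C C] [SMulCommClass K C C]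

theorem isExtension_extend (hC : Nondegenerate C) (F : B →ₙₐ[K] Mult K C)
    (hF : NondegenerateMap (F : B →ₗ[K] Mult K C)) (m : Mult K B) :
    IsExtension (F : B →ₗ[K] Mult K C) m (extend (F : B →ₗ[K] Mult K C) m) :=
  (extend_eq_iff hC F hF m _).1 rfl

/-- The extension of a non-degenerate homomorphism `B → M(C)` to a unital homomorphism
`M(B) → M(C)`. -/
def extendHom (hC : Nondegenerate C) (F : B →ₙₐ[K] Mult K C)
    (hF : NondegenerateMap (F : B →ₗ[K] Mult K C)) : Mult K B →ₐ[K] Mult K C :=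
  AlgHom.ofLinearMap
    { toFun := extend (F : B →ₗ[K] Mult K C)
      map_add' := fun m n => by
        rw [extend_eq_iff hC F hF]
        intro b
        have hm := isExtension_extend hC F hF m b
        have hn := isExtension_extend hC F hF n b
        constructor
        · rw [add_mul, hm.1, hn.1, lact_add, LinearMap.add_apply, map_add]
        · rw [mul_add, hm.2, hn.2, ract_add, LinearMap.add_apply, map_add]
      map_smul' := fun r m => by
        rw [extend_eq_iff hC F hF]
        intro b
        have hm := isExtension_extend hC F hF m b
        constructor
        · rw [RingHom.id_apply, smul_mul_assoc, hm.1, lact_smul, LinearMap.smul_apply, map_smul]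
        · rw [RingHom.id_apply, mul_smul_comm, hm.2, ract_smul, LinearMap.smul_apply, map_smul] }
    (by
      change extend (F : B →ₗ[K] Mult K C) 1 = 1
      rw [extend_eq_iff hC F hF]
      intro b
      simp)
    (fun m n => by
      change extend (F : B →ₗ[K] Mult K C) (m * n) = extend (F : B →ₗ[K] Mult K C) m *
        extend (F : B →ₗ[K] Mult K C) n
      rw [extend_eq_iff hC F hF]
      intro b
      have hm := isExtension_extend hC F hF m
      have hn := isExtension_extend hC F hF n
      constructor
      · rw [mul_assoc, (hn b).1, (hm _).1]; rfl
      · rw [← mul_assoc, (hm b).2, (hn _).2]; rfl)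

variable (hC : Nondegenerate C) (F : B →ₙₐ[K] Mult K C)
    (hF : NondegenerateMap (F : B →ₗ[K] Mult K C))

theorem extendHom_apply (m : Mult K B) :
    extendHom hC F hF m = extend (F : B →ₗ[K] Mult K C) m := rfl

theorem extendHom_mul (m : Mult K B) (b : B) : extendHom hC F hF m * F b = F (lact m b) :=
  (isExtension_extend hC F hF m b).1

theorem extendHom_emb (b : B) : extendHom hC F hF (emb K B b) = F b := by
  rw [extendHom_apply, extend_eq_iff hC F hF]
  intro c
  exact ⟨(map_mul F b c).symm, (map_mul F c b).symm⟩

theorem NondegenerateMap.ext_mul (hC : Nondegenerate C) {F : B →ₙₐ[K] Mult K C}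
    (hF : NondegenerateMap (F : B →ₗ[K] Mult K C)) {m n : Mult K C}
    (h : ∀ b, m * F b = n * F b) : m = n := by
  refine Mult.ext_lact hC fun c => ?_
  have hc : c ∈ Submodule.span K {c | ∃ b d, c = lact ((F : B →ₗ[K] Mult K C) b) d} :=
    hF.left ▸ Submodule.mem_top
  induction hc using Submodule.span_induction with
  | mem x hx =>
    obtain ⟨b, d, rfl⟩ := hx
    exact LinearMap.congr_fun (congrArg lact (h b)) d
  | zero => simp
  | add x y _ _ hx hy => rw [map_add, map_add, hx, hy]
  | smul r x _ hx => rw [map_smul, map_smul, hx]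

end ExtendHom

/-! ### Tensor products of homomorphisms -/

section TensorHom

variable {K : Type*} [Field K]
  {A : Type*} [NonUnitalRing A] [Module K A] [IsScalarTower K A A] [SMulCommClass K A A]
  {B : Type*} [NonUnitalRing B] [Module K B] [IsScalarTower K B B] [SMulCommClass K B B]
  {C : Type*} [NonUnitalRing C] [Module K C] [IsScalarTower K C C] [SMulCommClass K C C]
  {D : Type*} [NonUnitalRing D] [Module K D] [IsScalarTower K D D] [SMulCommClass K D D]

theorem map_mul_of_map_mul_tmul {R : Type*} [Ring R] [Module K R] (L : A ⊗[K] B →ₗ[K] R)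
    (h : ∀ a b a' b', L ((a * a') ⊗ₜ (b * b')) = L (a ⊗ₜ b) * L (a' ⊗ₜ b')) (x y : A ⊗[K] B) :
    L (x * y) = L x * L y := by
  induction x with
  | zero => simp
  | add x x' hx hx' => simp only [add_mul, map_add, hx, hx']
  | tmul a b =>
    induction y with
    | zero => simp
    | add y y' hy hy' => simp only [mul_add, map_add, hy, hy']
    | tmul a' b' => rw [Algebra.TensorProduct.tmul_mul_tmul, h]

/-- The homomorphism `F ⊗ G : A ⊗ B → M(C ⊗ D)`. -/
def tensorHom (F : A →ₙₐ[K] Mult K C) (G : B →ₙₐ[K] Mult K D) : A ⊗[K] B →ₙₐ[K] Mult K (C ⊗[K] D) :=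
  { mtprod ∘ₗ TensorProduct.map (F : A →ₗ[K] Mult K C) (G : B →ₗ[K] Mult K D) with
    map_mul' := map_mul_of_map_mul_tmul _ fun a b a' b' => by
      change mtprod (F (a * a') ⊗ₜ G (b * b')) = mtprod (F a ⊗ₜ G b) * mtprod (F a' ⊗ₜ G b')
      rw [mtprod_mul, map_mul, map_mul]
    map_zero' := map_zero _ }

theorem span_tensor_eq_top {s : Set C} {t : Set D} (hs : Submodule.span K s = ⊤)
    (ht : Submodule.span K t = ⊤) (p : Submodule K (C ⊗[K] D))
    (h : ∀ c ∈ s, ∀ d ∈ t, c ⊗ₜ d ∈ p) : p = ⊤ := by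
  rw [eq_top_iff, ← TensorProduct.span_tmul_eq_top, Submodule.span_le]
  rintro _ ⟨x, y, rfl⟩
  have hx : x ∈ Submodule.span K s := hs ▸ Submodule.mem_top
  have hy : y ∈ Submodule.span K t := ht ▸ Submodule.mem_top
  induction hx using Submodule.span_induction with
  | zero => simp
  | add x x' _ _ h h' => rw [TensorProduct.add_tmul]; exact p.add_mem h h'
  | smul r x _ h => rw [← TensorProduct.smul_tmul']; exact p.smul_mem _ h
  | mem x hx =>
    induction hy using Submodule.span_induction with
    | mem y hy => exact h x hx y hy
    | zero => simp
    | add y y' _ _ h h' => rw [TensorProduct.tmul_add]; exact p.add_mem h h'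
    | smul r y _ h => rw [TensorProduct.tmul_smul]; exact p.smul_mem _ h

theorem NondegenerateMap.tensorHom {F : A →ₙₐ[K] Mult K C} {G : B →ₙₐ[K] Mult K D}
    (hF : NondegenerateMap (F : A →ₗ[K] Mult K C)) (hG : NondegenerateMap (G : B →ₗ[K] Mult K D)) :
    NondegenerateMap (tensorHom F G : A ⊗[K] B →ₗ[K] Mult K (C ⊗[K] D)) where
  left := by
    refine span_tensor_eq_top hF.left hG.left _ ?_
    rintro _ ⟨a, c, rfl⟩ _ ⟨b, d, rfl⟩
    exact Submodule.subset_span ⟨a ⊗ₜ b, c ⊗ₜ d, rfl⟩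
  right := by
    refine span_tensor_eq_top hF.right hG.right _ ?_
    rintro _ ⟨a, c, rfl⟩ _ ⟨b, d, rfl⟩
    exact Submodule.subset_span ⟨a ⊗ₜ b, c ⊗ₜ d, rfl⟩

theorem nondegenerateMap_emb (hsp : Submodule.span K {c : A | ∃ a b, c = a * b} = ⊤) :
    NondegenerateMap (emb K A : A →ₗ[K] Mult K A) where
  left := hsp
  right := by
    rw [← hsp]
    congr 1
    ext c
    exact ⟨fun ⟨a, b, h⟩ => ⟨b, a, h⟩, fun ⟨a, b, h⟩ => ⟨b, a, h⟩⟩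

/-- Transport of a non-degenerate homomorphism along an isomorphism of the target algebra. -/
theorem NondegenerateMap.transport {F : A →ₗ[K] Mult K C} (hF : NondegenerateMap F)
    (e : C ≃ₗ[K] D) (he : ∀ x y, e (x * y) = e x * e y) :
    NondegenerateMap ((Mult.transport e he).toLinearMap ∘ₗ F) where
  left := by
    have h := congrArg (Submodule.map e.toLinearMap) hF.left
    rw [Submodule.map_span, Submodule.map_top, LinearEquiv.range] at h
    rw [eq_top_iff, ← h, Submodule.span_le]
    rintro _ ⟨_, ⟨a, c, rfl⟩, rfl⟩
    refine Submodule.subset_span ⟨a, e c, ?_⟩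
    simp [Mult.transport]
  right := by
    have h := congrArg (Submodule.map e.toLinearMap) hF.right
    rw [Submodule.map_span, Submodule.map_top, LinearEquiv.range] at h
    rw [eq_top_iff, ← h, Submodule.span_le]
    rintro _ ⟨_, ⟨a, c, rfl⟩, rfl⟩
    refine Submodule.subset_span ⟨a, e c, ?_⟩
    simp [Mult.transport]

end TensorHom

/-! ### The canonical maps and the counit -/

section Hopf

variable {K : Type u} [Field K]
  {A : Type v} [NonUnitalRing A] [Module K A] [IsScalarTower K A A] [SMulCommClass K A A]
  {Δ : A →ₙₐ[K] Mult K (A ⊗[K] A)} {ε : A →ₙₐ[K] K}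

/-- The canonical map `a ⊗ b ↦ Δ(a)(1 ⊗ b)`, as an automorphism of the vector space `A ⊗ A`. -/
def IsMultiplierHopf.canon₁ (hΔ : IsMultiplierHopf Δ) : A ⊗[K] A ≃ₗ[K] A ⊗[K] A :=
  (LinearEquiv.ofInjective (T₁ Δ) hΔ.injective₁).trans
    ((LinearEquiv.ofEq _ _ hΔ.range₁).trans
      (LinearEquiv.ofInjective (emb K (A ⊗[K] A) : A ⊗[K] A →ₗ[K] Mult K (A ⊗[K] A))
        (emb_injective (hΔ.nondegenerate.tensor hΔ.nondegenerate))).symm)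

/-- The canonical map `a ⊗ b ↦ (a ⊗ 1)Δ(b)`, as an automorphism of the vector space `A ⊗ A`. -/
def IsMultiplierHopf.canon₂ (hΔ : IsMultiplierHopf Δ) : A ⊗[K] A ≃ₗ[K] A ⊗[K] A :=
  (LinearEquiv.ofInjective (T₂ Δ) hΔ.injective₂).trans
    ((LinearEquiv.ofEq _ _ hΔ.range₂).trans
      (LinearEquiv.ofInjective (emb K (A ⊗[K] A) : A ⊗[K] A →ₗ[K] Mult K (A ⊗[K] A))
        (emb_injective (hΔ.nondegenerate.tensor hΔ.nondegenerate))).symm)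

theorem IsMultiplierHopf.nondegenerate₂ (hΔ : IsMultiplierHopf Δ) : Nondegenerate (A ⊗[K] A) :=
  hΔ.nondegenerate.tensor hΔ.nondegenerate

theorem IsMultiplierHopf.nondegenerate₃ (hΔ : IsMultiplierHopf Δ) :
    Nondegenerate ((A ⊗[K] A) ⊗[K] A) :=
  hΔ.nondegenerate₂.tensor hΔ.nondegenerate

theorem IsMultiplierHopf.emb_canon₁ (hΔ : IsMultiplierHopf Δ) (z : A ⊗[K] A) :
    emb K (A ⊗[K] A) (hΔ.canon₁ z) = T₁ Δ z := by
  have h := LinearEquiv.apply_symm_apply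
    (LinearEquiv.ofInjective (emb K (A ⊗[K] A) : A ⊗[K] A →ₗ[K] Mult K (A ⊗[K] A))
        (emb_injective hΔ.nondegenerate₂))
    (LinearEquiv.ofEq _ _ hΔ.range₁ (LinearEquiv.ofInjective (T₁ Δ) hΔ.injective₁ z))
  exact congrArg Subtype.val h

theorem IsMultiplierHopf.emb_canon₂ (hΔ : IsMultiplierHopf Δ) (z : A ⊗[K] A) :
    emb K (A ⊗[K] A) (hΔ.canon₂ z) = T₂ Δ z := by
  have h := LinearEquiv.apply_symm_apply
    (LinearEquiv.ofInjective (emb K (A ⊗[K] A) : A ⊗[K] A →ₗ[K] Mult K (A ⊗[K] A))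
        (emb_injective hΔ.nondegenerate₂))
    (LinearEquiv.ofEq _ _ hΔ.range₂ (LinearEquiv.ofInjective (T₂ Δ) hΔ.injective₂ z))
  exact congrArg Subtype.val h

theorem IsMultiplierHopf.emb_canon₁_tmul (hΔ : IsMultiplierHopf Δ) (a b : A) :
    emb K (A ⊗[K] A) (hΔ.canon₁ (a ⊗ₜ b)) = Δ a * rightLeg K A A (emb K A b) :=
  hΔ.emb_canon₁ _

theorem IsMultiplierHopf.emb_canon₂_tmul (hΔ : IsMultiplierHopf Δ) (a b : A) :
    emb K (A ⊗[K] A) (hΔ.canon₂ (a ⊗ₜ b)) = leftLeg K A A (emb K A a) * Δ b :=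
  hΔ.emb_canon₂ _

/-- The value of `Δ(a)` on `x ⊗ y` is `(Δ(a)(1 ⊗ y))(x ⊗ 1)`. -/
theorem IsMultiplierHopf.lact_comul_tmul (hΔ : IsMultiplierHopf Δ) (a x y : A) :
    lact (Δ a) (x ⊗ₜ y) = ract (leftLeg K A A (emb K A x)) (hΔ.canon₁ (a ⊗ₜ y)) := by
  apply emb_injective (K := K) hΔ.nondegenerate₂
  rw [← mul_emb, ← emb_mul, emb_canon₁_tmul, mul_assoc, rightLeg_mul_leftLeg, mtprod_emb]

theorem IsMultiplierHopf.ract_comul_tmul (hΔ : IsMultiplierHopf Δ) (a x y : A) :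
    ract (Δ a) (x ⊗ₜ y) = lact (rightLeg K A A (emb K A y)) (hΔ.canon₂ (x ⊗ₜ a)) := by
  apply emb_injective (K := K) hΔ.nondegenerate₂
  rw [← mul_emb, ← emb_mul, emb_canon₂_tmul, ← mul_assoc, rightLeg_mul_leftLeg, mtprod_emb]

theorem IsMultiplierHopf.lact_comul_canon₁ (hΔ : IsMultiplierHopf Δ) (a : A) (z : A ⊗[K] A) :
    lact (Δ a) (hΔ.canon₁ z) = hΔ.canon₁ (lact (leftLeg K A A (emb K A a)) z) := by
  induction z with
  | zero => simp
  | add x y hx hy => simp only [map_add, hx, hy]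
  | tmul x y =>
    apply emb_injective (K := K) hΔ.nondegenerate₂
    rw [← mul_emb, emb_canon₁_tmul, lact_leftLeg_tmul, lact_emb, emb_canon₁_tmul, map_mul,
      mul_assoc]

theorem IsMultiplierHopf.ract_rightLeg_canon₁ (hΔ : IsMultiplierHopf Δ) (a : A) (z : A ⊗[K] A) :
    ract (rightLeg K A A (emb K A a)) (hΔ.canon₁ z) =
      hΔ.canon₁ (ract (rightLeg K A A (emb K A a)) z) := by
  induction z with
  | zero => simp
  | add x y hx hy => simp only [map_add, hx, hy]
  | tmul x y =>
    apply emb_injective (K := K) hΔ.nondegenerate₂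
    rw [← emb_mul, emb_canon₁_tmul, ract_rightLeg_tmul, ract_emb, emb_canon₁_tmul, map_mul, map_mul,
      mul_assoc]

theorem IsMultiplierHopf.lact_leftLeg_canon₂ (hΔ : IsMultiplierHopf Δ) (a : A) (z : A ⊗[K] A) :
    lact (leftLeg K A A (emb K A a)) (hΔ.canon₂ z) =
      hΔ.canon₂ (lact (leftLeg K A A (emb K A a)) z) := by
  induction z with
  | zero => simp
  | add x y hx hy => simp only [map_add, hx, hy]
  | tmul x y =>
    apply emb_injective (K := K) hΔ.nondegenerate₂
    rw [← mul_emb, emb_canon₂_tmul, lact_leftLeg_tmul, lact_emb, emb_canon₂_tmul, map_mul, map_mul,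
      mul_assoc]

@[simp] theorem counitLeft_tmul (a b : A) : counitLeft ε (a ⊗ₜ b) = ε a • b := rfl

@[simp] theorem counitRight_tmul (a b : A) : counitRight ε (a ⊗ₜ b) = ε b • a := rfl

theorem counitLeft_canon₁ (hΔ : IsMultiplierHopf Δ) (hε : IsCounit Δ ε) (z : A ⊗[K] A) :
    counitLeft ε (hΔ.canon₁ z) = LinearMap.mul' K A z := by
  induction z with
  | zero => simp
  | add x y hx hy => simp only [map_add, hx, hy]
  | tmul x y => rw [hε.left x y _ (hΔ.emb_canon₁_tmul x y), LinearMap.mul'_apply]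

theorem counitRight_canon₂ (hΔ : IsMultiplierHopf Δ) (hε : IsCounit Δ ε) (z : A ⊗[K] A) :
    counitRight ε (hΔ.canon₂ z) = LinearMap.mul' K A z := by
  induction z with
  | zero => simp
  | add x y hx hy => simp only [map_add, hx, hy]
  | tmul x y => rw [hε.right x y _ (hΔ.emb_canon₂_tmul x y), LinearMap.mul'_apply]

/-- Unless `A` is trivial, the counit takes the value `1`: if it vanished, so would the product. -/
theorem exists_counit_eq_one (hΔ : IsMultiplierHopf Δ) (hε : IsCounit Δ ε) [Nontrivial A] :
    ∃ h : A, ε h = 1 := by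
  by_contra! hne
  have h0 : ∀ a, ε a = 0 := by
    intro a
    by_contra ha
    exact hne ((ε a)⁻¹ • a) (by rw [map_smul, smul_eq_mul, inv_mul_cancel₀ ha])
  have hz : ∀ z, counitLeft ε z = 0 := fun z => by
    induction z with
    | zero => simp
    | add x y hx hy => rw [map_add, hx, hy, add_zero]
    | tmul x y => simp [h0]
  obtain ⟨a, ha⟩ := exists_ne (0 : A)
  refine ha (hΔ.nondegenerate.left a fun b => ?_)
  rw [← LinearMap.mul'_apply (R := K), ← counitLeft_canon₁ hΔ hε, hz]

theorem counitLeft_surjective (hΔ : IsMultiplierHopf Δ) (hε : IsCounit Δ ε) :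
    Function.Surjective (counitLeft ε) := by
  intro a
  cases subsingleton_or_nontrivial A
  · exact ⟨0, Subsingleton.elim _ _⟩
  · obtain ⟨h, hh⟩ := exists_counit_eq_one hΔ hε
    exact ⟨h ⊗ₜ a, by simp [hh]⟩

theorem counitRight_surjective (hΔ : IsMultiplierHopf Δ) (hε : IsCounit Δ ε) :
    Function.Surjective (counitRight ε) := by
  intro a
  cases subsingleton_or_nontrivial A
  · exact ⟨0, Subsingleton.elim _ _⟩
  · obtain ⟨h, hh⟩ := exists_counit_eq_one hΔ hε
    exact ⟨a ⊗ₜ h, by simp [hh]⟩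

theorem span_mul_eq_top (hΔ : IsMultiplierHopf Δ) (hε : IsCounit Δ ε) :
    Submodule.span K {c : A | ∃ a b, c = a * b} = ⊤ := by
  rw [eq_top_iff]
  rintro a -
  obtain ⟨z, rfl⟩ := counitLeft_surjective hΔ hε a
  obtain ⟨z, rfl⟩ := hΔ.canon₁.surjective z
  rw [counitLeft_canon₁ hΔ hε]
  induction z with
  | zero => simp
  | add x y hx hy => rw [map_add]; exact Submodule.add_mem _ hx hy
  | tmul x y => exact Submodule.subset_span ⟨x, y, rfl⟩

theorem nondegenerateMap_comul (hΔ : IsMultiplierHopf Δ) (hε : IsCounit Δ ε) :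
    NondegenerateMap (Δ : A →ₗ[K] Mult K (A ⊗[K] A)) where
  left := by
    have hsp := span_mul_eq_top hΔ hε
    have key : ∀ z : A ⊗[K] A, ∀ x, ract (leftLeg K A A (emb K A x)) z ∈
        Submodule.span K {c | ∃ b d, c = lact ((Δ : A →ₗ[K] Mult K (A ⊗[K] A)) b) d} := by
      intro z x
      obtain ⟨z, rfl⟩ := hΔ.canon₁.surjective z
      induction z with
      | zero => simp
      | add y z hy hz => rw [map_add, map_add]; exact Submodule.add_mem _ hy hz
      | tmul a y => exact Submodule.subset_span ⟨a, x ⊗ₜ y, (hΔ.lact_comul_tmul a x y).symm⟩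
    refine span_tensor_eq_top hsp Submodule.span_univ _ ?_
    rintro _ ⟨p, x, rfl⟩ q -
    exact key (p ⊗ₜ q) x
  right := by
    have hsp := span_mul_eq_top hΔ hε
    have key : ∀ z : A ⊗[K] A, ∀ y, lact (rightLeg K A A (emb K A y)) z ∈
        Submodule.span K {c | ∃ b d, c = ract ((Δ : A →ₗ[K] Mult K (A ⊗[K] A)) b) d} := by
      intro z y
      obtain ⟨z, rfl⟩ := hΔ.canon₂.surjective z
      induction z with
      | zero => simp
      | add y z hy hz => rw [map_add, map_add]; exact Submodule.add_mem _ hy hz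
      | tmul x a => exact Submodule.subset_span ⟨a, x ⊗ₜ y, (hΔ.ract_comul_tmul a x y).symm⟩
    refine span_tensor_eq_top Submodule.span_univ hsp _ ?_
    rintro p - _ ⟨y, q, rfl⟩
    exact key (p ⊗ₜ q) y

/-! ### Comultiplication and counit on multipliers -/

/-- `comulLeft` as a homomorphism. -/
def comulLeftHom (Δ : A →ₙₐ[K] Mult K (A ⊗[K] A)) : A ⊗[K] A →ₙₐ[K] Mult K ((A ⊗[K] A) ⊗[K] A) :=
  tensorHom Δ (emb K A)

/-- `comulRight` as a homomorphism. -/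
def comulRightHom (Δ : A →ₙₐ[K] Mult K (A ⊗[K] A)) : A ⊗[K] A →ₙₐ[K] Mult K ((A ⊗[K] A) ⊗[K] A) :=
  ((assocMult : Mult K (A ⊗[K] (A ⊗[K] A)) →ₐ[K] Mult K ((A ⊗[K] A) ⊗[K] A)) :
    Mult K (A ⊗[K] (A ⊗[K] A)) →ₙₐ[K] Mult K ((A ⊗[K] A) ⊗[K] A)).comp (tensorHom (emb K A) Δ)

/-- `emb ∘ (ε ⊗ ι)` as a homomorphism. -/
def counitLeftHom (ε : A →ₙₐ[K] K) : A ⊗[K] A →ₙₐ[K] Mult K A :=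
  { (emb K A : A →ₗ[K] Mult K A) ∘ₗ counitLeft ε with
    map_mul' := map_mul_of_map_mul_tmul _ fun a b a' b' => by
      change emb K A (counitLeft ε ((a * a') ⊗ₜ (b * b'))) =
        emb K A (counitLeft ε (a ⊗ₜ b)) * emb K A (counitLeft ε (a' ⊗ₜ b'))
      rw [← map_mul]
      simp [mul_smul, smul_mul_assoc, mul_smul_comm, smul_comm (ε a) (ε a')]
    map_zero' := map_zero _ }

/-- `emb ∘ (ι ⊗ ε)` as a homomorphism. -/
def counitRightHom (ε : A →ₙₐ[K] K) : A ⊗[K] A →ₙₐ[K] Mult K A :=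
  { (emb K A : A →ₗ[K] Mult K A) ∘ₗ counitRight ε with
    map_mul' := map_mul_of_map_mul_tmul _ fun a b a' b' => by
      change emb K A (counitRight ε ((a * a') ⊗ₜ (b * b'))) =
        emb K A (counitRight ε (a ⊗ₜ b)) * emb K A (counitRight ε (a' ⊗ₜ b'))
      rw [← map_mul]
      simp [mul_smul, smul_mul_assoc, mul_smul_comm, smul_comm (ε b) (ε b')]
    map_zero' := map_zero _ }

theorem coe_comulLeftHom :
    (comulLeftHom Δ : A ⊗[K] A →ₗ[K] Mult K ((A ⊗[K] A) ⊗[K] A)) = comulLeft Δ := rfl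

theorem coe_comulRightHom :
    (comulRightHom Δ : A ⊗[K] A →ₗ[K] Mult K ((A ⊗[K] A) ⊗[K] A)) = comulRight Δ := rfl

theorem nondegenerateMap_comulLeftHom (hΔ : IsMultiplierHopf Δ) (hε : IsCounit Δ ε) :
    NondegenerateMap (comulLeftHom Δ : A ⊗[K] A →ₗ[K] Mult K ((A ⊗[K] A) ⊗[K] A)) :=
  (nondegenerateMap_comul hΔ hε).tensorHom (nondegenerateMap_emb (span_mul_eq_top hΔ hε))

theorem nondegenerateMap_comulRightHom (hΔ : IsMultiplierHopf Δ) (hε : IsCounit Δ ε) :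
    NondegenerateMap (comulRightHom Δ : A ⊗[K] A →ₗ[K] Mult K ((A ⊗[K] A) ⊗[K] A)) := by
  have h := NondegenerateMap.transport (D := (A ⊗[K] A) ⊗[K] A)
    ((nondegenerateMap_emb (span_mul_eq_top hΔ hε)).tensorHom (nondegenerateMap_comul hΔ hε))
    (TensorProduct.assoc K A A A).symm (assoc_symm_mul (K := K) (A := A))
  exact h

theorem nondegenerateMap_counitLeftHom (hΔ : IsMultiplierHopf Δ) (hε : IsCounit Δ ε) :
    NondegenerateMap (counitLeftHom ε : A ⊗[K] A →ₗ[K] Mult K A) where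
  left := by
    rw [eq_top_iff, ← span_mul_eq_top hΔ hε, Submodule.span_le]
    rintro _ ⟨a, b, rfl⟩
    obtain ⟨z, rfl⟩ := counitLeft_surjective hΔ hε a
    exact Submodule.subset_span ⟨z, b, rfl⟩
  right := by
    rw [eq_top_iff, ← span_mul_eq_top hΔ hε, Submodule.span_le]
    rintro _ ⟨a, b, rfl⟩
    obtain ⟨z, rfl⟩ := counitLeft_surjective hΔ hε b
    exact Submodule.subset_span ⟨z, a, rfl⟩

theorem nondegenerateMap_counitRightHom (hΔ : IsMultiplierHopf Δ) (hε : IsCounit Δ ε) :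
    NondegenerateMap (counitRightHom ε : A ⊗[K] A →ₗ[K] Mult K A) where
  left := by
    rw [eq_top_iff, ← span_mul_eq_top hΔ hε, Submodule.span_le]
    rintro _ ⟨a, b, rfl⟩
    obtain ⟨z, rfl⟩ := counitRight_surjective hΔ hε a
    exact Submodule.subset_span ⟨z, b, rfl⟩
  right := by
    rw [eq_top_iff, ← span_mul_eq_top hΔ hε, Submodule.span_le]
    rintro _ ⟨a, b, rfl⟩
    obtain ⟨z, rfl⟩ := counitRight_surjective hΔ hε b
    exact Submodule.subset_span ⟨z, a, rfl⟩

/-- `Δ ⊗ ι : M(A ⊗ A) → M(A ⊗ A ⊗ A)`. -/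
def comulLeftMult (hΔ : IsMultiplierHopf Δ) (hε : IsCounit Δ ε) :
    Mult K (A ⊗[K] A) →ₐ[K] Mult K ((A ⊗[K] A) ⊗[K] A) :=
  extendHom hΔ.nondegenerate₃ (comulLeftHom Δ) (nondegenerateMap_comulLeftHom hΔ hε)

/-- `ι ⊗ Δ : M(A ⊗ A) → M(A ⊗ A ⊗ A)`. -/
def comulRightMult (hΔ : IsMultiplierHopf Δ) (hε : IsCounit Δ ε) :
    Mult K (A ⊗[K] A) →ₐ[K] Mult K ((A ⊗[K] A) ⊗[K] A) :=
  extendHom hΔ.nondegenerate₃ (comulRightHom Δ) (nondegenerateMap_comulRightHom hΔ hε)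

/-- `ε ⊗ ι : M(A ⊗ A) → M(A)`. -/
def counitLeftMult (hΔ : IsMultiplierHopf Δ) (hε : IsCounit Δ ε) :
    Mult K (A ⊗[K] A) →ₐ[K] Mult K A :=
  extendHom hΔ.nondegenerate (counitLeftHom ε) (nondegenerateMap_counitLeftHom hΔ hε)

/-- `ι ⊗ ε : M(A ⊗ A) → M(A)`. -/
def counitRightMult (hΔ : IsMultiplierHopf Δ) (hε : IsCounit Δ ε) :
    Mult K (A ⊗[K] A) →ₐ[K] Mult K A :=
  extendHom hΔ.nondegenerate (counitRightHom ε) (nondegenerateMap_counitRightHom hΔ hε)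

section Extended

variable (hΔ : IsMultiplierHopf Δ) (hε : IsCounit Δ ε)

theorem comulLeftMult_emb (z : A ⊗[K] A) :
    comulLeftMult hΔ hε (emb K (A ⊗[K] A) z) = comulLeft Δ z := extendHom_emb _ _ _ z

theorem comulRightMult_emb (z : A ⊗[K] A) :
    comulRightMult hΔ hε (emb K (A ⊗[K] A) z) = comulRight Δ z := extendHom_emb _ _ _ z

theorem counitLeftMult_emb (z : A ⊗[K] A) :
    counitLeftMult hΔ hε (emb K (A ⊗[K] A) z) = emb K A (counitLeft ε z) := extendHom_emb _ _ _ z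

theorem counitRightMult_emb (z : A ⊗[K] A) :
    counitRightMult hΔ hε (emb K (A ⊗[K] A) z) = emb K A (counitRight ε z) := extendHom_emb _ _ _ z

theorem comulLeftMult_mul (m : Mult K (A ⊗[K] A)) (z : A ⊗[K] A) :
    comulLeftMult hΔ hε m * comulLeft Δ z = comulLeft Δ (lact m z) := extendHom_mul _ _ _ m z

theorem comulRightMult_mul (m : Mult K (A ⊗[K] A)) (z : A ⊗[K] A) :
    comulRightMult hΔ hε m * comulRight Δ z = comulRight Δ (lact m z) := extendHom_mul _ _ _ m z

theorem counitLeftMult_mul (m : Mult K (A ⊗[K] A)) (z : A ⊗[K] A) :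
    counitLeftMult hΔ hε m * emb K A (counitLeft ε z) = emb K A (counitLeft ε (lact m z)) :=
  extendHom_mul _ _ _ m z

theorem counitRightMult_mul (m : Mult K (A ⊗[K] A)) (z : A ⊗[K] A) :
    counitRightMult hΔ hε m * emb K A (counitRight ε z) = emb K A (counitRight ε (lact m z)) :=
  extendHom_mul _ _ _ m z

@[simp] theorem comulLeft_tmul (a b : A) : comulLeft Δ (a ⊗ₜ b) = mtprod (Δ a ⊗ₜ emb K A b) := rfl

@[simp] theorem comulRight_tmul (a b : A) :
    comulRight Δ (a ⊗ₜ b) = assocMult (mtprod (emb K A a ⊗ₜ Δ b)) := rfl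

theorem assocMult_leftLeg (m : Mult K A) :
    assocMult (leftLeg K A (A ⊗[K] A) m) = leftLeg K (A ⊗[K] A) A (leftLeg K A A m) := by
  apply Mult.ext' <;> intro x
  · induction x with
    | zero => simp
    | add x y hx hy => rw [map_add, map_add, hx, hy]
    | tmul z c =>
      induction z with
      | zero => simp
      | add x y hx hy => rw [TensorProduct.add_tmul, map_add, map_add, hx, hy]
      | tmul a b => simp [assocMult, Mult.transport]
  · induction x with
    | zero => simp
    | add x y hx hy => rw [map_add, map_add, hx, hy]
    | tmul z c =>
      induction z with
      | zero => simp
      | add x y hx hy => rw [TensorProduct.add_tmul, map_add, map_add, hx, hy]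
      | tmul a b => simp [assocMult, Mult.transport]

theorem assocMult_rightLeg_rightLeg (m : Mult K A) :
    assocMult (rightLeg K A (A ⊗[K] A) (rightLeg K A A m)) = rightLeg K (A ⊗[K] A) A m := by
  apply Mult.ext' <;> intro x
  · induction x with
    | zero => simp
    | add x y hx hy => rw [map_add, map_add, hx, hy]
    | tmul z c =>
      induction z with
      | zero => simp
      | add x y hx hy => rw [TensorProduct.add_tmul, map_add, map_add, hx, hy]
      | tmul a b => simp [assocMult, Mult.transport]
  · induction x with
    | zero => simp
    | add x y hx hy => rw [map_add, map_add, hx, hy]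
    | tmul z c =>
      induction z with
      | zero => simp
      | add x y hx hy => rw [TensorProduct.add_tmul, map_add, map_add, hx, hy]
      | tmul a b => simp [assocMult, Mult.transport]

theorem comulLeftMult_rightLeg (m : Mult K A) :
    comulLeftMult hΔ hε (rightLeg K A A m) = rightLeg K (A ⊗[K] A) A m := by
  refine NondegenerateMap.ext_mul hΔ.nondegenerate₃ (nondegenerateMap_comulLeftHom hΔ hε)
    fun z => ?_
  change _ * comulLeft Δ z = _ * comulLeft Δ z
  rw [comulLeftMult_mul]
  induction z with
  | zero => simp
  | add x y hx hy => simp only [map_add, mul_add, hx, hy]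
  | tmul a b =>
    rw [lact_rightLeg_tmul, comulLeft_tmul, comulLeft_tmul, rightLeg_apply, mtprod_mul, one_mul,
      mul_emb]

theorem comulRightMult_leftLeg (m : Mult K A) :
    comulRightMult hΔ hε (leftLeg K A A m) = leftLeg K (A ⊗[K] A) A (leftLeg K A A m) := by
  refine NondegenerateMap.ext_mul hΔ.nondegenerate₃ (nondegenerateMap_comulRightHom hΔ hε)
    fun z => ?_
  change _ * comulRight Δ z = _ * comulRight Δ z
  rw [comulRightMult_mul]
  induction z with
  | zero => simp
  | add x y hx hy => simp only [map_add, mul_add, hx, hy]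
  | tmul a b =>
    rw [lact_leftLeg_tmul, comulRight_tmul, comulRight_tmul, ← assocMult_leftLeg, ← map_mul,
      leftLeg_apply, mtprod_mul, one_mul, mul_emb]

theorem counitLeftMult_rightLeg (m : Mult K A) :
    counitLeftMult hΔ hε (rightLeg K A A m) = m := by
  refine NondegenerateMap.ext_mul hΔ.nondegenerate (nondegenerateMap_counitLeftHom hΔ hε)
    fun z => ?_
  change _ * emb K A (counitLeft ε z) = _ * emb K A (counitLeft ε z)
  rw [counitLeftMult_mul, mul_emb]
  induction z with
  | zero => simp
  | add x y hx hy => simp only [map_add, hx, hy]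
  | tmul a b => simp

theorem counitRightMult_leftLeg (m : Mult K A) :
    counitRightMult hΔ hε (leftLeg K A A m) = m := by
  refine NondegenerateMap.ext_mul hΔ.nondegenerate (nondegenerateMap_counitRightHom hΔ hε)
    fun z => ?_
  change _ * emb K A (counitRight ε z) = _ * emb K A (counitRight ε z)
  rw [counitRightMult_mul, mul_emb]
  induction z with
  | zero => simp
  | add x y hx hy => simp only [map_add, hx, hy]
  | tmul a b => simp

theorem counitLeftMult_comul (a : A) : counitLeftMult hΔ hε (Δ a) = emb K A a := by
  refine Mult.ext_mul_emb hΔ.nondegenerate fun b => ?_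
  rw [← counitLeftMult_rightLeg hΔ hε (emb K A b), ← map_mul, ← hΔ.emb_canon₁_tmul,
    counitLeftMult_emb, counitLeft_canon₁ hΔ hε, LinearMap.mul'_apply, map_mul,
    counitLeftMult_rightLeg]

theorem counitRightMult_comul (a : A) : counitRightMult hΔ hε (Δ a) = emb K A a := by
  refine Mult.ext_emb_mul hΔ.nondegenerate fun b => ?_
  rw [← counitRightMult_leftLeg hΔ hε (emb K A b), ← map_mul, ← hΔ.emb_canon₂_tmul,
    counitRightMult_emb, counitRight_canon₂ hΔ hε, LinearMap.mul'_apply, map_mul,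
    counitRightMult_leftLeg]

/-- Multipliers of `A ⊗ A ⊗ A` are separated by `X ↦ (a ⊗ 1 ⊗ 1) X (1 ⊗ 1 ⊗ c)`. -/
theorem Mult.ext_outerLegs (hA : Nondegenerate A)
    (hsp : Submodule.span K {c : A | ∃ a b, c = a * b} = ⊤) {X Y : Mult K ((A ⊗[K] A) ⊗[K] A)}
    (h : ∀ a c, leftLeg K (A ⊗[K] A) A (leftLeg K A A (emb K A a)) * X *
        rightLeg K (A ⊗[K] A) A (emb K A c) =
      leftLeg K (A ⊗[K] A) A (leftLeg K A A (emb K A a)) * Y *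
        rightLeg K (A ⊗[K] A) A (emb K A c)) : X = Y := by
  refine Mult.ext_lact ((hA.tensor hA).tensor hA) fun ζ => ?_
  have hζ : ζ ∈ Submodule.span K {t : (A ⊗[K] A) ⊗[K] A |
      ∃ b z, t = lact (rightLeg K (A ⊗[K] A) A (emb K A b)) z} :=
    (span_lact_rightLeg (A := A ⊗[K] A) hsp) ▸ Submodule.mem_top
  induction hζ using Submodule.span_induction with
  | zero => simp
  | add x y _ _ hx hy => rw [map_add, map_add, hx, hy]
  | smul r x _ hx => rw [map_smul, map_smul, hx]
  | mem x hx =>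
    obtain ⟨c, z, rfl⟩ := hx
    rw [← sub_eq_zero]
    refine eq_zero_of_forall_map_left_eq_zero (fun a => lact (leftLeg K A A (emb K A a)))
      (fun z hz => eq_zero_of_lact_leftLeg hA z hz) _ fun a => ?_
    change lact (leftLeg K (A ⊗[K] A) A (leftLeg K A A (emb K A a))) _ = 0
    rw [map_sub, sub_eq_zero]
    exact LinearMap.congr_fun (congrArg lact (h a c)) z

/-- Coassociativity in `M(A ⊗ A ⊗ A)`. -/
theorem comulLeftMult_comul (b : A) :
    comulLeftMult hΔ hε (Δ b) = comulRightMult hΔ hε (Δ b) := by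
  refine Mult.ext_outerLegs hΔ.nondegenerate (span_mul_eq_top hΔ hε) fun a c => ?_
  have h := hΔ.coassoc a b c _ _ (hΔ.emb_canon₁_tmul b c) (hΔ.emb_canon₂_tmul a b)
  rw [← comulLeftMult_emb hΔ hε, ← comulRightMult_emb hΔ hε, hΔ.emb_canon₁_tmul,
    hΔ.emb_canon₂_tmul, map_mul, map_mul, comulLeftMult_rightLeg, comulRightMult_leftLeg] at h
  rw [mul_assoc]
  exact h

end Extended

/-! ### The co-opposite comultiplication -/

section Coop

theorem flipMult_flipMult (m : Mult K (A ⊗[K] A)) : flipMult (flipMult m) = m := by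
  apply Mult.ext' <;> intro x <;> simp [flipMult, Mult.transport]

theorem flipMult_emb (z : A ⊗[K] A) :
    flipMult (emb K (A ⊗[K] A) z) = emb K (A ⊗[K] A) (TensorProduct.comm K A A z) := by
  apply Mult.ext' <;> intro x <;> simp [flipMult, Mult.transport, comm_mul]

theorem lact_flipMult (m : Mult K (A ⊗[K] A)) (z : A ⊗[K] A) :
    lact (flipMult m) (TensorProduct.comm K A A z) = TensorProduct.comm K A A (lact m z) := by
  simp [flipMult, Mult.transport]

theorem ract_flipMult (m : Mult K (A ⊗[K] A)) (z : A ⊗[K] A) :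
    ract (flipMult m) (TensorProduct.comm K A A z) = TensorProduct.comm K A A (ract m z) := by
  simp [flipMult, Mult.transport]

theorem flipMult_mtprod (m n : Mult K A) :
    flipMult (mtprod (m ⊗ₜ[K] n)) = mtprod (n ⊗ₜ[K] m) := by
  apply Mult.ext' <;> intro x
  · obtain ⟨x, rfl⟩ := (TensorProduct.comm K A A).surjective x
    rw [lact_flipMult]
    exact (TensorProduct.map_comm _ _ x).symm
  · obtain ⟨x, rfl⟩ := (TensorProduct.comm K A A).surjective x
    rw [ract_flipMult]
    exact (TensorProduct.map_comm _ _ x).symm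

theorem flipMult_leftLeg (m : Mult K A) : flipMult (leftLeg K A A m) = rightLeg K A A m :=
  flipMult_mtprod m 1

theorem flipMult_rightLeg (m : Mult K A) : flipMult (rightLeg K A A m) = leftLeg K A A m :=
  flipMult_mtprod 1 m

theorem coop_apply (a : A) : coop Δ a = flipMult (Δ a) := rfl

theorem coop_coop : coop (coop Δ) = Δ := by
  ext a
  exact flipMult_flipMult _

theorem counitLeft_comm (z : A ⊗[K] A) :
    counitLeft ε (TensorProduct.comm K A A z) = counitRight ε z := by
  induction z with
  | zero => simp
  | add x y hx hy => simp only [map_add, hx, hy]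
  | tmul a b => simp

theorem counitRight_comm (z : A ⊗[K] A) :
    counitRight ε (TensorProduct.comm K A A z) = counitLeft ε z := by
  induction z with
  | zero => simp
  | add x y hx hy => simp only [map_add, hx, hy]
  | tmul a b => simp

theorem IsRegularMultiplierHopf.coop (hΔ : IsRegularMultiplierHopf Δ) :
    IsRegularMultiplierHopf (coop Δ) :=
  ⟨hΔ.coop_isMultiplierHopf, by rw [coop_coop]; exact hΔ.isMultiplierHopf⟩

theorem IsCounit.coop (hΔ : IsMultiplierHopf Δ) (hε : IsCounit Δ ε) : IsCounit (coop Δ) ε where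
  left a b z hz := by
    apply emb_injective (K := K) hΔ.nondegenerate
    have h := congrArg (fun m => counitRightMult hΔ hε (flipMult m)) hz
    simp only [flipMult_emb, map_mul, coop_apply, flipMult_flipMult] at h
    rw [counitRightMult_emb, counitRight_comm, counitRightMult_comul, ← rightLeg_apply,
      flipMult_rightLeg, counitRightMult_leftLeg] at h
    rw [h, map_mul]
  right a b z hz := by
    apply emb_injective (K := K) hΔ.nondegenerate
    have h := congrArg (fun m => counitLeftMult hΔ hε (flipMult m)) hz
    simp only [flipMult_emb, map_mul, coop_apply, flipMult_flipMult] at h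
    rw [counitLeftMult_emb, counitLeft_comm, counitLeftMult_comul, ← leftLeg_apply,
      flipMult_leftLeg, counitLeftMult_rightLeg] at h
    rw [h, map_mul]

end Coop

end Hopf

/-! ### Contractions with the antipode -/

section Antipode

variable {K : Type u} [Field K]
  {A : Type v} [NonUnitalRing A] [Module K A] [IsScalarTower K A A] [SMulCommClass K A A]
  {Δ : A →ₙₐ[K] Mult K (A ⊗[K] A)} {ε : A →ₙₐ[K] K}

variable (K A) in
/-- `lact` as a linear map in the multiplier. -/
def lactLin : Mult K A →ₗ[K] A →ₗ[K] A where
  toFun := lact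
  map_add' _ _ := rfl
  map_smul' _ _ := rfl

variable (K A) in
/-- `ract` as a linear map in the multiplier. -/
def ractLin : Mult K A →ₗ[K] A →ₗ[K] A where
  toFun := ract
  map_add' _ _ := rfl
  map_smul' _ _ := rfl

/-- The contraction `m(S ⊗ ι) : A ⊗ A → A`, `x ⊗ y ↦ S(x)y`. -/
def contractLeft (S : A →ₗ[K] Mult K A) : A ⊗[K] A →ₗ[K] A :=
  TensorProduct.lift (lactLin K A ∘ₗ S)

/-- The contraction `m(ι ⊗ S) : A ⊗ A → A`, `x ⊗ y ↦ xS(y)`. -/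
def contractRight (S : A →ₗ[K] Mult K A) : A ⊗[K] A →ₗ[K] A :=
  TensorProduct.lift (ractLin K A ∘ₗ S).flip

@[simp] theorem contractLeft_tmul (S : A →ₗ[K] Mult K A) (x y : A) :
    contractLeft S (x ⊗ₜ y) = lact (S x) y := rfl

@[simp] theorem contractRight_tmul (S : A →ₗ[K] Mult K A) (x y : A) :
    contractRight S (x ⊗ₜ y) = ract (S y) x := rfl

theorem mul'_map_emb_right (S : A →ₗ[K] Mult K A) (z : A ⊗[K] A) :
    LinearMap.mul' K (Mult K A) (TensorProduct.map S (emb K A : A →ₗ[K] Mult K A) z) =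
      emb K A (contractLeft S z) := by
  induction z with
  | zero => simp
  | add x y hx hy => simp only [map_add, hx, hy]
  | tmul x y => exact mul_emb _ _

theorem mul'_map_emb_left (S : A →ₗ[K] Mult K A) (z : A ⊗[K] A) :
    LinearMap.mul' K (Mult K A) (TensorProduct.map (emb K A : A →ₗ[K] Mult K A) S z) =
      emb K A (contractRight S z) := by
  induction z with
  | zero => simp
  | add x y hx hy => simp only [map_add, hx, hy]
  | tmul x y => exact emb_mul _ _

theorem contractLeft_ract_rightLeg (S : A →ₗ[K] Mult K A) (c : A) (z : A ⊗[K] A) :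
    contractLeft S (ract (rightLeg K A A (emb K A c)) z) = contractLeft S z * c := by
  induction z with
  | zero => simp
  | add x y hx hy => simp only [map_add, add_mul, hx, hy]
  | tmul x y => simp [lact_mul_right]

theorem contractRight_lact_leftLeg (S : A →ₗ[K] Mult K A) (c : A) (z : A ⊗[K] A) :
    contractRight S (lact (leftLeg K A A (emb K A c)) z) = c * contractRight S z := by
  induction z with
  | zero => simp
  | add x y hx hy => simp only [map_add, mul_add, hx, hy]
  | tmul x y => simp [ract_mul_left]

/-! ### Existence and uniqueness of the antipode -/

theorem emb_assoc_symm (t : A ⊗[K] (A ⊗[K] A)) :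
    emb K ((A ⊗[K] A) ⊗[K] A) ((TensorProduct.assoc K A A A).symm t) =
      assocMult (emb K (A ⊗[K] (A ⊗[K] A)) t) := by
  apply Mult.ext' <;> intro x
  · obtain ⟨x, rfl⟩ := (TensorProduct.assoc K A A A).symm.surjective x
    simp [assocMult, Mult.transport, assoc_symm_mul]
  · obtain ⟨x, rfl⟩ := (TensorProduct.assoc K A A A).symm.surjective x
    simp [assocMult, Mult.transport, assoc_symm_mul]

theorem emb_map_canon₂ (hΔ : IsMultiplierHopf Δ) (u : A) (y : A ⊗[K] A) :
    emb K ((A ⊗[K] A) ⊗[K] A) (LinearMap.rTensor A hΔ.canon₂.toLinearMap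
        ((TensorProduct.assoc K A A A).symm (u ⊗ₜ y))) =
      leftLeg K (A ⊗[K] A) A (leftLeg K A A (emb K A u)) * comulLeft Δ y := by
  induction y with
  | zero => simp
  | add x y hx hy => simp only [TensorProduct.tmul_add, map_add, mul_add, hx, hy]
  | tmul x y =>
    rw [TensorProduct.assoc_symm_tmul, LinearMap.rTensor_tmul, ← mtprod_emb,
      LinearEquiv.coe_coe, hΔ.emb_canon₂_tmul, comulLeft_tmul]
    change _ = mtprod (_ ⊗ₜ 1) * _
    rw [mtprod_mul, one_mul]

theorem emb_map_canon₁ (hΔ : IsMultiplierHopf Δ) (q : A) (y : A ⊗[K] A) :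
    emb K ((A ⊗[K] A) ⊗[K] A) ((TensorProduct.assoc K A A A).symm
        (LinearMap.lTensor A hΔ.canon₁.toLinearMap (TensorProduct.assoc K A A A (y ⊗ₜ q)))) =
      comulRight Δ y * rightLeg K (A ⊗[K] A) A (emb K A q) := by
  induction y with
  | zero => simp
  | add x y hx hy => simp only [TensorProduct.add_tmul, map_add, add_mul, hx, hy]
  | tmul x y =>
    rw [TensorProduct.assoc_tmul, LinearMap.lTensor_tmul, emb_assoc_symm, ← mtprod_emb,
      LinearEquiv.coe_coe, hΔ.emb_canon₁_tmul, comulRight_tmul, ← assocMult_rightLeg_rightLeg,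
      ← map_mul]
    change _ = assocMult (_ * mtprod (1 ⊗ₜ _))
    rw [mtprod_mul, mul_one]

/-- Coassociativity as a relation between the canonical maps. -/
theorem canon₁_canon₂ (hΔ : IsMultiplierHopf Δ) (a b c : A) :
    (TensorProduct.assoc K A A A).symm (LinearMap.lTensor A hΔ.canon₁.toLinearMap
        (TensorProduct.assoc K A A A (hΔ.canon₂ (a ⊗ₜ b) ⊗ₜ c))) =
      LinearMap.rTensor A hΔ.canon₂.toLinearMap
        ((TensorProduct.assoc K A A A).symm (a ⊗ₜ hΔ.canon₁ (b ⊗ₜ c))) := by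
  apply emb_injective (K := K) hΔ.nondegenerate₃
  rw [emb_map_canon₁, emb_map_canon₂]
  exact (hΔ.coassoc a b c _ _ (hΔ.emb_canon₁_tmul b c) (hΔ.emb_canon₂_tmul a b)).symm

/-- `(ε ⊗ ι)T₁⁻¹`, that is, `a ⊗ b ↦ S(a)b`. -/
def antipodeLeft (hΔ : IsMultiplierHopf Δ) (ε : A →ₙₐ[K] K) : A ⊗[K] A →ₗ[K] A :=
  counitLeft ε ∘ₗ hΔ.canon₁.symm.toLinearMap

/-- `(ι ⊗ ε)T₂⁻¹`, that is, `a ⊗ b ↦ aS(b)`. -/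
def antipodeRight (hΔ : IsMultiplierHopf Δ) (ε : A →ₙₐ[K] K) : A ⊗[K] A →ₗ[K] A :=
  counitRight ε ∘ₗ hΔ.canon₂.symm.toLinearMap

theorem antipodeLeft_canon₁ (hΔ : IsMultiplierHopf Δ) (z : A ⊗[K] A) :
    antipodeLeft hΔ ε (hΔ.canon₁ z) = counitLeft ε z := by simp [antipodeLeft]

theorem antipodeRight_canon₂ (hΔ : IsMultiplierHopf Δ) (z : A ⊗[K] A) :
    antipodeRight hΔ ε (hΔ.canon₂ z) = counitRight ε z := by simp [antipodeRight]

/-- The maps `antipodeLeft` and `antipodeRight` are the two actions of one multiplier. -/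
theorem mul_antipodeLeft (hΔ : IsMultiplierHopf Δ) (hε : IsCounit Δ ε) (c : A) (z : A ⊗[K] A) :
    c * antipodeLeft hΔ ε z = LinearMap.mul' K A (LinearMap.rTensor A (antipodeRight hΔ ε)
      ((TensorProduct.assoc K A A A).symm (c ⊗ₜ z))) := by
  obtain ⟨z, rfl⟩ := hΔ.canon₁.surjective z
  rw [antipodeLeft_canon₁]
  induction z with
  | zero => simp
  | add x y hx hy => simp only [TensorProduct.tmul_add, map_add, mul_add, hx, hy]
  | tmul p q =>
    -- both sides are linear in `c ⊗ p`, which may be taken to be a value of `T₂`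
    suffices h : ∀ w : A ⊗[K] A, counitRight ε w * q =
        LinearMap.mul' K A (LinearMap.rTensor A (antipodeRight hΔ ε)
          ((TensorProduct.assoc K A A A).symm (LinearMap.lTensor A hΔ.canon₁.toLinearMap
            (TensorProduct.assoc K A A A (w ⊗ₜ q))))) by
      simpa [smul_mul_assoc, mul_smul_comm] using h (c ⊗ₜ p)
    intro w
    obtain ⟨w, rfl⟩ := hΔ.canon₂.surjective w
    induction w with
    | zero => simp
    | add x y hx hy => simp only [TensorProduct.add_tmul, map_add, add_mul, hx, hy]
    | tmul u v =>
      have key : ∀ y : A ⊗[K] A, LinearMap.mul' K A (LinearMap.rTensor A (antipodeRight hΔ ε)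
          (LinearMap.rTensor A hΔ.canon₂.toLinearMap
            ((TensorProduct.assoc K A A A).symm (u ⊗ₜ y)))) = u * counitLeft ε y := by
        intro y
        induction y with
        | zero => simp
        | add x y hx hy => simp only [TensorProduct.tmul_add, map_add, mul_add, hx, hy]
        | tmul x y =>
          simp [antipodeRight_canon₂, smul_mul_assoc, mul_smul_comm]
      rw [canon₁_canon₂, key, counitRight_canon₂ hΔ hε, counitLeft_canon₁ hΔ hε]
      simp [mul_assoc]

theorem antipodeLeft_ract_rightLeg (hΔ : IsMultiplierHopf Δ) (b : A) (z : A ⊗[K] A) :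
    antipodeLeft hΔ ε (ract (rightLeg K A A (emb K A b)) z) = antipodeLeft hΔ ε z * b := by
  obtain ⟨z, rfl⟩ := hΔ.canon₁.surjective z
  rw [hΔ.ract_rightLeg_canon₁, antipodeLeft_canon₁, antipodeLeft_canon₁]
  induction z with
  | zero => simp
  | add x y hx hy => simp only [map_add, add_mul, hx, hy]
  | tmul x y => simp [smul_mul_assoc]

theorem antipodeRight_lact_leftLeg (hΔ : IsMultiplierHopf Δ) (b : A) (z : A ⊗[K] A) :
    antipodeRight hΔ ε (lact (leftLeg K A A (emb K A b)) z) = b * antipodeRight hΔ ε z := by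
  obtain ⟨z, rfl⟩ := hΔ.canon₂.surjective z
  rw [hΔ.lact_leftLeg_canon₂, antipodeRight_canon₂, antipodeRight_canon₂]
  induction z with
  | zero => simp
  | add x y hx hy => simp only [map_add, mul_add, hx, hy]
  | tmul x y => simp [mul_smul_comm]

theorem antipodeLeft_lact_comul (hΔ : IsMultiplierHopf Δ) (a : A) (z : A ⊗[K] A) :
    antipodeLeft hΔ ε (lact (Δ a) z) = ε a • antipodeLeft hΔ ε z := by
  obtain ⟨z, rfl⟩ := hΔ.canon₁.surjective z
  rw [hΔ.lact_comul_canon₁, antipodeLeft_canon₁, antipodeLeft_canon₁]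
  induction z with
  | zero => simp
  | add x y hx hy => simp only [map_add, smul_add, hx, hy]
  | tmul x y => simp [mul_smul]

/-- The antipode of a multiplier Hopf algebra, constructed from the canonical maps. -/
def antipodeMap (hΔ : IsMultiplierHopf Δ) (hε : IsCounit Δ ε) : A →ₗ[K] Mult K A where
  toFun a := Mult.mk' (antipodeLeft hΔ ε ∘ₗ TensorProduct.mk K A A a)
    (antipodeRight hΔ ε ∘ₗ (TensorProduct.mk K A A).flip a)
    (fun b c => (antipodeLeft_ract_rightLeg hΔ c (a ⊗ₜ b)))
    (fun b c => (antipodeRight_lact_leftLeg hΔ b (c ⊗ₜ a)))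
    (fun b c => (mul_antipodeLeft hΔ hε b (a ⊗ₜ c)).symm)
  map_add' a b := by
    apply Mult.ext' <;> intro c
    · exact (congrArg (antipodeLeft hΔ ε) (TensorProduct.add_tmul a b c)).trans (map_add _ _ _)
    · exact (congrArg (antipodeRight hΔ ε) (TensorProduct.tmul_add c a b)).trans (map_add _ _ _)
  map_smul' r a := by
    apply Mult.ext' <;> intro c
    · exact map_smul (antipodeLeft hΔ ε) r (a ⊗ₜ c)
    · exact (congrArg (antipodeRight hΔ ε) (TensorProduct.tmul_smul r c a)).trans (map_smul _ _ _)

theorem contractLeft_antipodeMap (hΔ : IsMultiplierHopf Δ) (hε : IsCounit Δ ε) :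
    contractLeft (antipodeMap hΔ hε) = antipodeLeft hΔ ε := by
  ext a b; rfl

theorem contractRight_antipodeMap (hΔ : IsMultiplierHopf Δ) (hε : IsCounit Δ ε) :
    contractRight (antipodeMap hΔ hε) = antipodeRight hΔ ε := by
  ext a b; rfl

theorem isAntipode_antipodeMap (hΔ : IsMultiplierHopf Δ) (hε : IsCounit Δ ε) :
    IsAntipode Δ ε (antipodeMap hΔ hε) where
  map_mul a b := by
    refine Mult.ext_lact hΔ.nondegenerate fun c => ?_
    change antipodeLeft hΔ ε ((a * b) ⊗ₜ c) = antipodeLeft hΔ ε (b ⊗ₜ antipodeLeft hΔ ε (a ⊗ₜ c))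
    -- both sides are linear in `a ⊗ c`, which may be taken to be a value of `T₁`
    suffices h : ∀ w : A ⊗[K] A, antipodeLeft hΔ ε (ract (leftLeg K A A (emb K A b)) w) =
        antipodeLeft hΔ ε (b ⊗ₜ antipodeLeft hΔ ε w) from h (a ⊗ₜ c)
    intro w
    obtain ⟨w, rfl⟩ := hΔ.canon₁.surjective w
    rw [antipodeLeft_canon₁]
    induction w with
    | zero => simp
    | add x y hx hy => simp only [map_add, TensorProduct.tmul_add, hx, hy]
    | tmul p q => rw [← hΔ.lact_comul_tmul, antipodeLeft_lact_comul, counitLeft_tmul,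
        TensorProduct.tmul_smul, map_smul]
  left a b z hz := by
    have hz' : z = hΔ.canon₁ (a ⊗ₜ b) := by
      apply emb_injective (K := K) hΔ.nondegenerate₂
      rw [hz, hΔ.emb_canon₁_tmul, rightLeg_apply]
    rw [mul'_map_emb_right, contractLeft_antipodeMap, hz', antipodeLeft_canon₁, counitLeft_tmul]
  right a b z hz := by
    have hz' : z = hΔ.canon₂ (a ⊗ₜ b) := by
      apply emb_injective (K := K) hΔ.nondegenerate₂
      rw [hz, hΔ.emb_canon₂_tmul, leftLeg_apply]
    rw [mul'_map_emb_left, contractRight_antipodeMap, hz', antipodeRight_canon₂, counitRight_tmul]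

/-- The antipode is determined by the identity `m(S ⊗ ι)(Δ(a)(1 ⊗ b)) = ε(a)b` alone. -/
theorem eq_antipodeMap (hΔ : IsMultiplierHopf Δ) (hε : IsCounit Δ ε) {S : A →ₗ[K] Mult K A}
    (hS : ∀ a b, contractLeft S (hΔ.canon₁ (a ⊗ₜ b)) = ε a • b) : S = antipodeMap hΔ hε := by
  have h : ∀ z, contractLeft S (hΔ.canon₁ z) = counitLeft ε z := fun z => by
    induction z with
    | zero => simp
    | add x y hx hy => simp only [map_add, hx, hy]
    | tmul a b => exact hS a b
  ext1 a
  refine Mult.ext_lact hΔ.nondegenerate fun b => ?_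
  change contractLeft S (a ⊗ₜ b) = antipodeLeft hΔ ε (a ⊗ₜ b)
  rw [antipodeLeft, LinearMap.comp_apply, ← h]
  simp

section

variable {S : A →ₗ[K] Mult K A}

theorem IsAntipode.contractLeft_canon₁ (hΔ : IsMultiplierHopf Δ)
    (hS : IsAntipode Δ ε S) (z : A ⊗[K] A) :
    contractLeft S (hΔ.canon₁ z) = counitLeft ε z := by
  induction z with
  | zero => simp
  | add x y hx hy => simp only [map_add, hx, hy]
  | tmul a b =>
    apply emb_injective (K := K) hΔ.nondegenerate
    rw [← mul'_map_emb_right, hS.left a b _ (hΔ.emb_canon₁_tmul a b), counitLeft_tmul]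

theorem IsAntipode.contractRight_canon₂ (hΔ : IsMultiplierHopf Δ)
    (hS : IsAntipode Δ ε S) (z : A ⊗[K] A) :
    contractRight S (hΔ.canon₂ z) = counitRight ε z := by
  induction z with
  | zero => simp
  | add x y hx hy => simp only [map_add, hx, hy]
  | tmul a b =>
    apply emb_injective (K := K) hΔ.nondegenerate
    rw [← mul'_map_emb_left, hS.right a b _ (hΔ.emb_canon₂_tmul a b), counitRight_tmul]

theorem IsAntipode.contractLeft_ract_leftLeg (hS : IsAntipode Δ ε S) (a : A) (z : A ⊗[K] A) :
    contractLeft S (ract (leftLeg K A A (emb K A a)) z) = lact (S a) (contractLeft S z) := by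
  induction z with
  | zero => simp
  | add x y hx hy => simp only [map_add, hx, hy]
  | tmul x y => simp [hS.map_mul]

theorem IsAntipode.contractRight_lact_rightLeg (hS : IsAntipode Δ ε S) (a : A) (z : A ⊗[K] A) :
    contractRight S (lact (rightLeg K A A (emb K A a)) z) = ract (S a) (contractRight S z) := by
  induction z with
  | zero => simp
  | add x y hx hy => simp only [map_add, hx, hy]
  | tmul x y => simp [hS.map_mul]

/-- `m(S ⊗ ι)(Δ(a)z) = ε(a) m(S ⊗ ι)(z)`. -/
theorem IsAntipode.contractLeft_lact_comul (hΔ : IsMultiplierHopf Δ)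
    (hS : IsAntipode Δ ε S) (a : A) (z : A ⊗[K] A) :
    contractLeft S (lact (Δ a) z) = ε a • contractLeft S z := by
  induction z with
  | zero => simp
  | add x y hx hy => simp only [map_add, smul_add, hx, hy]
  | tmul x y => rw [hΔ.lact_comul_tmul, hS.contractLeft_ract_leftLeg, hS.contractLeft_canon₁ hΔ,
      counitLeft_tmul, map_smul, contractLeft_tmul]

/-- `m(ι ⊗ S)(zΔ(a)) = ε(a) m(ι ⊗ S)(z)`. -/
theorem IsAntipode.contractRight_ract_comul (hΔ : IsMultiplierHopf Δ)
    (hS : IsAntipode Δ ε S) (a : A) (z : A ⊗[K] A) :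
    contractRight S (ract (Δ a) z) = ε a • contractRight S z := by
  induction z with
  | zero => simp
  | add x y hx hy => simp only [map_add, smul_add, hx, hy]
  | tmul x y => rw [hΔ.ract_comul_tmul, hS.contractRight_lact_rightLeg, hS.contractRight_canon₂ hΔ,
      counitRight_tmul, map_smul, contractRight_tmul]

end

/-! ### Bijectivity of the antipode in the regular case -/

section Regular

variable {S S' : A →ₗ[K] Mult K A}

/-- If `S'` is the antipode of the co-opposite comultiplication, then `S(S'(x)y) = S(y)x`. -/
theorem IsAntipode.antipode_contractLeft (hΔ : IsRegularMultiplierHopf Δ) (hS : IsAntipode Δ ε S)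
    (hS' : IsAntipode (coop Δ) ε S') (z : A ⊗[K] A) :
    S (contractLeft S' z) = emb K A (contractLeft S (TensorProduct.comm K A A z)) := by
  obtain ⟨z, rfl⟩ := hΔ.coop_isMultiplierHopf.canon₁.surjective z
  rw [hS'.contractLeft_canon₁ hΔ.coop_isMultiplierHopf]
  induction z with
  | zero => simp
  | add x y hx hy => simp only [map_add, hx, hy]
  | tmul p q =>
    have hA := hΔ.isMultiplierHopf.nondegenerate
    have h1 : emb K (A ⊗[K] A) (TensorProduct.comm K A A
        (hΔ.coop_isMultiplierHopf.canon₁ (p ⊗ₜ q))) = Δ p * leftLeg K A A (emb K A q) := by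
      rw [← flipMult_emb, IsMultiplierHopf.emb_canon₁_tmul, _root_.map_mul, coop_apply,
        flipMult_flipMult, flipMult_rightLeg]
    refine Mult.ext_lact hA fun c => ?_
    rw [lact_emb, ← contractLeft_ract_rightLeg]
    have h2 : ract (rightLeg K A A (emb K A c)) (TensorProduct.comm K A A
        (hΔ.coop_isMultiplierHopf.canon₁ (p ⊗ₜ q))) = lact (Δ p) (q ⊗ₜ c) := by
      apply emb_injective (K := K) hΔ.isMultiplierHopf.nondegenerate₂
      rw [← emb_mul, h1, mul_assoc, leftLeg_mul_rightLeg, mtprod_emb, mul_emb]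
    rw [h2, hS.contractLeft_lact_comul hΔ.isMultiplierHopf, counitLeft_tmul, map_smul,
      contractLeft_tmul]
    rfl

theorem IsAntipode.exists_linearMap (hΔ : IsRegularMultiplierHopf Δ) (hε : IsCounit Δ ε)
    (hS : IsAntipode Δ ε S) (hS' : IsAntipode (coop Δ) ε S') :
    ∃ f : A →ₗ[K] A, ∀ a, S a = emb K A (f a) := by
  have hmem : ∀ a, ∃ b, S a = emb K A b := by
    intro a
    obtain ⟨z, rfl⟩ := counitLeft_surjective hΔ.isMultiplierHopf hε a
    rw [← hS'.contractLeft_canon₁ hΔ.coop_isMultiplierHopf, hS.antipode_contractLeft hΔ hS']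
    exact ⟨_, rfl⟩
  choose f hf using hmem
  have hinj := emb_injective (K := K) hΔ.isMultiplierHopf.nondegenerate
  exact ⟨{ toFun := f
           map_add' := fun a b => hinj (by rw [map_add, ← hf, ← hf, ← hf, map_add])
           map_smul' := fun r a => hinj (by
             rw [RingHom.id_apply, map_smul, ← hf, ← hf, map_smul]) },
    hf⟩

theorem IsAntipode.comp_eq_id (hΔ : IsRegularMultiplierHopf Δ) (hε : IsCounit Δ ε)
    (hS : IsAntipode Δ ε S) (hS' : IsAntipode (coop Δ) ε S') {f g : A →ₗ[K] A}
    (hf : ∀ a, S a = emb K A (f a)) (hg : ∀ a, S' a = emb K A (g a)) (x : A) : f (g x) = x := by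
  have hA := hΔ.isMultiplierHopf.nondegenerate
  have h : ∀ y, f y * (f (g x) - x) = 0 := by
    intro y
    have h1 := hS.antipode_contractLeft hΔ hS' (x ⊗ₜ y)
    rw [contractLeft_tmul, hg, lact_emb, hS.map_mul, TensorProduct.comm_tmul, contractLeft_tmul,
      hf, hf, lact_emb, ← _root_.map_mul] at h1
    rw [mul_sub, sub_eq_zero]
    exact emb_injective hA h1
  rw [← sub_eq_zero]
  refine hA.right _ fun a => ?_
  obtain ⟨z, rfl⟩ := counitRight_surjective hΔ.isMultiplierHopf hε a
  rw [← hS.contractRight_canon₂ hΔ.isMultiplierHopf]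
  generalize hΔ.isMultiplierHopf.canon₂ z = z
  induction z with
  | zero => simp
  | add x y hx hy => rw [map_add, add_mul, hx, hy, add_zero]
  | tmul a y => rw [contractRight_tmul, hf, ract_emb, mul_assoc, h, mul_zero]

/-- The antipode of a regular multiplier Hopf algebra is a bijection of `A`, and its inverse is the
antipode of the co-opposite comultiplication. -/
theorem IsAntipode.exists_linearEquiv (hΔ : IsRegularMultiplierHopf Δ) (hε : IsCounit Δ ε)
    (hS : IsAntipode Δ ε S) (hS' : IsAntipode (coop Δ) ε S') :
    ∃ e : A ≃ₗ[K] A, (∀ a, S a = emb K A (e a)) ∧ ∀ a, S' a = emb K A (e.symm a) := by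
  have hε' := hε.coop hΔ.isMultiplierHopf
  have hS'' : IsAntipode (coop (coop Δ)) ε S := by rwa [coop_coop]
  obtain ⟨f, hf⟩ := hS.exists_linearMap hΔ hε hS'
  obtain ⟨g, hg⟩ := hS'.exists_linearMap hΔ.coop hε' hS''
  refine ⟨LinearEquiv.ofLinearMap f g ?_ ?_, hf, hg⟩
  · ext x
    exact hS.comp_eq_id hΔ hε hS' hf hg x
  · ext x
    exact hS'.comp_eq_id hΔ.coop hε' hS'' hg hf x

end Regular

end Antipode

section Twist

variable {K : Type u} [Field K]
  {A : Type v} [NonUnitalRing A] [Module K A] [IsScalarTower K A A] [SMulCommClass K A A]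
  {Δ : A →ₙₐ[K] Mult K (A ⊗[K] A)} {ε : A →ₙₐ[K] K} {S : A →ₗ[K] Mult K A} {σ : A ≃ₗ[K] A}

theorem lact_ract_comm (hA : Nondegenerate A) (m n : Mult K A) (a : A) :
    lact m (ract n a) = ract n (lact m a) := by
  apply emb_injective (K := K) hA
  rw [← mul_emb, ← emb_mul, ← emb_mul, ← mul_emb, mul_assoc]

/-! ### The antipode on multipliers -/

theorem antipode_equiv_mul (hA : Nondegenerate A) (hS : IsAntipode Δ ε S)
    (hσ : ∀ a, S a = emb K A (σ a)) (a b : A) : σ (a * b) = σ b * σ a := by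
  apply emb_injective (K := K) hA
  rw [← hσ, hS.map_mul, hσ, hσ, map_mul]

/-- The extension to multipliers of an anti-automorphism `σ` of `A`:
`σ(m)a = σ(σ⁻¹(a)m)` and `aσ(m) = σ(mσ⁻¹(a))`. -/
def antiMult (σ : A ≃ₗ[K] A) (hσ : ∀ a b, σ (a * b) = σ b * σ a) : Mult K A →ₗ[K] Mult K A where
  toFun m := Mult.mk' (σ.toLinearMap ∘ₗ ract m ∘ₗ σ.symm.toLinearMap)
    (σ.toLinearMap ∘ₗ lact m ∘ₗ σ.symm.toLinearMap)
    (fun a b => by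
      obtain ⟨a, rfl⟩ := σ.surjective a
      obtain ⟨b, rfl⟩ := σ.surjective b
      simp [← hσ, ract_mul_left])
    (fun a b => by
      obtain ⟨a, rfl⟩ := σ.surjective a
      obtain ⟨b, rfl⟩ := σ.surjective b
      simp [← hσ, lact_mul_right])
    (fun a b => by
      obtain ⟨a, rfl⟩ := σ.surjective a
      obtain ⟨b, rfl⟩ := σ.surjective b
      simp [← hσ, ract_mul])
  map_add' m n := by
    apply Mult.ext' <;> intro a <;> simp
  map_smul' r m := by
    apply Mult.ext' <;> intro a <;> simp

@[simp] theorem lact_antiMult (hσ : ∀ a b, σ (a * b) = σ b * σ a) (m : Mult K A) (a : A) :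
    lact (antiMult σ hσ m) (σ a) = σ (ract m a) := by simp [antiMult]

@[simp] theorem ract_antiMult (hσ : ∀ a b, σ (a * b) = σ b * σ a) (m : Mult K A) (a : A) :
    ract (antiMult σ hσ m) (σ a) = σ (lact m a) := by simp [antiMult]

theorem mul_antiMult (hS : ∀ a, S a = emb K A (σ a)) (hσ : ∀ a b, σ (a * b) = σ b * σ a)
    (m : Mult K A) (a : A) : S a * antiMult σ hσ m = S (lact m a) := by
  rw [hS, hS, emb_mul, ract_antiMult]

theorem antiMult_mul (hS : ∀ a, S a = emb K A (σ a)) (hσ : ∀ a b, σ (a * b) = σ b * σ a)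
    (m : Mult K A) (a : A) : antiMult σ hσ m * S a = S (ract m a) := by
  rw [hS, hS, mul_emb, lact_antiMult]

theorem extendAnti_eq_antiMult (hA : Nondegenerate A) (hS : ∀ a, S a = emb K A (σ a))
    (hσ : ∀ a b, σ (a * b) = σ b * σ a) (m : Mult K A) : extendAnti S m = antiMult σ hσ m := by
  have hex : ∃ n, IsExtension ((MulOpposite.opLinearEquiv K).toLinearMap ∘ₗ S) m n :=
    ⟨MulOpposite.op (antiMult σ hσ m), fun b =>
      ⟨congrArg MulOpposite.op (mul_antiMult hS hσ m b),
        congrArg MulOpposite.op (antiMult_mul hS hσ m b)⟩⟩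
  have h : ∀ b, S b * extendAnti S m = S (lact m b) := fun b => by
    have h1 := (hex.choose_spec b).1
    have h2 : extendAnti S m = hex.choose.unop := by
      rw [extendAnti, extend, dif_pos hex]
    rw [h2]
    exact congrArg MulOpposite.unop h1
  refine Mult.ext_emb_mul hA fun a => ?_
  obtain ⟨a, rfl⟩ := σ.surjective a
  rw [← hS, h, mul_antiMult hS hσ]

/-! ### The multiplier `Q` -/

/-- The inclusion of `M(A) ⊗ A` in `M(A ⊗ A)`. -/
def multTensorMap (K : Type u) [Field K] (A : Type v) [NonUnitalRing A] [Module K A]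
    [IsScalarTower K A A] [SMulCommClass K A A] : Mult K A ⊗[K] A →ₗ[K] Mult K (A ⊗[K] A) :=
  mtprod ∘ₗ TensorProduct.map (LinearMap.id : Mult K A →ₗ[K] Mult K A)
    (emb K A : A →ₗ[K] Mult K A)

/-- The inclusion of `A ⊗ M(A)` in `M(A ⊗ A)`. -/
def tensorMultMap (K : Type u) [Field K] (A : Type v) [NonUnitalRing A] [Module K A]
    [IsScalarTower K A A] [SMulCommClass K A A] : A ⊗[K] Mult K A →ₗ[K] Mult K (A ⊗[K] A) :=
  mtprod ∘ₗ TensorProduct.map (emb K A : A →ₗ[K] Mult K A)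
    (LinearMap.id : Mult K A →ₗ[K] Mult K A)

/-- For `c` in `A`, the map `M(A) ⊗ A → A ⊗ A`, `m ⊗ b ↦ mc ⊗ b`. -/
def multTensorLact (c : A) : Mult K A ⊗[K] A →ₗ[K] A ⊗[K] A :=
  LinearMap.rTensor A ((lactLin K A).flip c)

/-- For `c` in `A`, the map `M(A) ⊗ A → A ⊗ A`, `m ⊗ b ↦ cm ⊗ b`. -/
def multTensorRact (c : A) : Mult K A ⊗[K] A →ₗ[K] A ⊗[K] A :=
  LinearMap.rTensor A ((ractLin K A).flip c)

/-- For `c` in `A`, the map `A ⊗ M(A) → A ⊗ A`, `b ⊗ m ↦ b ⊗ mc`. -/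
def tensorMultLact (c : A) : A ⊗[K] Mult K A →ₗ[K] A ⊗[K] A :=
  LinearMap.lTensor A ((lactLin K A).flip c)

@[simp] theorem multTensorMap_tmul (m : Mult K A) (b : A) :
    multTensorMap K A (m ⊗ₜ b) = mtprod (m ⊗ₜ emb K A b) := rfl
@[simp] theorem tensorMultMap_tmul (m : Mult K A) (b : A) :
    tensorMultMap K A (b ⊗ₜ m) = mtprod (emb K A b ⊗ₜ m) := rfl
@[simp] theorem multTensorLact_tmul (c : A) (m : Mult K A) (b : A) :
    multTensorLact c (m ⊗ₜ[K] b) = lact m c ⊗ₜ[K] b := rfl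
@[simp] theorem multTensorRact_tmul (c : A) (m : Mult K A) (b : A) :
    multTensorRact c (m ⊗ₜ[K] b) = ract m c ⊗ₜ[K] b := rfl
@[simp] theorem tensorMultLact_tmul (c : A) (m : Mult K A) (b : A) :
    tensorMultLact c (b ⊗ₜ[K] m) = b ⊗ₜ[K] lact m c := rfl

theorem multTensorMap_mul_leftLeg (t : Mult K A ⊗[K] A) (c : A) :
    multTensorMap K A t * leftLeg K A A (emb K A c) =
      emb K (A ⊗[K] A) (multTensorLact c t) := by
  induction t with
  | zero => simp
  | add x y hx hy => simp only [map_add, add_mul, hx, hy]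
  | tmul m b =>
    rw [multTensorMap_tmul, multTensorLact_tmul, leftLeg_apply, mtprod_mul, mul_one, mul_emb,
      mtprod_emb]

theorem leftLeg_mul_multTensorMap (t : Mult K A ⊗[K] A) (c : A) :
    leftLeg K A A (emb K A c) * multTensorMap K A t =
      emb K (A ⊗[K] A) (multTensorRact c t) := by
  induction t with
  | zero => simp
  | add x y hx hy => simp only [map_add, mul_add, hx, hy]
  | tmul m b =>
    rw [multTensorMap_tmul, multTensorRact_tmul, leftLeg_apply, mtprod_mul, one_mul, emb_mul,
      mtprod_emb]

theorem tensorMultMap_mul_rightLeg (t : A ⊗[K] Mult K A) (c : A) :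
    tensorMultMap K A t * rightLeg K A A (emb K A c) =
      emb K (A ⊗[K] A) (tensorMultLact c t) := by
  induction t with
  | zero => simp
  | add x y hx hy => simp only [map_add, add_mul, hx, hy]
  | tmul m b =>
    rw [tensorMultMap_tmul, tensorMultLact_tmul, rightLeg_apply, mtprod_mul, mul_one, mul_emb,
      mtprod_emb]

theorem lact_tmul_eq_multTensorLact (hA : Nondegenerate A) {M : Mult K (A ⊗[K] A)} {a : A}
    {t : Mult K A ⊗[K] A} (h : M * rightLeg K A A (emb K A a) = multTensorMap K A t) (c : A) :
    lact M (c ⊗ₜ a) = multTensorLact c t := by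
  apply emb_injective (K := K) (hA.tensor hA)
  rw [← multTensorMap_mul_leftLeg, ← h, mul_assoc, rightLeg_mul_leftLeg, mtprod_emb, mul_emb]

theorem lact_tmul_eq_tensorMultLact (hA : Nondegenerate A) {M : Mult K (A ⊗[K] A)} {c : A}
    {t : A ⊗[K] Mult K A} (h : M * leftLeg K A A (emb K A c) = tensorMultMap K A t) (a : A) :
    lact M (c ⊗ₜ a) = tensorMultLact a t := by
  apply emb_injective (K := K) (hA.tensor hA)
  rw [← tensorMultMap_mul_rightLeg, ← h, mul_assoc, leftLeg_mul_rightLeg, mtprod_emb, mul_emb]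

/-- The contraction `m(S ⊗ ι) : M(A) ⊗ A → A`. -/
def multContract (σ : A ≃ₗ[K] A) (hσ : ∀ a b, σ (a * b) = σ b * σ a) : Mult K A ⊗[K] A →ₗ[K] A :=
  TensorProduct.lift (lactLin K A ∘ₗ antiMult σ hσ)

@[simp] theorem multContract_tmul (hσ : ∀ a b, σ (a * b) = σ b * σ a) (m : Mult K A) (b : A) :
    multContract σ hσ (m ⊗ₜ b) = lact (antiMult σ hσ m) b := rfl

theorem contractLeft_multTensorLact (hS : ∀ a, S a = emb K A (σ a))
    (hσ : ∀ a b, σ (a * b) = σ b * σ a) (c : A) (t : Mult K A ⊗[K] A) :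
    contractLeft S (multTensorLact c t) = σ c * multContract σ hσ t := by
  induction t with
  | zero => simp
  | add x y hx hy => simp only [map_add, mul_add, hx, hy]
  | tmul m b =>
    rw [multTensorLact_tmul, contractLeft_tmul, multContract_tmul, ← mul_antiMult hS hσ, hS]
    rfl

/-- The contraction `m(σ ⊗ ι) : A ⊗ M(A) → A`. -/
def contractMult (σ : A ≃ₗ[K] A) : A ⊗[K] Mult K A →ₗ[K] A :=
  TensorProduct.lift ((ractLin K A).flip ∘ₗ σ.toLinearMap)

@[simp] theorem contractMult_tmul (m : Mult K A) (b : A) :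
    contractMult σ (b ⊗ₜ m) = ract m (σ b) := rfl

theorem contractLeft_tensorMultLact (hS : ∀ a, S a = emb K A (σ a)) (c : A)
    (t : A ⊗[K] Mult K A) :
    contractLeft S (tensorMultLact c t) = contractMult σ t * c := by
  induction t with
  | zero => simp
  | add x y hx hy => simp only [map_add, add_mul, hx, hy]
  | tmul b m =>
    rw [tensorMultLact_tmul, contractLeft_tmul, contractMult_tmul, hS, lact_emb, ract_mul]

/-- `Q` is the multiplier `S(J⁽¹⁾)J⁽²⁾`, described without reference to a decomposition of `J`:
`S(c) Q a = m(S ⊗ ι)(J(c ⊗ a))`. -/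
def IsContraction (S : A →ₗ[K] Mult K A) (J : Mult K (A ⊗[K] A)) (Q : Mult K A) : Prop :=
  ∀ c a : A, contractLeft S (lact J (c ⊗ₜ a)) = lact (S c * Q) a

theorem exists_isContraction (hA : Nondegenerate A) (hS : ∀ a, S a = emb K A (σ a))
    (hσ : ∀ a b, σ (a * b) = σ b * σ a) {J : Mult K (A ⊗[K] A)}
    (hJ : ∀ a, J * rightLeg K A A (emb K A a) ∈ multTensor K A)
    (hJ' : ∀ a, J * leftLeg K A A (emb K A a) ∈ tensorMult K A) :
    ∃ Q : Mult K A, IsContraction S J Q := by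
  have h1 : ∀ a, ∃ x, ∀ c, contractLeft S (lact J (c ⊗ₜ a)) = σ c * x := by
    intro a
    obtain ⟨t, ht⟩ := hJ a
    exact ⟨multContract σ hσ t, fun c => by
      rw [lact_tmul_eq_multTensorLact hA ht.symm, contractLeft_multTensorLact hS hσ]⟩
  have h2 : ∀ c, ∃ x, ∀ a, contractLeft S (lact J (c ⊗ₜ a)) = x * a := by
    intro c
    obtain ⟨t, ht⟩ := hJ' c
    exact ⟨contractMult σ t, fun a => by
      rw [lact_tmul_eq_tensorMultLact hA ht.symm, contractLeft_tensorMultLact hS]⟩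
  choose L hL using h1
  choose R hR using h2
  have cancelL : ∀ x y : A, (∀ c, σ c * x = σ c * y) → x = y := fun x y h => by
    rw [← sub_eq_zero]
    refine hA.right _ fun a => ?_
    obtain ⟨a, rfl⟩ := σ.surjective a
    rw [mul_sub, h, sub_self]
  have cancelR : ∀ x y : A, (∀ c, x * c = y * c) → x = y := fun x y h => by
    rw [← sub_eq_zero]
    exact hA.left _ fun a => by rw [sub_mul, h, sub_self]
  have hS' : ∀ a z, contractLeft S (ract (leftLeg K A A (emb K A a)) z) =
      σ a * contractLeft S z := by
    intro a z
    induction z with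
    | zero => simp
    | add x y hx hy => simp only [map_add, mul_add, hx, hy]
    | tmul x y => simp [hS, hσ]
  let L' : A →ₗ[K] A :=
    { toFun := L
      map_add' := fun a b => cancelL _ _ fun c => by
        rw [← hL, mul_add, ← hL, ← hL, TensorProduct.tmul_add, map_add, map_add]
      map_smul' := fun r a => cancelL _ _ fun c => by
        rw [RingHom.id_apply, mul_smul_comm, ← hL, ← hL, TensorProduct.tmul_smul, map_smul,
          map_smul] }
  let R' : A →ₗ[K] A :=
    { toFun := R
      map_add' := fun a b => cancelR _ _ fun c => by
        rw [← hR, add_mul, ← hR, ← hR, TensorProduct.add_tmul, map_add, map_add]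
      map_smul' := fun r a => cancelR _ _ fun c => by
        rw [RingHom.id_apply, smul_mul_assoc, ← hR, ← hR, ← TensorProduct.smul_tmul', map_smul,
          map_smul] }
  refine ⟨Mult.mk' L' (R' ∘ₗ σ.symm.toLinearMap) (fun a b => cancelL _ _ fun c => ?_)
    (fun a b => cancelR _ _ fun c => ?_) (fun a b => ?_), fun c a => ?_⟩
  · change σ c * L (a * b) = σ c * (L a * b)
    rw [← mul_assoc, ← hL, ← hL, ← contractLeft_ract_rightLeg, ← lact_ract_comm (hA.tensor hA)]
    rfl
  · obtain ⟨a, rfl⟩ := σ.surjective a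
    obtain ⟨b, rfl⟩ := σ.surjective b
    change R (σ.symm (σ a * σ b)) * c = σ a * R (σ.symm (σ b)) * c
    rw [← hσ, σ.symm_apply_apply, σ.symm_apply_apply, mul_assoc, ← hR, ← hR, ← hS',
      ← lact_ract_comm (hA.tensor hA)]
    rfl
  · obtain ⟨a, rfl⟩ := σ.surjective a
    change R (σ.symm (σ a)) * b = σ a * L b
    rw [σ.symm_apply_apply, ← hL, hR]
  · rw [hL, lact_mul, hS]
    rfl

theorem IsContraction.isTwistMultiplier (hA : Nondegenerate A) (hS : ∀ a, S a = emb K A (σ a))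
    (hσ : ∀ a b, σ (a * b) = σ b * σ a) {J : Mult K (A ⊗[K] A)} {Q : Mult K A}
    (hQ : IsContraction S J Q) : IsTwistMultiplier S J Q where
  left a n m b h := by
    have h' : J * rightLeg K A A (emb K A a) = multTensorMap K A (∑ i, m i ⊗ₜ b i) := by
      rw [rightLeg_apply, h, map_sum]; rfl
    have key : lact Q a = multContract σ hσ (∑ i, m i ⊗ₜ b i) := by
      rw [← sub_eq_zero]
      refine hA.right _ fun c => ?_
      obtain ⟨c, rfl⟩ := σ.surjective c
      rw [mul_sub, sub_eq_zero, ← contractLeft_multTensorLact hS,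
        ← lact_tmul_eq_multTensorLact hA h', hQ, lact_mul, hS]
      rfl
    rw [key, map_sum]
    exact Finset.sum_congr rfl fun i _ => by
      rw [multContract_tmul, extendAnti_eq_antiMult hA hS hσ]
  right a c n b m hc h := by
    have h' : J * leftLeg K A A (emb K A c) = tensorMultMap K A (∑ i, b i ⊗ₜ m i) := by
      rw [leftLeg_apply, h, map_sum]; rfl
    have hca : σ c = a := emb_injective hA (by rw [← hS, hc])
    have key : ract Q a = contractMult σ (∑ i, b i ⊗ₜ m i) := by
      rw [← sub_eq_zero]
      refine hA.left _ fun y => ?_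
      rw [sub_mul, sub_eq_zero, ← contractLeft_tensorMultLact hS,
        ← lact_tmul_eq_tensorMultLact hA h', hQ, lact_mul, hS, ← hca, ract_mul]
      rfl
    rw [key, map_sum, map_sum]
    exact Finset.sum_congr rfl fun i _ => by rw [contractMult_tmul, hS, emb_mul]

/-- The multiplier `Q` is unique: its left action is prescribed. -/
theorem IsTwistMultiplier.eq (hA : Nondegenerate A) {J : Mult K (A ⊗[K] A)}
    (hJ : ∀ a, J * rightLeg K A A (emb K A a) ∈ multTensor K A) {X Y : Mult K A}
    (hX : IsTwistMultiplier S J X) (hY : IsTwistMultiplier S J Y) : X = Y := by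
  refine Mult.ext_lact hA fun a => ?_
  obtain ⟨t, ht⟩ := hJ a
  obtain ⟨n, m, b, rfl⟩ : ∃ (n : ℕ) (m : Fin n → Mult K A) (b : Fin n → A),
      t = ∑ i, m i ⊗ₜ b i := by
    obtain ⟨s, hs⟩ := TensorProduct.exists_finset t
    refine ⟨s.card, fun i => (s.equivFin.symm i : _).1.1, fun i => (s.equivFin.symm i : _).1.2, ?_⟩
    rw [hs, ← Finset.sum_coe_sort]
    exact (Equiv.sum_comp s.equivFin.symm
      (fun i : s => i.1.1 ⊗ₜ[K] i.1.2)).symm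
  have h : J * mtprod (1 ⊗ₜ emb K A a) = ∑ i, mtprod (m i ⊗ₜ emb K A (b i)) := by
    rw [← rightLeg_apply, ← ht, map_sum]; rfl
  rw [hX.left a n m b h, hY.left a n m b h]

/-! ### Contractions of the twist equation -/

variable (hΔ : IsMultiplierHopf Δ) (hε : IsCounit Δ ε)

/-- The contraction `m(S ⊗ ι)` of the first two legs. -/
def contract₁₂ (S : A →ₗ[K] Mult K A) : (A ⊗[K] A) ⊗[K] A →ₗ[K] A ⊗[K] A :=
  LinearMap.rTensor A (contractLeft S)

/-- The contraction `m(S ⊗ ι)` of the last two legs. -/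
def contract₂₃ (S : A →ₗ[K] Mult K A) : (A ⊗[K] A) ⊗[K] A →ₗ[K] A ⊗[K] A :=
  LinearMap.lTensor A (contractLeft S) ∘ₗ (TensorProduct.assoc K A A A).toLinearMap

@[simp] theorem contract₁₂_tmul (z : A ⊗[K] A) (c : A) :
    contract₁₂ S (z ⊗ₜ c) = contractLeft S z ⊗ₜ c := rfl

@[simp] theorem contract₂₃_assoc_symm_tmul (a : A) (z : A ⊗[K] A) :
    contract₂₃ S ((TensorProduct.assoc K A A A).symm (a ⊗ₜ z)) = a ⊗ₜ contractLeft S z := by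
  simp [contract₂₃]

@[simp] theorem contract₂₃_tmul (a b c : A) :
    contract₂₃ S ((a ⊗ₜ b) ⊗ₜ c) = a ⊗ₜ lact (S b) c := rfl

theorem contract₁₂_assoc_symm_tmul (a : A) (z : A ⊗[K] A) :
    contract₁₂ S ((TensorProduct.assoc K A A A).symm (a ⊗ₜ z)) =
      lact (leftLeg K A A (S a)) z := by
  induction z with
  | zero => simp
  | add x y hx hy => simp only [TensorProduct.tmul_add, map_add, hx, hy]
  | tmul x y => simp

theorem lact_assocMult_mtprod (m : Mult K A) (M : Mult K (A ⊗[K] A)) (a : A) (z : A ⊗[K] A) :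
    lact (assocMult (mtprod (m ⊗ₜ M))) ((TensorProduct.assoc K A A A).symm (a ⊗ₜ z)) =
      (TensorProduct.assoc K A A A).symm (lact m a ⊗ₜ lact M z) := by
  simp [assocMult, Mult.transport]

theorem lact_assocMult_rightLeg (M : Mult K (A ⊗[K] A)) (a : A) (z : A ⊗[K] A) :
    lact (assocMult (rightLeg K A (A ⊗[K] A) M)) ((TensorProduct.assoc K A A A).symm (a ⊗ₜ z)) =
      (TensorProduct.assoc K A A A).symm (a ⊗ₜ lact M z) :=
  lact_assocMult_mtprod 1 M a z

/-- `m₁₂(S ⊗ ι ⊗ ι)((Δ ⊗ ι)(M)ζ) = (1 ⊗ (ε ⊗ ι)(M)) m₁₂(S ⊗ ι ⊗ ι)(ζ)`. -/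
theorem contract₁₂_comulLeftMult (hS : IsAntipode Δ ε S) (M : Mult K (A ⊗[K] A))
    (ζ : (A ⊗[K] A) ⊗[K] A) : contract₁₂ S (lact (comulLeftMult hΔ hε M) ζ) =
      lact (rightLeg K A A (counitLeftMult hΔ hε M)) (contract₁₂ S ζ) := by
  have base : ∀ w ζ, contract₁₂ S (lact (comulLeft Δ w) ζ) =
      lact (rightLeg K A A (emb K A (counitLeft ε w))) (contract₁₂ S ζ) := by
    intro w ζ
    induction w with
    | zero => simp
    | add x y hx hy => simp only [map_add, lact_add, LinearMap.add_apply, hx, hy]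
    | tmul x y =>
      induction ζ with
      | zero => simp
      | add ζ ζ' h h' => simp only [map_add, h, h']
      | tmul z c => simp [hS.contractLeft_lact_comul hΔ, TensorProduct.smul_tmul]
  have hζ : ζ ∈ Submodule.span K {c | ∃ b d, c =
      lact ((comulLeftHom Δ : A ⊗[K] A →ₗ[K] Mult K ((A ⊗[K] A) ⊗[K] A)) b) d} :=
    (nondegenerateMap_comulLeftHom hΔ hε).left ▸ Submodule.mem_top
  induction hζ using Submodule.span_induction with
  | zero => simp
  | add x y _ _ hx hy => simp only [map_add, hx, hy]
  | smul r x _ hx => simp only [map_smul, hx]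
  | mem x hx =>
    obtain ⟨w, ζ, rfl⟩ := hx
    rw [coe_comulLeftHom, lact_lact, comulLeftMult_mul, base, base, lact_lact, ← map_mul,
      counitLeftMult_mul]

/-- `m₂₃(ι ⊗ S ⊗ ι)((ι ⊗ Δ)(M)ζ) = ((ι ⊗ ε)(M) ⊗ 1) m₂₃(ι ⊗ S ⊗ ι)(ζ)`. -/
theorem contract₂₃_comulRightMult (hS : IsAntipode Δ ε S) (M : Mult K (A ⊗[K] A))
    (ζ : (A ⊗[K] A) ⊗[K] A) : contract₂₃ S (lact (comulRightMult hΔ hε M) ζ) =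
      lact (leftLeg K A A (counitRightMult hΔ hε M)) (contract₂₃ S ζ) := by
  have base : ∀ w ζ, contract₂₃ S (lact (comulRight Δ w) ζ) =
      lact (leftLeg K A A (emb K A (counitRight ε w))) (contract₂₃ S ζ) := by
    intro w ζ
    obtain ⟨ζ, rfl⟩ := (TensorProduct.assoc K A A A).symm.surjective ζ
    induction w with
    | zero => simp
    | add x y hx hy => simp only [map_add, lact_add, LinearMap.add_apply, hx, hy]
    | tmul x y =>
      induction ζ with
      | zero => simp
      | add ζ ζ' h h' => simp only [map_add, h, h']
      | tmul c z =>
        rw [comulRight_tmul, lact_assocMult_mtprod]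
        simp [hS.contractLeft_lact_comul hΔ]
  have hζ : ζ ∈ Submodule.span K {c | ∃ b d, c =
      lact ((comulRightHom Δ : A ⊗[K] A →ₗ[K] Mult K ((A ⊗[K] A) ⊗[K] A)) b) d} :=
    (nondegenerateMap_comulRightHom hΔ hε).left ▸ Submodule.mem_top
  induction hζ using Submodule.span_induction with
  | zero => simp
  | add x y _ _ hx hy => simp only [map_add, hx, hy]
  | smul r x _ hx => simp only [map_smul, hx]
  | mem x hx =>
    obtain ⟨w, ζ, rfl⟩ := hx
    rw [coe_comulRightHom, lact_lact, comulRightMult_mul, base, base, lact_lact, ← map_mul,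
      counitRightMult_mul]

variable {J : (Mult K (A ⊗[K] A))ˣ} {Q : Mult K A}

theorem IsGeneralTwist.comulLeftMult_mul_leftLeg (hJ : IsGeneralTwist Δ ε J) :
    comulLeftMult hΔ hε J * leftLeg K (A ⊗[K] A) A J =
      comulRightMult hΔ hε J * assocMult (rightLeg K A (A ⊗[K] A) J) := hJ.twist

theorem IsGeneralTwist.counitLeftMult_eq_one (hJ : IsGeneralTwist Δ ε J) :
    counitLeftMult hΔ hε J = 1 := hJ.normalized_left

theorem IsGeneralTwist.counitRightMult_eq_one (hJ : IsGeneralTwist Δ ε J) :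
    counitRightMult hΔ hε J = 1 := hJ.normalized_right

theorem IsContraction.contract₁₂_leftLeg (hQ : IsContraction S J Q) (c : A) (z : A ⊗[K] A) :
    contract₁₂ S (lact (leftLeg K (A ⊗[K] A) A J) ((TensorProduct.assoc K A A A).symm (c ⊗ₜ z))) =
      lact (leftLeg K A A (S c * Q)) z := by
  induction z with
  | zero => simp
  | add x y hx hy => simp only [TensorProduct.tmul_add, map_add, hx, hy]
  | tmul x y =>
    rw [TensorProduct.assoc_symm_tmul, lact_leftLeg_tmul, contract₁₂_tmul, hQ, lact_leftLeg_tmul]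

theorem contract₁₂_comulRight (hS : IsAntipode Δ ε S) (hσ : ∀ a, S a = emb K A (σ a))
    (w : A ⊗[K] A) (c : A) (z : A ⊗[K] A) :
    contract₁₂ S (lact (comulRight Δ w) ((TensorProduct.assoc K A A A).symm (c ⊗ₜ z))) =
      lact (leftLeg K A A (S c))
        (lact (emb K (A ⊗[K] A) (hΔ.canon₂ (LinearEquiv.rTensor A σ w))) z) := by
  induction w with
  | zero => simp
  | add x y hx hy => simp only [map_add, lact_add, LinearMap.add_apply, hx, hy]
  | tmul x y =>
    rw [comulRight_tmul, lact_assocMult_mtprod, contract₁₂_assoc_symm_tmul, lact_emb K A,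
      hS.map_mul, LinearEquiv.rTensor_tmul, hΔ.emb_canon₂_tmul, ← hσ, map_mul]
    rfl

theorem Mult.ext_leftLeg_mul (hA : Nondegenerate A) {X Y : Mult K (A ⊗[K] A)}
    (h : ∀ a, leftLeg K A A (emb K A a) * X = leftLeg K A A (emb K A a) * Y) : X = Y :=
  Mult.ext_lact (hA.tensor hA) fun z => lact_leftLeg_cancel hA fun a =>
    LinearMap.congr_fun (congrArg lact (h a)) z

/-- The contraction of the first two legs of the twist equation:
`(S(J⁽¹⁾c) ⊗ 1)Δ(J⁽²⁾d) = (S(c)Q ⊗ 1)J⁻¹Δ(d)`. -/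
theorem IsGeneralTwist.emb_canon₂ (hS : IsAntipode Δ ε S) (hσ : ∀ a, S a = emb K A (σ a))
    (hε : IsCounit Δ ε) (hJ : IsGeneralTwist Δ ε J) (hQ : IsContraction S J Q) (c d : A) :
    emb K (A ⊗[K] A) (hΔ.canon₂ (LinearEquiv.rTensor A σ (lact (J : Mult K (A ⊗[K] A)) (c ⊗ₜ d)))) =
      leftLeg K A A (S c * Q) * (↑J⁻¹ * Δ d) := by
  refine Mult.ext_lact hΔ.nondegenerate₂ fun z => ?_
  refine lact_leftLeg_cancel hΔ.nondegenerate fun b => ?_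
  obtain ⟨b, rfl⟩ := σ.surjective b
  set η := lact ((↑J⁻¹ : Mult K (A ⊗[K] A)) * Δ d) z with hη
  have hJη : lact (J : Mult K (A ⊗[K] A)) η = lact (Δ d) z := by
    rw [hη, lact_lact, ← mul_assoc, Units.mul_inv, one_mul]
  have h := congrArg (fun X => contract₁₂ S (lact X
    ((TensorProduct.assoc K A A A).symm ((c * b) ⊗ₜ η)))) (hJ.comulLeftMult_mul_leftLeg hΔ hε)
  simp only [← lact_lact] at h
  rw [contract₁₂_comulLeftMult hΔ hε hS, hJ.counitLeftMult_eq_one, map_one, lact_one,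
    LinearMap.id_apply, hQ.contract₁₂_leftLeg, lact_assocMult_rightLeg, hJη] at h
  have h2 : (TensorProduct.assoc K A A A).symm ((c * b) ⊗ₜ lact (Δ d) z) =
      lact (comulRight Δ (c ⊗ₜ d)) ((TensorProduct.assoc K A A A).symm (b ⊗ₜ z)) := by
    rw [comulRight_tmul, lact_assocMult_mtprod, lact_emb]
  rw [h2, lact_lact (comulRightMult hΔ hε _), comulRightMult_mul,
    contract₁₂_comulRight hΔ hS hσ, hS.map_mul, mul_assoc, map_mul, ← lact_lact, hσ b] at h
  rw [← h, hη, lact_lact (leftLeg K A A (S c * Q))]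

/-- The contraction of the last two legs of the twist equation:
`T₁⁻¹(Δ(a)J(1 ⊗ b)) = (ι ⊗ S)((a ⊗ S⁻¹(Qb))J⁻¹)`. -/
theorem IsGeneralTwist.ract_canon₁_symm (hS : IsAntipode Δ ε S) (hσ : ∀ a, S a = emb K A (σ a))
    (hε : IsCounit Δ ε) (hJ : IsGeneralTwist Δ ε J) (hQ : IsContraction S J Q) (a b : A)
    (x : A ⊗[K] A) (hx : emb K (A ⊗[K] A) x = Δ a * J * rightLeg K A A (emb K A b)) :
    ract (J : Mult K (A ⊗[K] A)) (LinearEquiv.lTensor A σ.symm (hΔ.canon₁.symm x)) =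
      a ⊗ₜ σ.symm (lact Q b) := by
  have hσm := antipode_equiv_mul hΔ.nondegenerate hS hσ
  have gen : ∀ (a b : A) (m : Mult K (A ⊗[K] A)) (x z : A ⊗[K] A) (r : A),
      emb K (A ⊗[K] A) x = Δ a * m * rightLeg K A A (emb K A b) →
      contract₂₃ S (lact (comulLeft Δ x) (z ⊗ₜ r)) = lact (leftLeg K A A (emb K A a))
        (contract₂₃ S (lact (comulLeftMult hΔ hε m) (z ⊗ₜ (b * r)))) := by
    intro a b m x z r hx
    rw [← comulLeftMult_emb hΔ hε, hx, map_mul, map_mul, comulLeftMult_rightLeg,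
      comulLeftMult_comul, mul_assoc, ← lact_lact, contract₂₃_comulRightMult hΔ hε hS,
      counitRightMult_comul]
    rfl
  -- the left-hand side, for elements in the range of `T₁`
  have h1 : ∀ w z r, contract₂₃ S (lact (comulLeft Δ (hΔ.canon₁ w)) (z ⊗ₜ r)) =
      ract (rightLeg K A A (emb K A r))
        (LinearEquiv.lTensor A σ (LinearEquiv.lTensor A σ.symm w * z)) := by
    intro w z r
    induction w with
    | zero => simp
    | add x y hx hy => simp only [map_add, lact_add, LinearMap.add_apply, add_mul, hx, hy]
    | tmul p q =>
      rw [gen p q 1 _ z r (by rw [mul_one, hΔ.emb_canon₁_tmul]), map_one, lact_one,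
        LinearMap.id_apply]
      induction z with
      | zero => simp
      | add x y hx hy => simp only [TensorProduct.add_tmul, map_add, mul_add, hx, hy]
      | tmul c t => simp [hσ, hσm, mul_assoc]
  have h2 : ∀ c t, LinearEquiv.lTensor A σ.symm (hΔ.canon₁.symm x) *
      lact (J : Mult K (A ⊗[K] A)) (c ⊗ₜ t) = (a ⊗ₜ σ.symm (lact Q b)) * (c ⊗ₜ t) := by
    intro c t
    apply (LinearEquiv.lTensor A σ).injective
    refine ract_rightLeg_cancel hΔ.nondegenerate fun r => ?_
    rw [← h1, LinearEquiv.apply_symm_apply, gen a b J x _ r hx]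
    have h3 := congrArg (fun X => contract₂₃ S (lact X ((c ⊗ₜ t) ⊗ₜ (b * r))))
      (hJ.comulLeftMult_mul_leftLeg hΔ hε)
    simp only [← lact_lact] at h3
    rw [lact_leftLeg_tmul, contract₂₃_comulRightMult hΔ hε hS, hJ.counitRightMult_eq_one, map_one,
      lact_one, LinearMap.id_apply, ← TensorProduct.assoc_symm_tmul,
      lact_assocMult_rightLeg, contract₂₃_assoc_symm_tmul, hQ] at h3
    rw [h3]
    simp [hσ, hσm, mul_assoc, lact_mul_right]
  rw [← sub_eq_zero]
  refine hΔ.nondegenerate₂.left _ fun y => ?_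
  rw [sub_mul, sub_eq_zero, ract_mul]
  induction y with
  | zero => simp
  | add x y hx hy => simp only [map_add, mul_add, hx, hy]
  | tmul c t => exact h2 c t

end Twist

section Surjectivity

variable {K : Type u} [Field K]
  {A : Type v} [NonUnitalRing A] [Module K A] [IsScalarTower K A A] [SMulCommClass K A A]
  {Δ : A →ₙₐ[K] Mult K (A ⊗[K] A)} {ε : A →ₙₐ[K] K} {S : A →ₗ[K] Mult K A} {σ : A ≃ₗ[K] A}
  {J : (Mult K (A ⊗[K] A))ˣ} {Q : Mult K A}

/-! ### Surjectivity of the left action of `Q` -/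

/-- The map `p ↦ (1 ⊗ x)Δ(p)`, which takes values in `A ⊗ A` in the regular case. -/
def rightMulComul (hΔ' : IsMultiplierHopf (coop Δ)) (x : A) : A →ₗ[K] A ⊗[K] A :=
  (TensorProduct.comm K A A).toLinearMap ∘ₗ hΔ'.canon₂.toLinearMap ∘ₗ TensorProduct.mk K A A x

theorem emb_rightMulComul (hΔ' : IsMultiplierHopf (coop Δ)) (x p : A) :
    emb K (A ⊗[K] A) (rightMulComul hΔ' x p) = rightLeg K A A (emb K A x) * Δ p := by
  change emb K (A ⊗[K] A) (TensorProduct.comm K A A (hΔ'.canon₂ (x ⊗ₜ p))) = _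
  rw [← flipMult_emb, hΔ'.emb_canon₂_tmul, map_mul, flipMult_leftLeg, coop_apply, flipMult_flipMult]

theorem contractRight_rightMulComul (hΔ : IsMultiplierHopf Δ) (hΔ' : IsMultiplierHopf (coop Δ))
    (hS : IsAntipode Δ ε S) (hσ : ∀ a, S a = emb K A (σ a)) (x p : A) :
    contractRight S (rightMulComul hΔ' x p) = ε p • σ x := by
  rw [← sub_eq_zero]
  refine hΔ.nondegenerate.right _ fun y => ?_
  have h : lact (leftLeg K A A (emb K A y)) (rightMulComul hΔ' x p) = ract (Δ p) (y ⊗ₜ x) := by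
    apply emb_injective (K := K) hΔ.nondegenerate₂
    rw [← mul_emb, emb_rightMulComul, ← mul_assoc, leftLeg_mul_rightLeg, mtprod_emb, emb_mul]
  rw [mul_sub, sub_eq_zero, ← contractRight_lact_leftLeg, h, hS.contractRight_ract_comul hΔ,
    contractRight_tmul, hσ, ract_emb, mul_smul_comm]

theorem emb_rTensor_rightMulComul (hΔ' : IsMultiplierHopf (coop Δ)) (x : A) (y : A ⊗[K] A) :
    emb K ((A ⊗[K] A) ⊗[K] A) (LinearMap.rTensor A (rightMulComul hΔ' x) y) =
      leftLeg K (A ⊗[K] A) A (rightLeg K A A (emb K A x)) * comulLeft Δ y := by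
  induction y with
  | zero => simp
  | add x y hx hy => simp only [map_add, mul_add, hx, hy]
  | tmul p q =>
    rw [LinearMap.rTensor_tmul, ← mtprod_emb, emb_rightMulComul, comulLeft_tmul]
    change _ = mtprod (_ ⊗ₜ 1) * _
    rw [mtprod_mul, one_mul]

theorem contractRight_lact_leftLeg_mult (hσ : ∀ a, S a = emb K A (σ a)) (m : Mult K A)
    (z : A ⊗[K] A) :
    contractRight S (lact (leftLeg K A A m) z) = lact m (contractRight S z) := by
  induction z with
  | zero => simp
  | add x y hx hy => simp only [map_add, hx, hy]
  | tmul x y => simp [hσ, lact_mul_right]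

/-- The map `M(A) ⊗ A → M(A ⊗ A)`, `m ⊗ d ↦ (σ(m) ⊗ 1)Δ(d)`. -/
def antiMultComul (Δ : A →ₙₐ[K] Mult K (A ⊗[K] A)) (σ : A ≃ₗ[K] A)
    (hσ : ∀ a b, σ (a * b) = σ b * σ a) : Mult K A ⊗[K] A →ₗ[K] Mult K (A ⊗[K] A) :=
  TensorProduct.lift ((LinearMap.mul K (Mult K (A ⊗[K] A))).compl₁₂
    ((leftLeg K A A).toLinearMap ∘ₗ antiMult σ hσ) (Δ : A →ₗ[K] Mult K (A ⊗[K] A)))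

@[simp] theorem antiMultComul_tmul (hσ : ∀ a b, σ (a * b) = σ b * σ a) (m : Mult K A) (d : A) :
    antiMultComul Δ σ hσ (m ⊗ₜ d) = leftLeg K A A (antiMult σ hσ m) * Δ d := rfl

/-- The elements `(σ(m) ⊗ x ⊗ 1)(Δ ⊗ ι)(Δ(d)(1 ⊗ c))` of `A ⊗ A ⊗ A`, as a linear map in
`m ⊗ d`. -/
def antiMultComul₃ (hΔ : IsMultiplierHopf Δ) (hΔ' : IsMultiplierHopf (coop Δ))
    (hσ : ∀ a b, σ (a * b) = σ b * σ a) (x c : A) : Mult K A ⊗[K] A →ₗ[K] (A ⊗[K] A) ⊗[K] A :=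
  TensorProduct.lift ((lactLin K ((A ⊗[K] A) ⊗[K] A)).compl₁₂
    ((leftLeg K (A ⊗[K] A) A).toLinearMap ∘ₗ (leftLeg K A A).toLinearMap ∘ₗ antiMult σ hσ)
    (LinearMap.rTensor A (rightMulComul hΔ' x) ∘ₗ hΔ.canon₁.toLinearMap ∘ₗ
      (TensorProduct.mk K A A).flip c))

theorem antiMultComul₃_tmul (hΔ : IsMultiplierHopf Δ) (hΔ' : IsMultiplierHopf (coop Δ))
    (hσ : ∀ a b, σ (a * b) = σ b * σ a) (x c : A) (m : Mult K A) (d : A) :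
    antiMultComul₃ hΔ hΔ' hσ x c (m ⊗ₜ d) =
      lact (leftLeg K (A ⊗[K] A) A (leftLeg K A A (antiMult σ hσ m)))
        (LinearMap.rTensor A (rightMulComul hΔ' x) (hΔ.canon₁ (d ⊗ₜ c))) := rfl

theorem emb_antiMultComul₃ (hΔ : IsMultiplierHopf Δ) (hΔ' : IsMultiplierHopf (coop Δ))
    (hε : IsCounit Δ ε) (hσ : ∀ a b, σ (a * b) = σ b * σ a) (x c : A) (t : Mult K A ⊗[K] A) :
    emb K ((A ⊗[K] A) ⊗[K] A) (antiMultComul₃ hΔ hΔ' hσ x c t) =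
      leftLeg K (A ⊗[K] A) A (rightLeg K A A (emb K A x)) *
        comulRightMult hΔ hε (antiMultComul Δ σ hσ t) * rightLeg K (A ⊗[K] A) A (emb K A c) := by
  induction t with
  | zero => simp
  | add x y hx hy => simp only [map_add, mul_add, add_mul, hx, hy]
  | tmul m d =>
    rw [antiMultComul₃_tmul, ← mul_emb, emb_rTensor_rightMulComul, ← comulLeftMult_emb hΔ hε,
      hΔ.emb_canon₁_tmul, map_mul, comulLeftMult_rightLeg, comulLeftMult_comul, antiMultComul_tmul,
      map_mul, comulRightMult_leftLeg]
    simp only [← mul_assoc, ← map_mul]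
    rw [leftLeg_mul_rightLeg, rightLeg_mul_leftLeg]

theorem IsGeneralTwist.antiMultComul_eq (hΔ : IsMultiplierHopf Δ) (hS : IsAntipode Δ ε S)
    (hσ : ∀ a, S a = emb K A (σ a)) (hσm : ∀ a b, σ (a * b) = σ b * σ a) (hε : IsCounit Δ ε)
    (hJ : IsGeneralTwist Δ ε J) (hQ : IsContraction S J Q) (d : A) (t : Mult K A ⊗[K] A)
    (ht : J * rightLeg K A A (emb K A d) = multTensorMap K A t) :
    antiMultComul Δ σ hσm t = leftLeg K A A Q * (↑J⁻¹ * Δ d) := by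
  refine Mult.ext_leftLeg_mul hΔ.nondegenerate fun c => ?_
  obtain ⟨c, rfl⟩ := σ.surjective c
  have h : ∀ t : Mult K A ⊗[K] A, leftLeg K A A (emb K A (σ c)) * antiMultComul Δ σ hσm t =
      emb K (A ⊗[K] A) (hΔ.canon₂ (LinearEquiv.rTensor A σ (multTensorLact c t))) := by
    intro t
    induction t with
    | zero => simp
    | add x y hx hy => simp only [map_add, mul_add, hx, hy]
    | tmul m b =>
      rw [antiMultComul_tmul, ← mul_assoc, ← map_mul, ← hσ, mul_antiMult hσ hσm,
        multTensorLact_tmul, LinearEquiv.rTensor_tmul, hΔ.emb_canon₂_tmul, hσ]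
  rw [h, ← lact_tmul_eq_multTensorLact hΔ.nondegenerate ht, hJ.emb_canon₂ hΔ hS hσ hε hQ, hσ,
    map_mul, mul_assoc]

theorem mem_span_of_functional_mul_eq_zero (hA : Nondegenerate A) (f : A →ₗ[K] K)
    (τ : A ⊗[K] (A ⊗[K] A)) (h : ∀ e v, TensorProduct.lid K (A ⊗[K] A)
      (LinearMap.rTensor (A ⊗[K] A) f (τ * (e ⊗ₜ v))) = 0) :
    τ ∈ Submodule.span K {t : A ⊗[K] (A ⊗[K] A) | ∃ a v, (∀ e, f (a * e) = 0) ∧ t = a ⊗ₜ v} := by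
  refine mem_span_of_forall_map_left_eq_zero (fun e => f ∘ₗ LinearMap.mulRight K e) τ fun e => ?_
  apply (TensorProduct.lid K (A ⊗[K] A)).injective
  rw [map_zero]
  refine (hA.tensor hA).left _ fun v => ?_
  rw [← h e v]
  clear h
  induction τ with
  | zero => simp
  | add x y hx hy => simp only [map_add, add_mul, hx, hy]
  | tmul a u => simp [smul_mul_assoc]

/-- The slice map `A ⊗ A → A`, `p ⊗ q ↦ f(σ(p))q`. -/
def antiSlice (σ : A ≃ₗ[K] A) (f : A →ₗ[K] K) : A ⊗[K] A →ₗ[K] A :=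
  (TensorProduct.lid K A).toLinearMap ∘ₗ LinearMap.rTensor A (f ∘ₗ σ.toLinearMap)

@[simp] theorem antiSlice_tmul (f : A →ₗ[K] K) (p q : A) :
    antiSlice σ f (p ⊗ₜ q) = f (σ p) • q := rfl

theorem antiSlice_lact_rightLeg (f : A →ₗ[K] K) (q : A) (z : A ⊗[K] A) :
    antiSlice σ f (lact (rightLeg K A A (emb K A q)) z) = q * antiSlice σ f z := by
  induction z with
  | zero => simp
  | add x y hx hy => simp only [map_add, mul_add, hx, hy]
  | tmul a u => simp [mul_smul_comm]

theorem lid_rTensor_contractRight_antiMultComul₃ (hΔ : IsMultiplierHopf Δ)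
    (hΔ' : IsMultiplierHopf (coop Δ)) (hS : IsAntipode Δ ε S) (hσ : ∀ a, S a = emb K A (σ a))
    (hσm : ∀ a b, σ (a * b) = σ b * σ a) (hε : IsCounit Δ ε) (f : A →ₗ[K] K) (x c : A)
    (t : Mult K A ⊗[K] A) :
    TensorProduct.lid K A (LinearMap.rTensor A (f ∘ₗ contractRight S)
      (antiMultComul₃ hΔ hΔ' hσm x c t)) = antiSlice σ f (multTensorRact x t) * c := by
  induction t with
  | zero => simp
  | add x y hx hy => simp only [map_add, add_mul, hx, hy]
  | tmul m d =>
    have h : ∀ y, TensorProduct.lid K A (LinearMap.rTensor A (f ∘ₗ contractRight S)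
        (lact (leftLeg K (A ⊗[K] A) A (leftLeg K A A (antiMult σ hσm m)))
          (LinearMap.rTensor A (rightMulComul hΔ' x) y))) = f (σ (ract m x)) • counitLeft ε y := by
      intro y
      induction y with
      | zero => simp
      | add x y hx hy => simp only [map_add, smul_add, hx, hy]
      | tmul p q =>
        rw [LinearMap.rTensor_tmul, lact_leftLeg_tmul, LinearMap.rTensor_tmul,
          LinearMap.comp_apply, contractRight_lact_leftLeg_mult hσ,
          contractRight_rightMulComul hΔ hΔ' hS hσ, map_smul, lact_antiMult, map_smul,
          TensorProduct.lid_tmul, counitLeft_tmul, smul_eq_mul, mul_comm, mul_smul]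
    rw [antiMultComul₃_tmul, h, counitLeft_canon₁ hΔ hε, LinearMap.mul'_apply,
      multTensorRact_tmul, antiSlice_tmul, smul_mul_assoc]

/-- The right ideal `QA` is all of `A`. Since `J⁻¹` is not assumed to be general, this
does not follow by exhibiting an inverse of `Q`: instead a functional `f` that vanishes on `QA` is
shown to satisfy `(f ∘ S ⊗ ι)((x ⊗ 1)J(1 ⊗ d)) = 0`, so that `f ∘ S = 0`. -/
theorem IsGeneralTwist.surjective_lact (hΔr : IsRegularMultiplierHopf Δ) (hS : IsAntipode Δ ε S)
    (hσ : ∀ a, S a = emb K A (σ a)) (hε : IsCounit Δ ε)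
    (hJ : IsGeneralTwist Δ ε J) (hQ : IsContraction S J Q) : Function.Surjective (lact Q) := by
  have hΔ := hΔr.isMultiplierHopf
  have hΔ' := hΔr.coop_isMultiplierHopf
  have hA := hΔ.nondegenerate
  have hσm := antipode_equiv_mul hA hS hσ
  by_contra hne
  rw [← LinearMap.range_eq_top, ← ne_eq, ← lt_top_iff_ne_top] at hne
  obtain ⟨f, hf0, hf⟩ := Submodule.exists_le_ker_of_lt_top _ hne
  have hfQ : ∀ a, f (lact Q a) = 0 := fun a => hf ⟨a, rfl⟩
  -- the slices `(f ∘ S ⊗ ι)((x ⊗ 1)J(1 ⊗ d))` vanish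
  have key : ∀ x d z, emb K (A ⊗[K] A) z =
      leftLeg K A A (emb K A x) * (J * rightLeg K A A (emb K A d)) → antiSlice σ f z = 0 := by
    intro x d z hz
    obtain ⟨t, ht⟩ := hJ.mul_right_mem d
    have ht' : J * rightLeg K A A (emb K A d) = multTensorMap K A t := ht.symm
    have hzt : z = multTensorRact x t := by
      apply emb_injective (K := K) hΔ.nondegenerate₂
      rw [hz, ht', leftLeg_mul_multTensorMap]
    refine hA.left _ fun c => ?_
    rw [hzt, ← lid_rTensor_contractRight_antiMultComul₃ hΔ hΔ' hS hσ hσm hε]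
    set D := antiMultComul₃ hΔ hΔ' hσm x c t with hD
    -- `D` starts with `Q ⊗ 1 ⊗ 1`, so that its slices along `f` vanish
    have hDQ : emb K ((A ⊗[K] A) ⊗[K] A) D =
        leftLeg K (A ⊗[K] A) A (leftLeg K A A Q) *
          (leftLeg K (A ⊗[K] A) A (rightLeg K A A (emb K A x)) *
            comulRightMult hΔ hε (↑J⁻¹ * Δ d) * rightLeg K (A ⊗[K] A) A (emb K A c)) := by
      rw [hD, emb_antiMultComul₃ hΔ hΔ' hε, hJ.antiMultComul_eq hΔ hS hσ hσm hε hQ d t ht',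
        map_mul, comulRightMult_leftLeg]
      simp only [← mul_assoc, ← map_mul (leftLeg K (A ⊗[K] A) A)]
      rw [leftLeg_mul_rightLeg, rightLeg_mul_leftLeg]
    have hslice : ∀ ζ, TensorProduct.lid K (A ⊗[K] A) (LinearMap.rTensor (A ⊗[K] A) f
        (TensorProduct.assoc K A A A
          (lact (leftLeg K (A ⊗[K] A) A (leftLeg K A A Q)) ζ))) = 0 := by
      intro ζ
      obtain ⟨ζ, rfl⟩ := (TensorProduct.assoc K A A A).symm.surjective ζ
      rw [← assocMult_leftLeg]
      induction ζ with
      | zero => simp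
      | add x y hx hy => simp only [map_add, hx, hy, add_zero]
      | tmul a z =>
        rw [leftLeg_apply, lact_assocMult_mtprod, LinearEquiv.apply_symm_apply,
          LinearMap.rTensor_tmul, hfQ, TensorProduct.zero_tmul, map_zero]
    have hspan := mem_span_of_functional_mul_eq_zero hA f (TensorProduct.assoc K A A A D)
      fun e v => by
        have h1 : TensorProduct.assoc K A A A D * (e ⊗ₜ v) = TensorProduct.assoc K A A A
            (D * (TensorProduct.assoc K A A A).symm (e ⊗ₜ v)) := by
          apply (TensorProduct.assoc K A A A).symm.injective
          rw [assoc_symm_mul, LinearEquiv.symm_apply_apply, LinearEquiv.symm_apply_apply]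
        have h2 := lact_emb K _ D ((TensorProduct.assoc K A A A).symm (e ⊗ₜ v))
        rw [h1, ← h2, hDQ, ← lact_lact, hslice]
    have hD' : D = (TensorProduct.assoc K A A A).symm (TensorProduct.assoc K A A A D) := by simp
    rw [hD']
    generalize TensorProduct.assoc K A A A D = τ at hspan
    induction hspan using Submodule.span_induction with
    | zero => simp
    | add x y _ _ hx hy => simp only [map_add, hx, hy, add_zero]
    | smul r x _ hx => simp only [map_smul, hx, smul_zero]
    | mem τ hτ =>
      obtain ⟨a, v, ha, rfl⟩ := hτ
      induction v with
      | zero => simp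
      | add x y hx hy => simp only [TensorProduct.tmul_add, map_add, hx, hy, add_zero]
      | tmul g h => simp [hσ, ha]
  have hfσ : ∀ p q d : A, f (σ p) • (q * d) = 0 := by
    intro p q d
    have h : ∀ z, antiSlice σ f (ract (rightLeg K A A (emb K A d))
        (ract (J : Mult K (A ⊗[K] A)) z)) = 0 := by
      intro z
      induction z with
      | zero => simp
      | add x y hx hy => simp only [map_add, hx, hy, add_zero]
      | tmul x q =>
        obtain ⟨t, ht⟩ := hJ.mul_right_mem d
        have hz := key x d (multTensorRact x t) (by
          rw [← leftLeg_mul_multTensorMap]; exact congrArg _ ht)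
        have hz' : ract (rightLeg K A A (emb K A d)) (ract (J : Mult K (A ⊗[K] A)) (x ⊗ₜ q)) =
            lact (rightLeg K A A (emb K A q)) (multTensorRact x t) := by
          apply emb_injective (K := K) hΔ.nondegenerate₂
          rw [← mul_emb, ← leftLeg_mul_multTensorMap, ract_ract, ← emb_mul, ← mtprod_emb,
            ← rightLeg_mul_leftLeg, mul_assoc]
          exact congrArg (fun X => _ * (_ * X)) ht.symm
        rw [hz', antiSlice_lact_rightLeg, hz, mul_zero]
    have h' := h (ract (↑J⁻¹ : Mult K (A ⊗[K] A)) (p ⊗ₜ q))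
    rwa [ract_ract (J : Mult K (A ⊗[K] A)), Units.inv_mul, ract_one, LinearMap.id_apply,
      ract_rightLeg_tmul, ract_emb, antiSlice_tmul] at h'
  apply hf0
  ext a
  obtain ⟨p, rfl⟩ := σ.surjective a
  by_contra hp
  -- otherwise the product of `A` would be zero
  have hz : ∀ a : A, a = 0 := fun a => hA.left a fun b =>
    (smul_eq_zero.1 (hfσ p a b)).resolve_left hp
  exact hp (by rw [hz (σ p), map_zero, map_zero])

end Surjectivity

section CoopTwist

variable {K : Type u} [Field K]
  {A : Type v} [NonUnitalRing A] [Module K A] [IsScalarTower K A A] [SMulCommClass K A A]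
  {Δ : A →ₙₐ[K] Mult K (A ⊗[K] A)} {ε : A →ₙₐ[K] K} {S : A →ₗ[K] Mult K A} {σ : A ≃ₗ[K] A}
  {J : (Mult K (A ⊗[K] A))ˣ} {Q : Mult K A}

/-! ### The co-opposite twist -/

variable (K A) in
/-- The reversal `(a ⊗ b) ⊗ c ↦ (c ⊗ b) ⊗ a`. -/
def reverse : (A ⊗[K] A) ⊗[K] A ≃ₗ[K] (A ⊗[K] A) ⊗[K] A :=
  (TensorProduct.comm K (A ⊗[K] A) A).trans
    ((LinearEquiv.lTensor A (TensorProduct.comm K A A)).trans (TensorProduct.assoc K A A A).symm)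

theorem reverse_tmul (z : A ⊗[K] A) (c : A) : reverse K A (z ⊗ₜ c) =
    (TensorProduct.assoc K A A A).symm (c ⊗ₜ TensorProduct.comm K A A z) := rfl

theorem reverse_assoc_symm_tmul (a : A) (z : A ⊗[K] A) :
    reverse K A ((TensorProduct.assoc K A A A).symm (a ⊗ₜ z)) =
      TensorProduct.comm K A A z ⊗ₜ a := by
  induction z with
  | zero => simp
  | add x y hx hy => simp only [TensorProduct.tmul_add, map_add, TensorProduct.add_tmul, hx, hy]
  | tmul x y => simp [reverse]

theorem reverse_mul (x y : (A ⊗[K] A) ⊗[K] A) :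
    reverse K A (x * y) = reverse K A x * reverse K A y := by
  induction x with
  | zero => simp
  | add x x' hx hx' => simp only [add_mul, map_add, hx, hx']
  | tmul z c =>
    induction y with
    | zero => simp
    | add y y' hy hy' => simp only [mul_add, map_add, hy, hy']
    | tmul z' c' =>
      rw [Algebra.TensorProduct.tmul_mul_tmul, reverse_tmul, reverse_tmul, reverse_tmul,
        ← assoc_symm_mul, Algebra.TensorProduct.tmul_mul_tmul, comm_mul]

/-- The reversal, extended to `M(A ⊗ A ⊗ A)`. -/
def reverseMult : Mult K ((A ⊗[K] A) ⊗[K] A) →ₐ[K] Mult K ((A ⊗[K] A) ⊗[K] A) :=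
  Mult.transport (reverse K A) reverse_mul

theorem lact_reverseMult (m : Mult K ((A ⊗[K] A) ⊗[K] A)) (z : (A ⊗[K] A) ⊗[K] A) :
    lact (reverseMult m) (reverse K A z) = reverse K A (lact m z) := by
  simp [reverseMult, Mult.transport]

theorem reverseMult_mtprod (hA : Nondegenerate A) (X : Mult K (A ⊗[K] A)) (m : Mult K A) :
    reverseMult (mtprod (X ⊗ₜ m)) = assocMult (mtprod (m ⊗ₜ flipMult X)) := by
  refine Mult.ext_lact ((hA.tensor hA).tensor hA) fun ζ => ?_
  obtain ⟨ζ, rfl⟩ := (reverse K A).surjective ζ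
  rw [lact_reverseMult]
  induction ζ with
  | zero => simp
  | add x y hx hy => simp only [map_add, hx, hy]
  | tmul z c =>
    rw [lact_mtprod, TensorProduct.map_tmul, reverse_tmul, reverse_tmul, lact_assocMult_mtprod,
      lact_flipMult]

theorem reverseMult_assocMult_mtprod (hA : Nondegenerate A) (m : Mult K A)
    (X : Mult K (A ⊗[K] A)) :
    reverseMult (assocMult (mtprod (m ⊗ₜ X))) = mtprod (flipMult X ⊗ₜ m) := by
  refine Mult.ext_lact ((hA.tensor hA).tensor hA) fun ζ => ?_
  obtain ⟨ζ, rfl⟩ := (reverse K A).surjective ζ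
  obtain ⟨ζ, rfl⟩ := (TensorProduct.assoc K A A A).symm.surjective ζ
  rw [lact_reverseMult]
  induction ζ with
  | zero => simp
  | add x y hx hy => simp only [map_add, hx, hy]
  | tmul a z =>
    rw [lact_assocMult_mtprod, reverse_assoc_symm_tmul, reverse_assoc_symm_tmul, lact_mtprod,
      TensorProduct.map_tmul, lact_flipMult]

theorem comulLeft_coop (hA : Nondegenerate A) (w : A ⊗[K] A) :
    comulLeft (coop Δ) (TensorProduct.comm K A A w) = reverseMult (comulRight Δ w) := by
  induction w with
  | zero => simp
  | add x y hx hy => simp only [map_add, hx, hy]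
  | tmul a b => rw [comulRight_tmul, reverseMult_assocMult_mtprod hA]; rfl

theorem comulRight_coop (hA : Nondegenerate A) (w : A ⊗[K] A) :
    comulRight (coop Δ) (TensorProduct.comm K A A w) = reverseMult (comulLeft Δ w) := by
  induction w with
  | zero => simp
  | add x y hx hy => simp only [map_add, hx, hy]
  | tmul a b => rw [comulLeft_tmul, reverseMult_mtprod hA]; rfl

section

variable (hΔ : IsMultiplierHopf Δ) (hΔ' : IsMultiplierHopf (coop Δ)) (hε : IsCounit Δ ε)
  (hε' : IsCounit (coop Δ) ε)

theorem comulLeftMult_coop (m : Mult K (A ⊗[K] A)) :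
    comulLeftMult hΔ' hε' (flipMult m) = reverseMult (comulRightMult hΔ hε m) := by
  refine NondegenerateMap.ext_mul hΔ.nondegenerate₃ (nondegenerateMap_comulLeftHom hΔ' hε')
    fun z => ?_
  obtain ⟨z, rfl⟩ := (TensorProduct.comm K A A).surjective z
  change _ * comulLeft (coop Δ) _ = _ * comulLeft (coop Δ) _
  rw [comulLeftMult_mul, lact_flipMult, comulLeft_coop hΔ.nondegenerate,
    comulLeft_coop hΔ.nondegenerate, ← map_mul, comulRightMult_mul]

theorem comulRightMult_coop (m : Mult K (A ⊗[K] A)) :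
    comulRightMult hΔ' hε' (flipMult m) = reverseMult (comulLeftMult hΔ hε m) := by
  refine NondegenerateMap.ext_mul hΔ.nondegenerate₃ (nondegenerateMap_comulRightHom hΔ' hε')
    fun z => ?_
  obtain ⟨z, rfl⟩ := (TensorProduct.comm K A A).surjective z
  change _ * comulRight (coop Δ) _ = _ * comulRight (coop Δ) _
  rw [comulRightMult_mul, lact_flipMult, comulRight_coop hΔ.nondegenerate,
    comulRight_coop hΔ.nondegenerate, ← map_mul, comulLeftMult_mul]

theorem counitLeftMult_coop (m : Mult K (A ⊗[K] A)) :
    counitLeftMult hΔ' hε' (flipMult m) = counitRightMult hΔ hε m := by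
  refine NondegenerateMap.ext_mul hΔ.nondegenerate (nondegenerateMap_counitLeftHom hΔ' hε')
    fun z => ?_
  obtain ⟨z, rfl⟩ := (TensorProduct.comm K A A).surjective z
  change _ * emb K A (counitLeft ε _) = _ * emb K A (counitLeft ε _)
  rw [counitLeftMult_mul, lact_flipMult, counitLeft_comm, counitLeft_comm, counitRightMult_mul]

theorem counitRightMult_coop (m : Mult K (A ⊗[K] A)) :
    counitRightMult hΔ' hε' (flipMult m) = counitLeftMult hΔ hε m := by
  refine NondegenerateMap.ext_mul hΔ.nondegenerate (nondegenerateMap_counitRightHom hΔ' hε')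
    fun z => ?_
  obtain ⟨z, rfl⟩ := (TensorProduct.comm K A A).surjective z
  change _ * emb K A (counitRight ε _) = _ * emb K A (counitRight ε _)
  rw [counitRightMult_mul, lact_flipMult, counitRight_comm, counitRight_comm, counitLeftMult_mul]

end

theorem flipMult_mem_multTensor {m : Mult K (A ⊗[K] A)} (h : m ∈ tensorMult K A) :
    flipMult m ∈ multTensor K A := by
  obtain ⟨t, rfl⟩ := h
  induction t with
  | zero => simp
  | add x y hx hy => simp only [map_add]; exact add_mem hx hy
  | tmul b n => exact ⟨n ⊗ₜ b, (flipMult_mtprod (emb K A b) n).symm⟩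

theorem flipMult_mem_tensorMult {m : Mult K (A ⊗[K] A)} (h : m ∈ multTensor K A) :
    flipMult m ∈ tensorMult K A := by
  obtain ⟨t, rfl⟩ := h
  induction t with
  | zero => simp
  | add x y hx hy => simp only [map_add]; exact add_mem hx hy
  | tmul n b => exact ⟨b ⊗ₜ n, (flipMult_mtprod n (emb K A b)).symm⟩

/-- The flip of an invertible multiplier. -/
def flipUnit (J : (Mult K (A ⊗[K] A))ˣ) : (Mult K (A ⊗[K] A))ˣ :=
  Units.map (flipMult : Mult K (A ⊗[K] A) →ₐ[K] Mult K (A ⊗[K] A)) J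

/-- The flip of a twist for `Δ` is a twist for the co-opposite comultiplication. -/
theorem IsGeneralTwist.coop (hΔ : IsRegularMultiplierHopf Δ) (hε : IsCounit Δ ε)
    (hJ : IsGeneralTwist Δ ε J) : IsGeneralTwist (coop Δ) ε (flipUnit J) where
  twist := by
    have hA := hΔ.isMultiplierHopf.nondegenerate
    have h := congrArg reverseMult (hJ.comulLeftMult_mul_leftLeg hΔ.isMultiplierHopf hε)
    have hε' := hε.coop hΔ.isMultiplierHopf
    rw [map_mul, map_mul, ← comulRightMult_coop hΔ.isMultiplierHopf hΔ.coop_isMultiplierHopf hε hε',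
      ← comulLeftMult_coop hΔ.isMultiplierHopf hΔ.coop_isMultiplierHopf hε hε',
      leftLeg_apply, rightLeg_apply, reverseMult_mtprod hA, reverseMult_assocMult_mtprod hA] at h
    exact h.symm
  normalized_left := (counitLeftMult_coop hΔ.isMultiplierHopf hΔ.coop_isMultiplierHopf hε
    (hε.coop hΔ.isMultiplierHopf) _).trans (hJ.counitRightMult_eq_one hΔ.isMultiplierHopf hε)
  normalized_right := (counitRightMult_coop hΔ.isMultiplierHopf hΔ.coop_isMultiplierHopf hε
    (hε.coop hΔ.isMultiplierHopf) _).trans (hJ.counitLeftMult_eq_one hΔ.isMultiplierHopf hε)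
  mul_right_mem a := by
    have h := flipMult_mem_multTensor (hJ.mul_left_mem a)
    rwa [map_mul, flipMult_mtprod] at h
  right_mul_mem a := by
    have h := flipMult_mem_multTensor (hJ.left_mul_mem a)
    rwa [map_mul, flipMult_mtprod] at h
  mul_left_mem a := by
    have h := flipMult_mem_tensorMult (hJ.mul_right_mem a)
    rwa [map_mul, flipMult_mtprod] at h
  left_mul_mem a := by
    have h := flipMult_mem_tensorMult (hJ.right_mul_mem a)
    rwa [map_mul, flipMult_mtprod] at h

/-! ### Invertibility of `Q` -/

/-- A multiplier is invertible if `mA = A = Am`. -/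
theorem Mult.isUnit_of_surjective (hA : Nondegenerate A) {m : Mult K A}
    (hl : Function.Surjective (lact m)) (hr : Function.Surjective (ract m)) : IsUnit m := by
  have il : Function.Injective (lact m) := by
    rw [injective_iff_map_eq_zero]
    refine fun a ha => hA.right a fun b => ?_
    obtain ⟨b, rfl⟩ := hr b
    rw [ract_mul, ha, mul_zero]
  have ir : Function.Injective (ract m) := by
    rw [injective_iff_map_eq_zero]
    refine fun a ha => hA.left a fun b => ?_
    obtain ⟨b, rfl⟩ := hl b
    rw [← ract_mul, ha, zero_mul]
  let L := LinearEquiv.ofBijective (lact m) ⟨il, hl⟩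
  let R := LinearEquiv.ofBijective (ract m) ⟨ir, hr⟩
  have hL : ∀ a, lact m (L.symm a) = a := L.apply_symm_apply
  have hR : ∀ a, ract m (R.symm a) = a := R.apply_symm_apply
  let n : Mult K A := Mult.mk' L.symm.toLinearMap R.symm.toLinearMap
    (fun a b => il (by
      change lact m (L.symm (a * b)) = lact m (L.symm a * b)
      rw [lact_mul_right, hL, hL]))
    (fun a b => ir (by
      change ract m (R.symm (a * b)) = ract m (a * R.symm b)
      rw [ract_mul_left, hR, hR]))
    (fun a b => by
      change R.symm a * b = a * L.symm b
      conv_lhs => rw [← hL b]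
      rw [← ract_mul, hR])
  refine ⟨⟨m, n, Mult.ext' hL fun a => R.symm_apply_apply a,
    Mult.ext' (fun a => L.symm_apply_apply a) hR⟩, rfl⟩

/-- The multiplier of the co-opposite twist is `S⁻¹(Q)`. -/
theorem IsContraction.ract_eq {S' : A →ₗ[K] Mult K A} (hA : Nondegenerate A)
    (hS : ∀ a, S a = emb K A (σ a)) (hS' : ∀ a, S' a = emb K A (σ.symm a))
    (hσ : ∀ a b, σ (a * b) = σ b * σ a) {J : Mult K (A ⊗[K] A)} {Q Q' : Mult K A}
    (hQ : IsContraction S J Q) (hQ' : IsContraction S' (flipMult J) Q') (a : A) :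
    ract Q (σ a) = σ (lact Q' a) := by
  rw [← sub_eq_zero]
  refine hA.left _ fun c => ?_
  have h1 : ∀ z, σ (contractLeft S' (TensorProduct.comm K A A z)) = contractLeft S z := by
    intro z
    induction z with
    | zero => simp
    | add x y hx hy => simp only [map_add, hx, hy]
    | tmul x y => simp [hS, hS', hσ]
  have h2 := congrArg σ (hQ' c a)
  rw [← TensorProduct.comm_tmul, lact_flipMult, h1, hQ, lact_mul, lact_mul, LinearMap.comp_apply,
    LinearMap.comp_apply, hS, hS', lact_emb, lact_emb, hσ, LinearEquiv.apply_symm_apply] at h2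
  rw [sub_mul, sub_eq_zero, ract_mul, h2]

theorem IsGeneralTwist.isUnit (hΔ : IsRegularMultiplierHopf Δ) (hε : IsCounit Δ ε)
    (hS : IsAntipode Δ ε S) {S' : A →ₗ[K] Mult K A} (hS' : IsAntipode (MulHopf.coop Δ) ε S')
    (hSσ : ∀ a, S a = emb K A (σ a)) (hSσ' : ∀ a, S' a = emb K A (σ.symm a))
    (hJ : IsGeneralTwist Δ ε J) (hQ : IsContraction S J Q) : IsUnit Q := by
  have hA := hΔ.isMultiplierHopf.nondegenerate
  have hε' := hε.coop hΔ.isMultiplierHopf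
  have hJ' := hJ.coop hΔ hε
  have hσ := antipode_equiv_mul hA hS hSσ
  obtain ⟨Q', hQ'⟩ := exists_isContraction hA hSσ' (antipode_equiv_mul hA hS' hSσ')
    hJ'.mul_right_mem hJ'.mul_left_mem
  refine Mult.isUnit_of_surjective hA (hJ.surjective_lact hΔ hS hSσ hε hQ) fun x => ?_
  obtain ⟨y, rfl⟩ := σ.surjective x
  obtain ⟨a, rfl⟩ := hJ'.surjective_lact hΔ.coop hS' hSσ' hε' hQ' y
  exact ⟨σ a, hQ.ract_eq hA hSσ hSσ' hσ hQ' a⟩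

end CoopTwist

section TwistedHopf

variable {K : Type u} [Field K]
  {A : Type v} [NonUnitalRing A] [Module K A] [IsScalarTower K A A] [SMulCommClass K A A]
  {Δ : A →ₙₐ[K] Mult K (A ⊗[K] A)} {ε : A →ₙₐ[K] K} {S : A →ₗ[K] Mult K A} {σ : A ≃ₗ[K] A}
  {J : (Mult K (A ⊗[K] A))ˣ} {Q : (Mult K A)ˣ}

/-! ### The twisted comultiplication -/

/-- The left action of an invertible multiplier. -/
def lactEquiv (m : (Mult K A)ˣ) : A ≃ₗ[K] A :=
  LinearEquiv.ofLinearMap (lact (m : Mult K A)) (lact (↑m⁻¹ : Mult K A))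
    (by rw [← lact_mul, Units.mul_inv, lact_one]) (by rw [← lact_mul, Units.inv_mul, lact_one])

/-- The right action of an invertible multiplier. -/
def ractEquiv (m : (Mult K A)ˣ) : A ≃ₗ[K] A :=
  LinearEquiv.ofLinearMap (ract (m : Mult K A)) (ract (↑m⁻¹ : Mult K A))
    (by rw [← ract_mul', Units.inv_mul, ract_one]) (by rw [← ract_mul', Units.mul_inv, ract_one])

/-- A coassociative comultiplication defines a multiplier Hopf algebra if its canonical maps are
given by automorphisms of the vector space `A ⊗ A`. -/
theorem isMultiplierHopf_of_equiv (hA : Nondegenerate A) (e₁ e₂ : A ⊗[K] A ≃ₗ[K] A ⊗[K] A)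
    (h₁ : ∀ a b : A, emb K (A ⊗[K] A) (e₁ (a ⊗ₜ b)) = Δ a * rightLeg K A A (emb K A b))
    (h₂ : ∀ a b : A, emb K (A ⊗[K] A) (e₂ (a ⊗ₜ b)) = leftLeg K A A (emb K A a) * Δ b)
    (hcoassoc : ∀ (a b c : A) (z w : A ⊗[K] A),
      emb K (A ⊗[K] A) z = Δ b * rightLeg K A A (emb K A c) →
      emb K (A ⊗[K] A) w = leftLeg K A A (emb K A a) * Δ b →
      leftLeg K (A ⊗[K] A) A (leftLeg K A A (emb K A a)) * comulLeft Δ z =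
        comulRight Δ w * rightLeg K (A ⊗[K] A) A (emb K A c)) : IsMultiplierHopf Δ := by
  have hinj : Function.Injective (emb K (A ⊗[K] A)) := emb_injective (hA.tensor hA)
  have h₁' : T₁ Δ = (emb K (A ⊗[K] A) : A ⊗[K] A →ₗ[K] Mult K (A ⊗[K] A)) ∘ₗ e₁.toLinearMap :=
    TensorProduct.ext' fun a b => (h₁ a b).symm
  have h₂' : T₂ Δ = (emb K (A ⊗[K] A) : A ⊗[K] A →ₗ[K] Mult K (A ⊗[K] A)) ∘ₗ e₂.toLinearMap :=
    TensorProduct.ext' fun a b => (h₂ a b).symm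
  exact
    { nondegenerate := hA
      mem₁ := fun a b => ⟨_, h₁ a b⟩
      mem₂ := fun a b => ⟨_, h₂ a b⟩
      coassoc := hcoassoc
      injective₁ := by rw [h₁']; exact hinj.comp e₁.injective
      range₁ := by rw [h₁', LinearMap.range_comp_of_range_eq_top _ e₁.range]
      injective₂ := by rw [h₂']; exact hinj.comp e₂.injective
      range₂ := by rw [h₂', LinearMap.range_comp_of_range_eq_top _ e₂.range] }

theorem twistComul_apply (a : A) :
    twistComul Δ J a = (↑J⁻¹ : Mult K (A ⊗[K] A)) * Δ a * J := rfl

theorem comulLeft_twistComul (hΔ : IsMultiplierHopf Δ) (hε : IsCounit Δ ε) (z : A ⊗[K] A) :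
    comulLeft (twistComul Δ J) z = leftLeg K (A ⊗[K] A) A (↑J⁻¹ : Mult K (A ⊗[K] A)) *
      comulLeftMult hΔ hε (emb K (A ⊗[K] A) z) * leftLeg K (A ⊗[K] A) A J := by
  rw [comulLeftMult_emb]
  induction z with
  | zero => simp
  | add x y hx hy => simp only [map_add, mul_add, add_mul, hx, hy]
  | tmul a b =>
    rw [comulLeft_tmul, comulLeft_tmul, twistComul_apply,
      leftLeg_apply (A := A ⊗[K] A) (B := A), leftLeg_apply (A := A ⊗[K] A) (B := A), mtprod_mul,
      mtprod_mul, one_mul, mul_one]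

theorem comulRight_twistComul (hΔ : IsMultiplierHopf Δ) (hε : IsCounit Δ ε) (z : A ⊗[K] A) :
    comulRight (twistComul Δ J) z =
      assocMult (rightLeg K A (A ⊗[K] A) (↑J⁻¹ : Mult K (A ⊗[K] A))) *
        comulRightMult hΔ hε (emb K (A ⊗[K] A) z) * assocMult (rightLeg K A (A ⊗[K] A) J) := by
  rw [comulRightMult_emb]
  induction z with
  | zero => simp
  | add x y hx hy => simp only [map_add, mul_add, add_mul, hx, hy]
  | tmul a b =>
    rw [comulRight_tmul, comulRight_tmul, twistComul_apply, ← map_mul, ← map_mul,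
      rightLeg_apply (A := A) (B := A ⊗[K] A), rightLeg_apply (A := A) (B := A ⊗[K] A), mtprod_mul,
      mtprod_mul, one_mul, mul_one]

theorem IsGeneralTwist.coassoc (hΔ : IsMultiplierHopf Δ) (hε : IsCounit Δ ε)
    (hJ : IsGeneralTwist Δ ε J) (a b c : A) (z w : A ⊗[K] A)
    (hz : emb K (A ⊗[K] A) z = twistComul Δ J b * rightLeg K A A (emb K A c))
    (hw : emb K (A ⊗[K] A) w = leftLeg K A A (emb K A a) * twistComul Δ J b) :
    leftLeg K (A ⊗[K] A) A (leftLeg K A A (emb K A a)) * comulLeft (twistComul Δ J) z =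
      comulRight (twistComul Δ J) w * rightLeg K (A ⊗[K] A) A (emb K A c) := by
  let U : (Mult K ((A ⊗[K] A) ⊗[K] A))ˣ := Units.map (comulLeftMult hΔ hε) J *
    Units.map (leftLeg K (A ⊗[K] A) A) J
  let V : (Mult K ((A ⊗[K] A) ⊗[K] A))ˣ := Units.map (comulRightMult hΔ hε) J *
    Units.map (assocMult.comp (rightLeg K A (A ⊗[K] A))) J
  have hUV : U = V := Units.ext (hJ.comulLeftMult_mul_leftLeg hΔ hε)
  have hl : comulLeft (twistComul Δ J) z =
      ↑U⁻¹ * comulLeftMult hΔ hε (Δ b) * U * rightLeg K (A ⊗[K] A) A (emb K A c) := by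
    have hU : (↑U⁻¹ : Mult K ((A ⊗[K] A) ⊗[K] A)) =
      leftLeg K (A ⊗[K] A) A (↑J⁻¹ : Mult K (A ⊗[K] A)) *
        comulLeftMult hΔ hε (↑J⁻¹ : Mult K (A ⊗[K] A)) := rfl
    have hU' : (U : Mult K ((A ⊗[K] A) ⊗[K] A)) =
      comulLeftMult hΔ hε J * leftLeg K (A ⊗[K] A) A J := rfl
    rw [comulLeft_twistComul hΔ hε, hz, twistComul_apply, hU, hU']
    simp only [map_mul, mul_assoc, comulLeftMult_rightLeg]
    rw [leftLeg_mul_rightLeg, rightLeg_mul_leftLeg]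
  have hr : comulRight (twistComul Δ J) w =
      leftLeg K (A ⊗[K] A) A (leftLeg K A A (emb K A a)) *
        (↑V⁻¹ * comulRightMult hΔ hε (Δ b) * V) := by
    have hV : (↑V⁻¹ : Mult K ((A ⊗[K] A) ⊗[K] A)) =
      assocMult (rightLeg K A (A ⊗[K] A) (↑J⁻¹ : Mult K (A ⊗[K] A))) *
        comulRightMult hΔ hε (↑J⁻¹ : Mult K (A ⊗[K] A)) := rfl
    have hV' : (V : Mult K ((A ⊗[K] A) ⊗[K] A)) =
      comulRightMult hΔ hε J * assocMult (rightLeg K A (A ⊗[K] A) J) := rfl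
    rw [comulRight_twistComul hΔ hε, hw, twistComul_apply, hV, hV']
    simp only [map_mul, ← mul_assoc, comulRightMult_leftLeg]
    rw [← assocMult_leftLeg, ← map_mul, ← map_mul, leftLeg_mul_rightLeg, rightLeg_mul_leftLeg]
  rw [hl, hr, hUV, comulLeftMult_comul]
  simp only [mul_assoc]

theorem exists_emb_eq_comul_mul (hΔ : IsMultiplierHopf Δ) (hJ : IsGeneralTwist Δ ε J) (a b : A) :
    ∃ x, emb K (A ⊗[K] A) x = Δ a * J * rightLeg K A A (emb K A b) := by
  obtain ⟨t, ht⟩ := hJ.mul_right_mem b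
  change multTensorMap K A t = J * rightLeg K A A (emb K A b) at ht
  rw [mul_assoc, ← ht]
  clear ht
  induction t with
  | zero => exact ⟨0, by simp⟩
  | add x y hx hy =>
    obtain ⟨p, hp⟩ := hx
    obtain ⟨q, hq⟩ := hy
    exact ⟨p + q, by rw [map_add, hp, hq, map_add, mul_add]⟩
  | tmul m d =>
    exact ⟨ract (leftLeg K A A m) (hΔ.canon₁ (a ⊗ₜ d)), by
      rw [← emb_mul, hΔ.emb_canon₁_tmul, mul_assoc, rightLeg_mul_leftLeg, multTensorMap_tmul]⟩

/-- The twisted comultiplication defines a multiplier Hopf algebra: the canonical maps of `Δ^J` are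
composed of those of `Δ`, the bijection `S`, and the actions of the units `J` and `Q`. -/
theorem IsGeneralTwist.isMultiplierHopf (hΔ : IsMultiplierHopf Δ) (hε : IsCounit Δ ε)
    (hS : IsAntipode Δ ε S) (hσ : ∀ a, S a = emb K A (σ a)) (hJ : IsGeneralTwist Δ ε J)
    (hQ : IsContraction S J Q) : IsMultiplierHopf (twistComul Δ J) := by
  let e₁ : A ⊗[K] A ≃ₗ[K] A ⊗[K] A :=
    (LinearEquiv.lTensor A ((lactEquiv Q).trans σ.symm)).trans ((ractEquiv J).symm.trans
      ((LinearEquiv.lTensor A σ).trans (hΔ.canon₁.trans (lactEquiv J).symm)))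
  let e₂ : A ⊗[K] A ≃ₗ[K] A ⊗[K] A :=
    (LinearEquiv.rTensor A ((ractEquiv Q).symm.trans σ.symm)).trans ((lactEquiv J).trans
      ((LinearEquiv.rTensor A σ).trans (hΔ.canon₂.trans (ractEquiv J))))
  refine isMultiplierHopf_of_equiv hΔ.nondegenerate e₁ e₂ (fun a b => ?_) (fun a b => ?_)
    (hJ.coassoc hΔ hε)
  · obtain ⟨x, hx⟩ := exists_emb_eq_comul_mul hΔ hJ a b
    have h := hJ.ract_canon₁_symm hΔ hS hσ hε hQ a b x hx
    have he : e₁ (a ⊗ₜ b) = lact (↑J⁻¹ : Mult K (A ⊗[K] A)) x := by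
      change (lactEquiv J).symm (hΔ.canon₁ (LinearEquiv.lTensor A σ
        ((ractEquiv J).symm (a ⊗ₜ σ.symm (lact (Q : Mult K A) b))))) = (lactEquiv J).symm x
      rw [← h]
      congr 1
      rw [← LinearEquiv.eq_symm_apply, ← LinearEquiv.eq_symm_apply]
      exact (ractEquiv J).symm_apply_apply _
    rw [he, ← mul_emb, hx, twistComul_apply]
    simp only [mul_assoc]
  · obtain ⟨a, rfl⟩ := (ractEquiv Q).surjective a
    obtain ⟨a, rfl⟩ := σ.surjective a
    have he : e₂ (ractEquiv Q (σ a) ⊗ₜ b) = ract (J : Mult K (A ⊗[K] A))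
        (hΔ.canon₂ (LinearEquiv.rTensor A σ (lact (J : Mult K (A ⊗[K] A)) (a ⊗ₜ b)))) := by
      change ractEquiv J (hΔ.canon₂ (LinearEquiv.rTensor A σ (lactEquiv J
        (σ.symm ((ractEquiv Q).symm (ractEquiv Q (σ a))) ⊗ₜ b)))) = _
      rw [LinearEquiv.symm_apply_apply, LinearEquiv.symm_apply_apply]
      rfl
    rw [he, ← emb_mul, hJ.emb_canon₂ hΔ hS hσ hε hQ, hσ, emb_mul, twistComul_apply]
    simp only [mul_assoc]
    rfl

theorem IsGeneralTwist.counitLeftMult_inv (hΔ : IsMultiplierHopf Δ) (hε : IsCounit Δ ε)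
    (hJ : IsGeneralTwist Δ ε J) :
    counitLeftMult hΔ hε (↑J⁻¹ : Mult K (A ⊗[K] A)) = 1 := by
  have h := congrArg (counitLeftMult hΔ hε) J.inv_mul
  rwa [map_mul, hJ.counitLeftMult_eq_one hΔ hε, mul_one, map_one] at h

theorem IsGeneralTwist.counitRightMult_inv (hΔ : IsMultiplierHopf Δ) (hε : IsCounit Δ ε)
    (hJ : IsGeneralTwist Δ ε J) :
    counitRightMult hΔ hε (↑J⁻¹ : Mult K (A ⊗[K] A)) = 1 := by
  have h := congrArg (counitRightMult hΔ hε) J.inv_mul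
  rwa [map_mul, hJ.counitRightMult_eq_one hΔ hε, mul_one, map_one] at h

theorem IsGeneralTwist.isCounit (hΔ : IsMultiplierHopf Δ) (hε : IsCounit Δ ε)
    (hJ : IsGeneralTwist Δ ε J) : IsCounit (twistComul Δ J) ε where
  left a b z hz := by
    apply emb_injective (K := K) hΔ.nondegenerate
    rw [← counitLeftMult_emb hΔ hε, hz, ← rightLeg_apply, twistComul_apply, map_mul, map_mul,
      map_mul, hJ.counitLeftMult_inv hΔ hε, hJ.counitLeftMult_eq_one hΔ hε, counitLeftMult_rightLeg,
      counitLeftMult_comul, one_mul, mul_one, map_mul]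
  right a b z hz := by
    apply emb_injective (K := K) hΔ.nondegenerate
    rw [← counitRightMult_emb hΔ hε, hz, ← leftLeg_apply, twistComul_apply, map_mul, map_mul,
      map_mul, hJ.counitRightMult_inv hΔ hε, hJ.counitRightMult_eq_one hΔ hε,
      counitRightMult_leftLeg, counitRightMult_comul, one_mul, mul_one, map_mul]

theorem coop_twistComul : coop (twistComul Δ J) = twistComul (coop Δ) (flipUnit J) := by
  ext a
  rw [coop_apply, twistComul_apply, twistComul_apply, map_mul, map_mul]
  rfl

/-- The antipode of the twisted multiplier Hopf algebra. -/
theorem IsGeneralTwist.isAntipode (hΔ : IsMultiplierHopf Δ) (hε : IsCounit Δ ε)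
    (hS : IsAntipode Δ ε S) (hσ : ∀ a, S a = emb K A (σ a)) (hJ : IsGeneralTwist Δ ε J)
    (hQ : IsContraction S J Q) : IsAntipode (twistComul Δ J) ε (twistAntipode S Q) := by
  have hA := hΔ.nondegenerate
  have hΔJ := hJ.isMultiplierHopf hΔ hε hS hσ hQ
  have hεJ := hJ.isCounit hΔ hε
  suffices h : twistAntipode S Q = antipodeMap hΔJ hεJ by
    rw [h]
    exact isAntipode_antipodeMap hΔJ hεJ
  refine eq_antipodeMap hΔJ hεJ fun a b => ?_
  have h1 : ∀ z, contractLeft (twistAntipode S Q) z =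
      lact (↑Q⁻¹ : Mult K A) (contractLeft S (lact (J : Mult K (A ⊗[K] A)) z)) := by
    intro z
    induction z with
    | zero => simp
    | add x y hx hy => simp only [map_add, hx, hy]
    | tmul x y =>
      rw [hQ, lact_lact, ← mul_assoc]
      rfl
  have h2 : contractLeft S (lact (J : Mult K (A ⊗[K] A)) (hΔJ.canon₁ (a ⊗ₜ b))) =
      ε a • lact (Q : Mult K A) b := by
    rw [← sub_eq_zero]
    refine hA.right _ fun c => ?_
    obtain ⟨c, rfl⟩ := σ.surjective c
    have h3 : ract (leftLeg K A A (emb K A c))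
        (lact (J : Mult K (A ⊗[K] A)) (hΔJ.canon₁ (a ⊗ₜ b))) =
          lact (Δ a) (lact (J : Mult K (A ⊗[K] A)) (c ⊗ₜ b)) := by
      apply emb_injective (K := K) hΔ.nondegenerate₂
      rw [← emb_mul, ← mul_emb, ← mul_emb, ← mul_emb, hΔJ.emb_canon₁_tmul, twistComul_apply,
        ← mtprod_emb, ← rightLeg_mul_leftLeg]
      simp only [← mul_assoc]
      rw [Units.mul_inv, one_mul]
    have h4 := hS.contractLeft_ract_leftLeg c
      (lact (J : Mult K (A ⊗[K] A)) (hΔJ.canon₁ (a ⊗ₜ b)))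
    rw [h3, hS.contractLeft_lact_comul hΔ, hQ, hσ, lact_mul, LinearMap.comp_apply, lact_emb,
      lact_emb] at h4
    rw [mul_sub, sub_eq_zero, ← h4, mul_smul_comm]
  rw [h1, h2, map_smul, lact_lact, Units.inv_mul, lact_one, LinearMap.id_apply]

end TwistedHopf

end MulHopf

end

open MulHopf in
theorem proposition2p4 {K : Type*} [Field K] {A : Type*} [NonUnitalRing A] [Module K A]
    [IsScalarTower K A A] [SMulCommClass K A A]
    (Δ : A →ₙₐ[K] Mult K (A ⊗[K] A)) (hΔ : IsRegularMultiplierHopf Δ)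
    (ε : A →ₙₐ[K] K) (hε : IsCounit Δ ε)
    (S : A →ₗ[K] Mult K A) (hS : IsAntipode Δ ε S)
    (J : (Mult K (A ⊗[K] A))ˣ) (hJ : IsGeneralTwist Δ ε J) :
    IsRegularMultiplierHopf (twistComul Δ J) ∧
    IsCounit (twistComul Δ J) ε ∧
    ∃ Q : (Mult K A)ˣ,
      (∀ X : Mult K A, IsTwistMultiplier S (J : Mult K (A ⊗[K] A)) X ↔ X = Q) ∧
      IsAntipode (twistComul Δ J) ε (twistAntipode S Q) := by
  have hΔ₁ := hΔ.isMultiplierHopf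
  have hΔ₂ := hΔ.coop_isMultiplierHopf
  have hA := hΔ₁.nondegenerate
  have hε₂ := hε.coop hΔ₁
  have hJ₂ := hJ.coop hΔ hε
  have hS₂ := isAntipode_antipodeMap hΔ₂ hε₂
  obtain ⟨σ, hσ, hσ₂⟩ := hS.exists_linearEquiv hΔ hε hS₂
  obtain ⟨Q₀, hQ⟩ := exists_isContraction hA hσ (antipode_equiv_mul hA hS hσ)
    hJ.mul_right_mem hJ.mul_left_mem
  obtain ⟨Q, rfl⟩ := hJ.isUnit hΔ hε hS hS₂ hσ hσ₂ hQ
  -- the same data for the co-opposite comultiplication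
  obtain ⟨P₀, hP⟩ := exists_isContraction hA hσ₂ (antipode_equiv_mul hA hS₂ hσ₂)
    hJ₂.mul_right_mem hJ₂.mul_left_mem
  obtain ⟨P, rfl⟩ := hJ₂.isUnit hΔ.coop hε₂ hS₂ (S' := S) (by rwa [coop_coop]) hσ₂ hσ hP
  have hT := hQ.isTwistMultiplier hA hσ (antipode_equiv_mul hA hS hσ)
  refine ⟨⟨hJ.isMultiplierHopf hΔ₁ hε hS hσ hQ, ?_⟩, hJ.isCounit hΔ₁ hε, Q,
    fun X => ⟨fun hX => ?_, ?_⟩, hJ.isAntipode hΔ₁ hε hS hσ hQ⟩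
  · rw [coop_twistComul]
    exact hJ₂.isMultiplierHopf hΔ₂ hε₂ hS₂ hσ₂ hP
  · exact hX.eq hA hJ.mul_right_mem hT
  · rintro rfl
    exact hT
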